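/- Setting. Let $m,k\ge 1$, $D=mk$, let $A\in\mathbb R^{m\times m}$, $B\in\mathbb R^{m\times k}$, let $Q\in\mathbb R^{m\times m}$, $R\in\mathbb R^{k\times k}$ be positive definite, $0<\gamma\le 1$, and let $\mathcal D_0$ be a distribution on $\mathbb R^m$ such that $s_0\sim\mathcal D_0$ has $\mathbb E[s_0]=0$, $\mathbb E[s_0s_0^\top]=I$ and $\|s_0\|_2^2\le C_m$ almost surely. For a policy $K\in\mathbb R^{k\times m}$ put $C(K;s_0)=\sum_{t\ge 0}\gamma^t(s_t^\top Qs_t+a_t^\top Ra_t)\in[0,\infty]$, where $a_t=-Ks_t$ and $s_{t+1}=As_t+Ba_t$, and $C(K)=\mathbb E_{s_0\sim\mathcal D_0}[C(K;s_0)]$. Let $K_0$ be a policy with $C(K_0)<\infty$. All norms and gradients in $K$ are with respect to the Frobenius inner product. A global minimizer of $C$ exists; let $K^*$ be one, and let $\Delta_0=C(K_0)-C(K^*)$ and $\mathcal G=\{K: C(K)<\infty,\ C(K)-C(K^*)\le 10\Delta_0\}$. There exist positive numbers $\phi_K,\beta_K,\lambda_K,\zeta_K$ $(K\in\mathcal G)$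 and $\mu>0$ such that * for all $K\in\mathcal G$ and all $K'$ with $\|K'-K\|\le\beta_K$: $C$ is finite and continuously differentiable at $K'$ and $\|\nabla C(K')-\nabla C(K)\|\le\phi_K\|K'-K\|$; * for all $K\in\mathcal G$: all $K'$ with $\|K'-K\|\le\zeta_K$ satisfy $C(K')<\infty$ and $|C(K')-C(K)|\le\lambda_K\|K'-K\|$, and, for $\mathcal D_0$-almost every $s_0$, they satisfy $C(K';s_0)<\infty$ and $|C(K';s_0)-C(K;s_0)|\le\lambda_K\|K'-K\|$; * wherever $C$ is finite, it is continuously differentiable and $\|\nabla C(K)\|^2\ge\mu\,(C(K)-C(K^*))$; * $\phi=\sup_{K\in\mathcal G}\phi_K<\infty$, $\lambda=\sup_{K\in\mathcal G}\lambda_K<\infty$ and $\rho=\inf_{K\in\mathcal G}\min\{\beta_K,\zeta_K\}>0$. Fix any such choice, put $\theta=\min\{\frac1{2\phi},\frac{\rho}{\lambda}\}$, and let $\epsilon>0$ satisfy $\epsilon\log(120\Delta_0/\epsilon)<\frac{10}{3}\Delta_0$. Let $$0<\eta\le\min\Big\{\frac{\epsilon\mu}{240\,\phi D\lambda^2},\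 \frac1{2\phi},\ \frac{\rho}{D\lambda}\Big\},\qquad 0<r\le\min\Big\{\frac{\theta\mu}{8\phi}\sqrt{\frac{\epsilon}{15}},\ \frac1{2\phi}\sqrt{\frac{\epsilon\mu}{30}},\ \rho\Big\},$$ and $T=\max\{0,\lceil\frac{4}{\eta\mu}\log\frac{120\Delta_0}{\epsilon}\rceil\}$. Consider the two-point zero-order method $$K_{t+1}=K_t-\eta\,\big[C(K_t+ru_t;s_0^{(t)})-C(K_t-ru_t;s_0^{(t)})\big]\frac{D}{2r}\,u_t ,$$ where the pairs $(u_t,s_0^{(t)})$ are independent, $u_t$ is uniform on the unit sphere of $\mathbb R^{k\times m}$, $s_0^{(t)}\sim\mathcal D_0$ is independent of $u_t$, and both evaluations in step $t$ share the same initial state $s_0^{(t)}$. Then with probability greater than $3/4$ all cost evaluations in the first $T$ steps are finite and $$C(K_T)-C(K^*)\le\epsilon .$$ If $\eta$ equals its largest allowed value, then the number $T$ of two-point queries satisfies $$T\le\frac4\mu\Big(\frac{240\phi\lambda^2}{\mu}+2\phi\epsilon+\frac{\lambda\epsilon}{\rho}\Big)\frac{D}{\epsilon}\max\Big\{0,\log\frac{120\Delta_0}{\epsilon}\Big\}+1,$$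 that is, $T=\widetilde O(1/\epsilon)$ with linear dependence on $D$. -/

import Mathlib

open MeasureTheory ProbabilityTheory Matrix
open scoped ENNReal

namespace LQR

/-- States of an `m`-dimensional linear system. The Euclidean inner product is `⬝ᵥ`, so the squared
Euclidean norm of `s` is `s ⬝ᵥ s`. -/
abbrev State (m : ℕ) : Type := Fin m → ℝ

/-- Linear policies, i.e. real `k × m` matrices. The norm, the inner product and the volume of this
Euclidean space are those of the Frobenius inner product. -/
abbrev Policy (m k : ℕ) : Type := EuclideanSpace ℝ (Fin k × Fin m)

/-- The matrix of a policy. -/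
def Policy.mat {m k : ℕ} (K : Policy m k) : Matrix (Fin k) (Fin m) ℝ :=
  Matrix.of fun i j => K (i, j)

/-- A discounted linear quadratic system: transition matrices `A`, `B`, positive definite cost
matrices `Q`, `R`, and a discount factor `0 < γ ≤ 1`. -/
structure System (m k : ℕ) where
  A : Matrix (Fin m) (Fin m) ℝ
  B : Matrix (Fin m) (Fin k) ℝ
  Q : Matrix (Fin m) (Fin m) ℝ
  R : Matrix (Fin k) (Fin k) ℝ
  γ : ℝ
  Q_posDef : Q.PosDef
  R_posDef : R.PosDef
  γ_pos : 0 < γ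
  γ_le_one : γ ≤ 1

/-- The control `a = -K s` that the policy `K` applies in the state `s`. -/
def control {m k : ℕ} (K : Policy m k) (s : State m) : Fin k → ℝ :=
  -(K.mat *ᵥ s)

/-- The distribution of the initial state: mean zero, identity covariance, and squared Euclidean
norm at most `Cm` almost surely. -/
structure IsInitialLaw {m : ℕ} (ν : Measure (State m)) (Cm : ℝ) : Prop where
  isProb : IsProbabilityMeasure ν
  mean_zero : ∀ i, ∫ s, s i ∂ν = 0
  covariance : ∀ i j, ∫ s, s i * s j ∂ν = (1 : Matrix (Fin m) (Fin m) ℝ) i j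
  bounded : ∀ᵐ s ∂ν, s ⬝ᵥ s ≤ Cm

namespace System

variable {m k : ℕ}

/-- The noiseless trajectory `s_{t+1} = A s_t + B a_t`, `a_t = -K s_t`, started at `s₀`. -/
def trajectory (S : System m k) (K : Policy m k) (s₀ : State m) : ℕ → State m
  | 0 => s₀
  | t + 1 => S.A *ᵥ S.trajectory K s₀ t + S.B *ᵥ control K (S.trajectory K s₀ t)

/-- The quadratic stage cost `sᵀ Q s + aᵀ R a`. -/
def stageCost (S : System m k) (s : State m) (a : Fin k → ℝ) : ℝ :=
  s ⬝ᵥ (S.Q *ᵥ s) + a ⬝ᵥ (S.R *ᵥ a)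

/-- The sample cost `C(K; s₀) = ∑ₜ γᵗ (sₜᵀ Q sₜ + aₜᵀ R aₜ)`, possibly infinite. -/
noncomputable def sampleCost (S : System m k) (K : Policy m k) (s₀ : State m) : ℝ≥0∞ :=
  ∑' t : ℕ, ENNReal.ofReal
    (S.γ ^ t * S.stageCost (S.trajectory K s₀ t) (control K (S.trajectory K s₀ t)))

/-- The population cost `C(K) = 𝔼 [C(K; s₀)]`, possibly infinite. -/
noncomputable def cost (S : System m k) (ν : Measure (State m)) (K : Policy m k) : ℝ≥0∞ :=
  ∫⁻ s₀, S.sampleCost K s₀ ∂ν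

/-- `Kstar` is a global minimizer of the population cost. -/
def IsOptimal (S : System m k) (ν : Measure (State m)) (Kstar : Policy m k) : Prop :=
  ∀ K, S.cost ν Kstar ≤ S.cost ν K

/-- The gap `C(K) - C(Kstar)`, meaningful for policies of finite cost. -/
noncomputable def gap (S : System m k) (ν : Measure (State m)) (Kstar K : Policy m k) : ℝ :=
  (S.cost ν K).toReal - (S.cost ν Kstar).toReal

/-- The policies whose gap is at most ten times the gap of `K₀`. -/
def boundedSet (S : System m k) (ν : Measure (State m)) (Kstar K₀ : Policy m k) :
    Set (Policy m k) :=
  {K | S.cost ν K ≠ ⊤ ∧ S.gap ν Kstar K ≤ 10 * S.gap ν Kstar K₀}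

end System

/-- `f` has `(φ, β)` locally Lipschitz gradients at `x`: on the closed ball of radius `β` around `x`
it is finite and continuously differentiable, and `‖∇f(y) - ∇f(x)‖ ≤ φ ‖y - x‖`. -/
def HasLocallyLipschitzGradientAt {E : Type*} [NormedAddCommGroup E] [InnerProductSpace ℝ E]
    [CompleteSpace E] (f : E → ℝ≥0∞) (φ β : ℝ) (x : E) : Prop :=
  ∀ y, ‖y - x‖ ≤ β → f y ≠ ⊤ ∧ ContDiffAt ℝ 1 (fun z => (f z).toReal) y ∧
    ‖gradient (fun z => (f z).toReal) y - gradient (fun z => (f z).toReal) x‖ ≤ φ * ‖y - x‖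

/-- `f` is `(lam, ζ)` locally Lipschitz at `x`: on the closed ball of radius `ζ` around `x` it is
finite and `|f(y) - f(x)| ≤ lam ‖y - x‖`. -/
def IsLocallyLipschitzAt {E : Type*} [NormedAddCommGroup E]
    (f : E → ℝ≥0∞) (lam ζ : ℝ) (x : E) : Prop :=
  ∀ y, ‖y - x‖ ≤ ζ → f y ≠ ⊤ ∧ |(f y).toReal - (f x).toReal| ≤ lam * ‖y - x‖

/-- `f`, with global minimizer `xstar`, satisfies the Polyak-Łojasiewicz inequality with constant
`μ` at all points at which it is finite. -/
def IsPL {E : Type*} [NormedAddCommGroup E] [InnerProductSpace ℝ E] [CompleteSpace E]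
    (f : E → ℝ≥0∞) (xstar : E) (μ : ℝ) : Prop :=
  0 < μ ∧ ∀ x, f x ≠ ⊤ → ContDiffAt ℝ 1 (fun z => (f z).toReal) x ∧
    μ * ((f x).toReal - (f xstar).toReal) ≤ ‖gradient (fun z => (f z).toReal) x‖ ^ 2

/-- The curvature parameters of the problem. At each policy `K` of the bounded set, the population
cost has `(φK K, βK K)` locally Lipschitz gradients, and the population cost as well as almost every
sample cost is `(lamK K, ζK K)` locally Lipschitz. The number `φ` is the supremum of `φK`, `lam` the
supremum of `lamK`, and `ρ` the infimum of `min βK ζK` over the bounded set, where the suprema are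
finite and the infimum is positive; `μ` is a PL constant of the population cost. -/
structure IsCurvature {m k : ℕ} (S : System m k) (ν : Measure (State m)) (Kstar K₀ : Policy m k)
    (φK βK lamK ζK : Policy m k → ℝ) (φ lam ρ μ : ℝ) : Prop where
  pos : ∀ K ∈ S.boundedSet ν Kstar K₀, 0 < φK K ∧ 0 < βK K ∧ 0 < lamK K ∧ 0 < ζK K
  smooth : ∀ K ∈ S.boundedSet ν Kstar K₀,
    HasLocallyLipschitzGradientAt (S.cost ν) (φK K) (βK K) K
  lipschitz : ∀ K ∈ S.boundedSet ν Kstar K₀, IsLocallyLipschitzAt (S.cost ν) (lamK K) (ζK K) K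
  lipschitz_sample : ∀ K ∈ S.boundedSet ν Kstar K₀,
    ∀ᵐ s₀ ∂ν, IsLocallyLipschitzAt (fun K' => S.sampleCost K' s₀) (lamK K) (ζK K) K
  isLUB_φ : IsLUB (φK '' S.boundedSet ν Kstar K₀) φ
  isLUB_lam : IsLUB (lamK '' S.boundedSet ν Kstar K₀) lam
  isGLB_ρ : IsGLB ((fun K => min (βK K) (ζK K)) '' S.boundedSet ν Kstar K₀) ρ
  ρ_pos : 0 < ρ
  pl : IsPL (S.cost ν) Kstar μ

/-- The uniform distribution on the Frobenius unit sphere of the space of policies: the normalized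
surface measure, as a measure on the ambient space. -/
noncomputable def uniformSphere (m k : ℕ) : Measure (Policy m k) :=
  (((volume : Measure (Policy m k)).toSphere Set.univ)⁻¹ •
    (volume : Measure (Policy m k)).toSphere).map Subtype.val

/-- The two-point gradient estimate
`[C(K + r u; s₀) - C(K - r u; s₀)] (D / (2 r)) u` with `D = m k`. -/
noncomputable def gradEst {m k : ℕ} (S : System m k) (r : ℝ) (K u : Policy m k) (s₀ : State m) :
    Policy m k :=
  (((S.sampleCost (K + r • u) s₀).toReal - (S.sampleCost (K - r • u) s₀).toReal) *
    (((m : ℝ) * k) / (2 * r))) • u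

/-- The iterates `K_{t+1} = K_t - η g_t` of the two-point zero-order method started at `K₀`, where
`g_t` uses the direction and the initial state in `ξ t = (u_t, s_{0,t})`. -/
noncomputable def iter {m k : ℕ} (S : System m k) (η r : ℝ) (K₀ : Policy m k)
    (ξ : ℕ → Policy m k × State m) : ℕ → Policy m k
  | 0 => K₀
  | t + 1 => iter S η r K₀ ξ t - η • gradEst S r (iter S η r K₀ ξ t) (ξ t).1 (ξ t).2

/-- The largest step size that is allowed, `min {ε μ / (240 φ D lam²), 1 / (2 φ), ρ / (D lam)}`. -/
noncomputable def maxStep (D ε φ lam ρ μ : ℝ) : ℝ :=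
  min (min (ε * μ / (240 * φ * D * lam ^ 2)) (1 / (2 * φ))) (ρ / (D * lam))

/-- The largest smoothing radius that is allowed,
`min {θ μ / (8 φ) √(ε / 15), 1 / (2 φ) √(ε μ / 30), ρ}` with `θ = min {1 / (2 φ), ρ / lam}`. -/
noncomputable def maxRadius (ε φ lam ρ μ : ℝ) : ℝ :=
  min (min (min (1 / (2 * φ)) (ρ / lam) * μ / (8 * φ) * Real.sqrt (ε / 15))
    (1 / (2 * φ) * Real.sqrt (ε * μ / 30))) ρ

/-- The number of iterations `(4 / (η μ)) log (120 Δ₀ / ε)`, rounded up. -/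
noncomputable def numIter (η μ Δ₀ ε : ℝ) : ℕ :=
  ⌈4 / (η * μ) * Real.log (120 * Δ₀ / ε)⌉₊

end LQR

/-! ### The uniform law on the Frobenius sphere: invariance, second moments, bias estimate. -/

namespace LQR

variable {m k : ℕ}

/-! The method is stochastic gradient descent on a cost that satisfies a PL inequality wherever it
is finite, but has uniform smoothness and Lipschitz constants only on the sublevel set of height 10
Δ₀. While the iterate and its perturbations stay there, the quadratic upper bound gives E[gap of
next iterate] ≤ gap - η (‖∇C‖² - φ r ‖∇C‖) + (φ/2) η² E‖g‖² (`lintegral_subopt_step_le`).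

Two facts about the estimate g enter. Its mean has inner product at least ‖∇C‖² - φ r ‖∇C‖ with ∇C
(`le_integral_inner_gradEst`): the linear part of C contributes exactly ‖∇C‖², and the remainder is
(φ r)-Lipschitz on the ball of radius r. Its second moment is at most D λ², one power of D better
than the pointwise bound (D λ)² (`integral_norm_gradEst_sq_le`). The gain is a Poincaré inequality
with sharp dimension dependence for h(y) - h(-y) on the sphere. It is proved on thin shells by
flipping one coordinate at a time and then passed to the sphere by continuity in the radius.

With the given η and r the one-step bound has two forms: the gap is a supermartingale up to a drift
ηεμ/240, and it contracts by 1 - ημ/2 up to ηεμ/160. The first form and a maximal inequality bound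
the probability of leaving the sublevel set of height (9/2) Δ₀ before the last step by 19/81.
Markov's inequality at the last step, applied to the better of the two forms, adds at most
141/10000, and the sum is below 1/4 (`failure_bound_lt`). Perturbations of size r of a policy with
gap at most (9/2) Δ₀ have gap at most 10 Δ₀ (`IsRegular.add_mem_sublevel`); this rests on a converse
of PL, `IsRegular.mul_norm_gradient_sq_le`, whose constant does not involve ρ.

For the existence claims, finite cost means that some power of L = √γ (A - B K) is a contraction
(`cost_ne_top_iff`). There the cost is the trace of the solution of a Stein equation, hence smooth.
Sublevel sets are compact by coercivity and lower semicontinuity, which yields a minimizer and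
uniform constants. PL follows from the performance difference identity by completing a square. -/

lemma policy_nontrivial (hm : 0 < m) (hk : 0 < k) : Nontrivial (Policy m k) := by
  have : Nonempty (Fin k × Fin m) := ⟨(⟨0, hk⟩, ⟨0, hm⟩)⟩
  exact inferInstance

lemma toSphere_univ_ne_zero (hm : 0 < m) (hk : 0 < k) :
    (volume : Measure (Policy m k)).toSphere Set.univ ≠ 0 := by
  have := policy_nontrivial hm hk
  simp only [ne_eq, Measure.measure_univ_eq_zero]
  exact Measure.toSphere_ne_zero _

lemma isProbabilityMeasure_uniformSphere (hm : 0 < m) (hk : 0 < k) :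
    IsProbabilityMeasure (uniformSphere m k) := by
  constructor
  rw [uniformSphere, Measure.map_apply measurable_subtype_coe MeasurableSet.univ]
  simp only [Set.preimage_univ, Measure.smul_apply, smul_eq_mul]
  exact ENNReal.inv_mul_cancel (toSphere_univ_ne_zero hm hk) (measure_ne_top _ _)

lemma ae_norm_uniformSphere : ∀ᵐ u ∂(uniformSphere m k), ‖u‖ = 1 := by
  rw [uniformSphere, ae_map_iff measurable_subtype_coe.aemeasurable
    (measurableSet_eq_fun measurable_norm measurable_const)]
  exact Filter.Eventually.of_forall fun u => by simp

open scoped Pointwise in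
lemma uniformSphere_apply {s : Set (Policy m k)} (hs : MeasurableSet s) :
    uniformSphere m k s = ((volume : Measure (Policy m k)).toSphere Set.univ)⁻¹ *
      (Module.finrank ℝ (Policy m k) *
        volume (Set.Ioo (0 : ℝ) 1 • (s ∩ Metric.sphere (0 : Policy m k) 1))) := by
  rw [uniformSphere, Measure.map_apply measurable_subtype_coe hs, Measure.smul_apply,
    Measure.toSphere_apply' _ (measurable_subtype_coe hs), smul_eq_mul,
    Subtype.image_preimage_coe, Set.inter_comm]

/-- The uniform law on the sphere is invariant under linear isometries. -/
lemma map_uniformSphere (e : Policy m k ≃ₗᵢ[ℝ] Policy m k) :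
    (uniformSphere m k).map e = uniformSphere m k := by
  ext s hs
  have he : Measurable e := e.continuous.measurable
  rw [Measure.map_apply he hs, uniformSphere_apply hs, uniformSphere_apply (he hs)]
  congr 2
  symm
  -- The surface measure of a set is a multiple of the volume of the cone over it; `e` maps cones to
  -- cones and preserves volume.
  rw [← (LinearIsometryEquiv.measurePreserving e).measure_preimage_equiv (f := e.toMeasurableEquiv)]
  congr 1
  ext y
  simp only [Set.mem_smul, Set.mem_preimage, Set.mem_inter_iff, mem_sphere_zero_iff_norm]
  constructor
  · rintro ⟨a, ha, u, ⟨hu, hu1⟩, h⟩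
    refine ⟨a, ha, e.symm u, ⟨by simpa using hu, by simpa using hu1⟩, ?_⟩
    apply e.injective
    simpa using h
  · rintro ⟨a, ha, u, ⟨hu, hu1⟩, rfl⟩
    exact ⟨a, ha, e u, ⟨hu, by simpa using hu1⟩, by simp⟩

lemma measurePreserving_uniformSphere (e : Policy m k ≃ₗᵢ[ℝ] Policy m k) :
    MeasurePreserving e (uniformSphere m k) (uniformSphere m k) :=
  ⟨e.continuous.measurable, map_uniformSphere e⟩

lemma integral_comp_uniformSphere (e : Policy m k ≃ₗᵢ[ℝ] Policy m k) (g : Policy m k → ℝ) :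
    ∫ u, g (e u) ∂(uniformSphere m k) = ∫ u, g u ∂(uniformSphere m k) :=
  (measurePreserving_uniformSphere e).integral_comp' (f := e.toMeasurableEquiv) g

lemma integrable_uniformSphere_of_bound (hm : 0 < m) (hk : 0 < k) {g : Policy m k → ℝ}
    (hg : AEStronglyMeasurable g (uniformSphere m k)) (C : ℝ) (h : ∀ u, ‖u‖ = 1 → |g u| ≤ C) :
    Integrable g (uniformSphere m k) := by
  have := isProbabilityMeasure_uniformSphere hm hk
  refine Integrable.of_bound hg C ?_
  filter_upwards [ae_norm_uniformSphere] with u hu using h u hu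

lemma integrable_inner_sq (hm : 0 < m) (hk : 0 < k) (w : Policy m k) :
    Integrable (fun u => inner ℝ u w ^ 2) (uniformSphere m k) := by
  refine integrable_uniformSphere_of_bound hm hk (by fun_prop) (‖w‖ ^ 2) fun u hu => ?_
  rw [abs_of_nonneg (sq_nonneg _), ← sq_abs]
  have := abs_real_inner_le_norm u w
  rw [hu, one_mul] at this
  gcongr

/-- Second moments of the uniform law on the sphere. -/
lemma integral_inner_sq (hm : 0 < m) (hk : 0 < k) (w : Policy m k) :
    ∫ u, inner ℝ u w ^ 2 ∂(uniformSphere m k) = ‖w‖ ^ 2 / ((m : ℝ) * k) := by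
  have := isProbabilityMeasure_uniformSphere hm hk
  have hunit : ∀ v v' : Policy m k, ‖v‖ = ‖v'‖ →
      ∫ u, inner ℝ u v ^ 2 ∂(uniformSphere m k) = ∫ u, inner ℝ u v' ^ 2 ∂(uniformSphere m k) := by
    intro v v' h
    -- The reflection in the bisecting hyperplane exchanges two vectors of equal norm, so the second
    -- moment depends on the norm alone. Summation over an orthonormal basis scaled by ‖w‖ then
    -- fixes its value.
    have hr : ((ℝ ∙ (v - v'))ᗮ).reflection v = v' := Submodule.reflection_sub h
    rw [← integral_comp_uniformSphere ((ℝ ∙ (v - v'))ᗮ).reflection (fun u => inner ℝ u v' ^ 2)]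
    congr 1
    ext u
    have := LinearIsometryEquiv.inner_map_map ((ℝ ∙ (v - v'))ᗮ).reflection u v
    rw [hr] at this
    rw [this]
  have hsum : ∑ i, ∫ u, inner ℝ u (‖w‖ • EuclideanSpace.basisFun (Fin k × Fin m) ℝ i) ^ 2
      ∂(uniformSphere m k) = ‖w‖ ^ 2 := by
    rw [← integral_finsetSum _ fun i _ => integrable_inner_sq hm hk _]
    rw [integral_congr_ae (g := fun _ => ‖w‖ ^ 2)]
    · simp
    · filter_upwards [ae_norm_uniformSphere] with u hu
      simp only [real_inner_smul_right, mul_pow]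
      rw [← Finset.mul_sum]
      have := (EuclideanSpace.basisFun (Fin k × Fin m) ℝ).sum_sq_norm_inner_left u
      simp only [Real.norm_eq_abs, sq_abs] at this
      rw [this, hu]
      simp
  have hD : ((m : ℝ) * k) ≠ 0 := by positivity
  rw [eq_div_iff hD, ← hsum]
  rw [Finset.sum_congr rfl fun i _ => (hunit _ w (by simp [norm_smul]))]
  simp
  ring

/-- Mean of `(q (r u) - q (-r u)) ⟨u, w⟩` for a function `q` that is `L`-Lipschitz on the ball of
radius `r`. -/
lemma abs_integral_sub_mul_inner_le (hm : 0 < m) (hk : 0 < k) {q : Policy m k → ℝ} {r L : ℝ}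
    (hr : 0 ≤ r) (hL : ∀ y z, ‖y‖ ≤ r → ‖z‖ ≤ r → |q y - q z| ≤ L * ‖y - z‖)
    (hq : Measurable q) (w : Policy m k) :
    |∫ u, (q (r • u) - q (-(r • u))) * inner ℝ u w ∂(uniformSphere m k)| ≤
      2 * r * L * ‖w‖ / ((m : ℝ) * k) := by
  have := isProbabilityMeasure_uniformSphere hm hk
  rcases eq_or_ne w 0 with rfl | hw
  · simp
  have hw' : 0 < ‖w‖ := norm_pos_iff.2 hw
  have hru : ∀ u : Policy m k, ‖u‖ = 1 → ‖r • u‖ ≤ r := fun u hu => by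
    simp [norm_smul, hu, abs_of_nonneg hr]
  have hL0 : ∀ u : Policy m k, ‖u‖ = 1 → 0 ≤ L * r := fun u hu => by
    have := (abs_nonneg _).trans (hL (r • u) 0 (hru u hu) (by simpa using hr))
    simpa [norm_smul, hu, abs_of_nonneg hr] using this
  have hb : ∀ u : Policy m k, ‖u‖ = 1 → |q (r • u)| ≤ L * r + |q 0| := fun u hu => by
    have h1 := hL (r • u) 0 (hru u hu) (by simpa using hr)
    simp only [sub_zero, norm_smul, hu, Real.norm_eq_abs, abs_of_nonneg hr, mul_one] at h1
    have := abs_sub_abs_le_abs_sub (q (r • u)) (q 0)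
    linarith
  have hi : ∀ u : Policy m k, ‖u‖ = 1 → |inner ℝ u w| ≤ ‖w‖ := fun u hu => by
    simpa [hu] using abs_real_inner_le_norm u w
  have hint1 : Integrable (fun u => q (r • u) * inner ℝ u w) (uniformSphere m k) := by
    refine integrable_uniformSphere_of_bound hm hk
      (by apply Measurable.aestronglyMeasurable; fun_prop) ((L * r + |q 0|) * ‖w‖) fun u hu => ?_
    rw [abs_mul]
    exact mul_le_mul (hb u hu) (hi u hu) (abs_nonneg _) (by have := hL0 u hu; positivity)
  have hint2 : Integrable (fun u => q (-(r • u)) * inner ℝ u w) (uniformSphere m k) := by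
    refine integrable_uniformSphere_of_bound hm hk
      (by apply Measurable.aestronglyMeasurable; fun_prop) ((L * r + |q 0|) * ‖w‖) fun u hu => ?_
    rw [abs_mul, ← smul_neg]
    exact mul_le_mul (hb (-u) (by simpa using hu)) (hi u hu) (abs_nonneg _)
      (by have := hL0 u hu; positivity)
  have h1 : ∫ u, q (-(r • u)) * inner ℝ u w ∂(uniformSphere m k) =
      - ∫ u, q (r • u) * inner ℝ u w ∂(uniformSphere m k) := by
    rw [← integral_comp_uniformSphere (LinearIsometryEquiv.neg ℝ), ← integral_neg]
    congr 1
    ext u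
    simp
  -- Both u ↦ -u and the reflection `R` change the sign of ⟨u, w⟩, so -u can be replaced with `R u`
  -- under the integral. The gain is that u - R u has length 2 |⟨u, w⟩| / ‖w‖ instead of 2: the
  -- Lipschitz bound now produces ⟨u, w⟩², whose mean carries the factor 1 / D.
  set R := ((ℝ ∙ w)ᗮ).reflection with hR
  have hRw : R w = -w := Submodule.reflection_orthogonalComplement_singleton_eq_neg w
  have hRin : ∀ u, inner ℝ (R u) w = - inner ℝ u w := fun u => by
    rw [← LinearIsometryEquiv.inner_map_map R u w, hRw, inner_neg_right, neg_neg]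
  have h2 : ∫ u, q (r • R u) * inner ℝ u w ∂(uniformSphere m k) =
      - ∫ u, q (r • u) * inner ℝ u w ∂(uniformSphere m k) := by
    rw [← integral_comp_uniformSphere R (fun u => q (r • u) * inner ℝ u w), ← integral_neg]
    congr 1
    ext u
    rw [hRin]; ring
  have hint3 : Integrable (fun u => q (r • R u) * inner ℝ u w) (uniformSphere m k) := by
    have := ((measurePreserving_uniformSphere R).integrable_comp hint1.aestronglyMeasurable).2
      hint1
    refine this.neg.congr (Filter.Eventually.of_forall fun u => ?_)
    simp [hRin]
  have h3 : ∫ u, (q (r • u) - q (-(r • u))) * inner ℝ u w ∂(uniformSphere m k) =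
      ∫ u, (q (r • u) - q (r • R u)) * inner ℝ u w ∂(uniformSphere m k) := by
    simp only [sub_mul]
    rw [integral_sub hint1 hint2, integral_sub hint1 hint3, h1, h2]
  have hRsub : ∀ u, ‖u - R u‖ = 2 * |inner ℝ u w| / ‖w‖ := fun u => by
    have : u - R u = (2 * (inner ℝ u w / ‖w‖ ^ 2)) • w := by
      rw [hR, Submodule.reflection_orthogonal_apply, Submodule.reflection_singleton_apply]
      rw [real_inner_comm]
      simp only [RCLike.ofReal_real_eq_id, id_eq]
      module
    rw [this, norm_smul]
    simp only [Real.norm_eq_abs, abs_mul, abs_div, abs_pow, abs_norm, abs_two]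
    field_simp
  rw [h3]
  calc |∫ u, (q (r • u) - q (r • R u)) * inner ℝ u w ∂(uniformSphere m k)|
      ≤ ∫ u, (2 * r * L / ‖w‖) * inner ℝ u w ^ 2 ∂(uniformSphere m k) := by
        rw [← Real.norm_eq_abs]
        refine norm_integral_le_of_norm_le ((integrable_inner_sq hm hk w).const_mul _) ?_
        filter_upwards [ae_norm_uniformSphere] with u hu
        rw [Real.norm_eq_abs, abs_mul]
        have := hL (r • u) (r • R u) (hru u hu) (hru _ (by simpa using hu))
        rw [← smul_sub, norm_smul, hRsub, Real.norm_eq_abs, abs_of_nonneg hr] at this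
        calc |q (r • u) - q (r • R u)| * |inner ℝ u w|
            ≤ L * (r * (2 * |inner ℝ u w| / ‖w‖)) * |inner ℝ u w| := by gcongr
          _ = 2 * r * L / ‖w‖ * |inner ℝ u w| ^ 2 := by ring
          _ = _ := by rw [sq_abs]
    _ = _ := by
        rw [integral_const_mul, integral_inner_sq hm hk]
        field_simp

end LQR

/-! ### Coordinate scalings and sign flips, and integration along coordinate segments. -/

namespace LQR

section CoordinateMaps

variable {ι : Type*} [Fintype ι] [DecidableEq ι]

/-- The linear map that multiplies the coordinate `i` by `s`. -/
noncomputable def scaleCoord (i : ι) (s : ℝ) : EuclideanSpace ℝ ι →ₗ[ℝ] EuclideanSpace ℝ ι :=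
  Matrix.toLpLin 2 2 (Matrix.diagonal fun j => if j = i then s else 1)

lemma scaleCoord_apply (i : ι) (s : ℝ) (y : EuclideanSpace ℝ ι) (j : ι) :
    scaleCoord i s y j = (if j = i then s else 1) * y j := by
  simp [scaleCoord, Matrix.toLpLin_apply, Matrix.mulVec_diagonal]

lemma det_scaleCoord (i : ι) (s : ℝ) : LinearMap.det (scaleCoord i s) = s := by
  rw [scaleCoord, Matrix.toLpLin_eq_toLin, LinearMap.det_toLin, Matrix.det_diagonal]
  simp

lemma scaleCoord_eq (i : ι) (s : ℝ) (y : EuclideanSpace ℝ ι) :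
    scaleCoord i s y = y + ((s - 1) * y i) • EuclideanSpace.single i (1 : ℝ) := by
  ext j
  rw [scaleCoord_apply]
  rcases eq_or_ne j i with rfl | h
  · simp; ring
  · simp [h]

lemma norm_sq_scaleCoord (i : ι) (s : ℝ) (y : EuclideanSpace ℝ ι) :
    ‖scaleCoord i s y‖ ^ 2 = ‖y‖ ^ 2 + y i ^ 2 * (s ^ 2 - 1) := by
  rw [scaleCoord_eq, norm_add_sq_real, real_inner_smul_right, norm_smul]
  simp [EuclideanSpace.inner_single_right, mul_pow]
  ring

lemma norm_scaleCoord_le (i : ι) {s : ℝ} (h0 : 0 ≤ s) (h1 : s ≤ 1) (y : EuclideanSpace ℝ ι) :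
    ‖scaleCoord i s y‖ ≤ ‖y‖ := by
  refine le_of_sq_le_sq ?_ (norm_nonneg _)
  rw [norm_sq_scaleCoord]
  nlinarith [mul_nonneg (sq_nonneg (y i)) (sub_nonneg.2 (show s ^ 2 ≤ 1 by nlinarith))]

lemma scaleCoord_inv (i : ι) {s : ℝ} (hs : s ≠ 0) (y : EuclideanSpace ℝ ι) :
    scaleCoord i s⁻¹ (scaleCoord i s y) = y := by
  ext j
  simp only [scaleCoord_apply]
  split_ifs <;> field_simp

/-- The isometry that changes the signs of the coordinates in `s`. -/
noncomputable def flipCoords (s : Finset ι) : EuclideanSpace ℝ ι ≃ₗᵢ[ℝ] EuclideanSpace ℝ ι :=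
  LinearIsometryEquiv.piLpCongrRight 2 fun i =>
    if i ∈ s then LinearIsometryEquiv.neg ℝ else LinearIsometryEquiv.refl ℝ ℝ

lemma flipCoords_apply (s : Finset ι) (y : EuclideanSpace ℝ ι) (j : ι) :
    flipCoords s y j = if j ∈ s then -y j else y j := by
  simp only [flipCoords, LinearIsometryEquiv.piLpCongrRight_apply]
  split_ifs <;> simp [*]

lemma flipCoords_univ (y : EuclideanSpace ℝ ι) : flipCoords Finset.univ y = -y := by
  ext j
  simp [flipCoords_apply]

lemma flipCoords_empty (y : EuclideanSpace ℝ ι) : flipCoords ∅ y = y := by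
  ext j
  simp [flipCoords_apply]

lemma flipCoords_flipCoords (s : Finset ι) (y : EuclideanSpace ℝ ι) :
    flipCoords s (flipCoords s y) = y := by
  ext j
  simp only [flipCoords_apply]
  split_ifs <;> simp

lemma flipCoords_comm (s t : Finset ι) (y : EuclideanSpace ℝ ι) :
    flipCoords s (flipCoords t y) = flipCoords t (flipCoords s y) := by
  ext j
  simp only [flipCoords_apply]
  split_ifs <;> simp

lemma flipCoords_insert {s : Finset ι} {i : ι} (hi : i ∉ s) (y : EuclideanSpace ℝ ι) :
    flipCoords (insert i s) y = flipCoords s (flipCoords {i} y) := by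
  ext j
  simp only [flipCoords_apply, Finset.mem_insert, Finset.mem_singleton]
  by_cases h : j = i
  · subst h; simp [hi]
  · simp [h]

lemma scaleCoord_zero_flipCoords (i : ι) (y : EuclideanSpace ℝ ι) :
    scaleCoord i 0 (flipCoords {i} y) = scaleCoord i 0 y := by
  ext j
  simp only [scaleCoord_apply, flipCoords_apply, Finset.mem_singleton]
  split_ifs <;> simp

end CoordinateMaps

/-- For commuting measure preserving involutions `R` and `S`, the quadratic variation of a function
along `R ∘ S` is at most the sum of those along `R` and `S`. -/
lemma lintegral_sq_sub_comp_le {X : Type*} [MeasurableSpace X] {μ : Measure X} {R S : X → X}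
    (hR : MeasurePreserving R μ μ) (hS : MeasurePreserving S μ μ) (hRR : ∀ x, R (R x) = x)
    (hRS : ∀ x, R (S x) = S (R x)) {h : X → ℝ} (hh : Measurable h) :
    ∫⁻ x, ENNReal.ofReal ((h x - h (R (S x))) ^ 2) ∂μ ≤
      ∫⁻ x, ENNReal.ofReal ((h x - h (R x)) ^ 2) ∂μ +
        ∫⁻ x, ENNReal.ofReal ((h x - h (S x)) ^ 2) ∂μ := by
  have hRm := hR.measurable
  have hSm := hS.measurable
  have e1 : ∫⁻ x, ENNReal.ofReal ((h (R x) - h (S x)) ^ 2) ∂μ =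
      ∫⁻ x, ENNReal.ofReal ((h x - h (R (S x))) ^ 2) ∂μ := by
    rw [← hR.lintegral_comp (by fun_prop : Measurable fun x =>
      ENNReal.ofReal ((h x - h (R (S x))) ^ 2))]
    simp only [hRS, hRR]
  have e2 : ∫⁻ x, ENNReal.ofReal ((h (S x) - h (R (S x))) ^ 2) ∂μ =
      ∫⁻ x, ENNReal.ofReal ((h x - h (R x)) ^ 2) ∂μ :=
    hS.lintegral_comp (by fun_prop : Measurable fun x => ENNReal.ofReal ((h x - h (R x)) ^ 2))
  have e3 : ∫⁻ x, ENNReal.ofReal ((h (R x) - h (R (S x))) ^ 2) ∂μ =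
      ∫⁻ x, ENNReal.ofReal ((h x - h (S x)) ^ 2) ∂μ := by
    simp only [hRS]
    exact hR.lintegral_comp (by fun_prop : Measurable fun x => ENNReal.ofReal ((h x - h (S x)) ^ 2))
  have key : ∫⁻ x, (ENNReal.ofReal ((h x - h (R (S x))) ^ 2) +
        ENNReal.ofReal ((h (R x) - h (S x)) ^ 2)) ∂μ ≤
      ∫⁻ x, ((ENNReal.ofReal ((h x - h (R x)) ^ 2) + ENNReal.ofReal ((h (S x) - h (R (S x))) ^ 2)) +
        (ENNReal.ofReal ((h x - h (S x)) ^ 2) + ENNReal.ofReal ((h (R x) - h (R (S x))) ^ 2))) ∂μ := by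
    refine lintegral_mono fun x => ?_
    simp only
    rw [← ENNReal.ofReal_add (sq_nonneg _) (sq_nonneg _),
      ← ENNReal.ofReal_add (sq_nonneg _) (sq_nonneg _),
      ← ENNReal.ofReal_add (sq_nonneg _) (sq_nonneg _),
      ← ENNReal.ofReal_add (by positivity) (by positivity)]
    refine ENNReal.ofReal_le_ofReal ?_
    -- For the four values at x, R x, R S x, S x the squared diagonals sum to at most the squared
    -- sides, with the square below as defect. By invariance opposite sides have equal integrals,
    -- and so do the two diagonals.
    nlinarith [sq_nonneg (h x - h (R x) - h (S x) + h (R (S x)))]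
  rw [lintegral_add_left (by fun_prop), lintegral_add_left (by fun_prop),
    lintegral_add_left (by fun_prop), lintegral_add_left (by fun_prop), e1, e2, e3, ← two_mul,
    ← two_mul, ← two_mul, ← mul_add] at key
  exact (ENNReal.mul_le_mul_iff_right (by norm_num) (by norm_num)).1 key

section Shell

variable {ι : Type*} [Fintype ι] [DecidableEq ι]

/-- Tensorization: a composition of flips costs only the sum of the single flips. Cauchy-Schwarz on
a telescoping sum would lose a factor equal to the number of flips. -/
lemma lintegral_sq_sub_flipCoords_le {μ : Measure (EuclideanSpace ℝ ι)}
    (hμ : ∀ s, MeasurePreserving (flipCoords s) μ μ) {h : EuclideanSpace ℝ ι → ℝ}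
    (hh : Measurable h) (s : Finset ι) :
    ∫⁻ y, ENNReal.ofReal ((h y - h (flipCoords s y)) ^ 2) ∂μ ≤
      ∑ i ∈ s, ∫⁻ y, ENNReal.ofReal ((h y - h (flipCoords {i} y)) ^ 2) ∂μ := by
  induction s using Finset.induction_on with
  | empty => simp [flipCoords_empty]
  | insert i s hi ih =>
    rw [Finset.sum_insert hi, add_comm]
    simp only [flipCoords_insert hi]
    refine (lintegral_sq_sub_comp_le (hμ s) (hμ {i}) (flipCoords_flipCoords s)
      (flipCoords_comm s {i}) hh).trans ?_
    gcongr

lemma measurable_scaleCoord {X : Type*} [MeasurableSpace X] (i : ι) {f : X → ℝ}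
    {g : X → EuclideanSpace ℝ ι} (hf : Measurable f) (hg : Measurable g) :
    Measurable fun x => scaleCoord i (f x) (g x) := by
  simp only [scaleCoord_eq]
  fun_prop

lemma lintegral_comp_scaleCoord (i : ι) {s : ℝ} (hs : 0 < s) {H : EuclideanSpace ℝ ι → ℝ≥0∞}
    (hH : Measurable H) :
    ∫⁻ y, H (scaleCoord i s y) = ENNReal.ofReal s⁻¹ * ∫⁻ z, H z := by
  have hdet : LinearMap.det (scaleCoord i s) ≠ 0 := by
    rw [det_scaleCoord]; exact hs.ne'
  have hmap := Measure.map_linearMap_addHaar_eq_smul_addHaar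
    (volume : Measure (EuclideanSpace ℝ ι)) hdet
  rw [det_scaleCoord, abs_of_pos (inv_pos.2 hs)] at hmap
  rw [← smul_eq_mul, ← lintegral_smul_measure, ← hmap,
    lintegral_map hH (LinearMap.continuous_of_finiteDimensional _).measurable]

/-- Integration of a function along the segments between `y` and its projection to the
hyperplane `y i = 0`, with a radial weight. -/
lemma lintegral_scaleCoord (i : ι) {w : ℝ → ℝ≥0∞} (hw : Measurable w)
    {G : EuclideanSpace ℝ ι → ℝ≥0∞} (hG : Measurable G) :
    2 * ∫⁻ y, w (‖y‖ ^ 2) * (ENNReal.ofReal (y i ^ 2) *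
        ∫⁻ s in Set.Ioo (0 : ℝ) 1, G (scaleCoord i s y)) =
      ∫⁻ z, G z * ∫⁻ p in Set.Ioi (‖z‖ ^ 2), w p := by
  have hcoord : Measurable fun y : EuclideanSpace ℝ ι => y i := by fun_prop
  have hwn : Measurable fun y : EuclideanSpace ℝ ι => w (‖y‖ ^ 2) := by fun_prop
  have h1 : ∀ y : EuclideanSpace ℝ ι, w (‖y‖ ^ 2) * (ENNReal.ofReal (y i ^ 2) *
      ∫⁻ s in Set.Ioo (0 : ℝ) 1, G (scaleCoord i s y)) =
      ∫⁻ s in Set.Ioo (0 : ℝ) 1, w (‖y‖ ^ 2) * ENNReal.ofReal (y i ^ 2) * G (scaleCoord i s y) := by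
    intro y
    have : Measurable fun s => G (scaleCoord i s y) :=
      hG.comp (measurable_scaleCoord i measurable_id measurable_const)
    rw [lintegral_const_mul _ this, mul_assoc]
  simp only [h1]
  rw [lintegral_lintegral_swap]
  swap
  · exact (((hwn.comp measurable_fst).mul
      ((hcoord.comp measurable_fst).pow_const 2).ennreal_ofReal).mul
      (hG.comp (measurable_scaleCoord i measurable_snd measurable_fst))).aemeasurable
  -- For fixed s substitute z = `scaleCoord i s y`, with Jacobian s⁻¹; the other factors become
  -- functions of the stretched point `scaleCoord i s⁻¹ z`.
  have h2 : ∀ s ∈ Set.Ioo (0 : ℝ) 1,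
      ∫⁻ y, w (‖y‖ ^ 2) * ENNReal.ofReal (y i ^ 2) * G (scaleCoord i s y) =
        ∫⁻ z, ENNReal.ofReal s⁻¹ * (w (‖scaleCoord i s⁻¹ z‖ ^ 2) *
          ENNReal.ofReal ((scaleCoord i s⁻¹ z) i ^ 2) * G z) := by
    intro s hs
    have hinv : Measurable fun z : EuclideanSpace ℝ ι => scaleCoord i s⁻¹ z :=
      measurable_scaleCoord i measurable_const measurable_id
    have hmeas : Measurable fun z => w (‖scaleCoord i s⁻¹ z‖ ^ 2) *
          ENNReal.ofReal ((scaleCoord i s⁻¹ z) i ^ 2) * G z :=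
      ((hwn.comp hinv).mul ((hcoord.comp hinv).pow_const 2).ennreal_ofReal).mul hG
    rw [lintegral_const_mul _ hmeas, ← lintegral_comp_scaleCoord i hs.1 hmeas]
    simp only [scaleCoord_inv i hs.1.ne']
  rw [setLIntegral_congr_fun measurableSet_Ioo h2]
  have hinv : Measurable fun p : ℝ × EuclideanSpace ℝ ι => scaleCoord i p.1⁻¹ p.2 :=
    measurable_scaleCoord i measurable_fst.inv measurable_snd
  rw [lintegral_lintegral_swap]
  swap
  · exact (measurable_fst.inv.ennreal_ofReal.mul (((hwn.comp hinv).mul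
      ((hcoord.comp hinv).pow_const 2).ennreal_ofReal).mul (hG.comp measurable_snd))).aemeasurable
  rw [← lintegral_const_mul' _ _ (by norm_num)]
  -- Off this null hyperplane the radial substitution below is injective.
  have hker : volume {z : EuclideanSpace ℝ ι | z i = 0} = 0 := by
    have := Measure.addHaar_submodule (volume : Measure (EuclideanSpace ℝ ι))
      (LinearMap.ker (EuclideanSpace.projₗ i : EuclideanSpace ℝ ι →ₗ[ℝ] ℝ)) (by
        intro h
        have : EuclideanSpace.single i (1 : ℝ) ∈
            LinearMap.ker (EuclideanSpace.projₗ i : EuclideanSpace ℝ ι →ₗ[ℝ] ℝ) := by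
          rw [h]; trivial
        simp at this)
    exact this
  refine lintegral_congr_ae ?_
  have hne : ∀ᵐ z : EuclideanSpace ℝ ι, z i ≠ 0 := by
    rw [ae_iff]; simpa using hker
  filter_upwards [hne] with z hz
  have hz2 : 0 < z i ^ 2 := by positivity
  -- For fixed z this is the squared norm of the stretched point. It runs over (‖z‖², ∞), and the
  -- modulus 2 (z i)² s⁻³ of its derivative is twice the Jacobian s⁻¹ times the squared coordinate
  -- (s⁻¹ z i)².
  set p : ℝ → ℝ := fun s => ‖z‖ ^ 2 + z i ^ 2 * (s⁻¹ ^ 2 - 1) with hp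
  have hp' : ∀ s ∈ Set.Ioo (0 : ℝ) 1,
      HasDerivWithinAt p (-(2 * z i ^ 2 * s⁻¹ ^ 3)) (Set.Ioo 0 1) s := by
    intro s hs
    have h := (((((hasDerivAt_inv hs.1.ne').pow 2).sub_const 1).const_mul (z i ^ 2)).const_add
      (‖z‖ ^ 2)).hasDerivWithinAt (s := Set.Ioo 0 1)
    refine h.congr_deriv ?_
    simp
    ring
  have hinj : Set.InjOn p (Set.Ioo 0 1) := by
    intro a ha b hb hab
    change ‖z‖ ^ 2 + z i ^ 2 * (a⁻¹ ^ 2 - 1) = ‖z‖ ^ 2 + z i ^ 2 * (b⁻¹ ^ 2 - 1) at hab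
    simp only [add_right_inj, mul_eq_mul_left_iff, sub_left_inj, hz2.ne', or_false] at hab
    have := (pow_left_inj₀ (inv_nonneg.2 ha.1.le) (inv_nonneg.2 hb.1.le) two_ne_zero).1 hab
    exact inv_injective this
  have himg : p '' Set.Ioo 0 1 = Set.Ioi (‖z‖ ^ 2) := by
    ext q
    simp only [Set.mem_image, Set.mem_Ioi, hp]
    constructor
    · rintro ⟨s, hs, rfl⟩
      have : 1 < s⁻¹ := (one_lt_inv₀ hs.1).2 hs.2
      have : 0 < s⁻¹ ^ 2 - 1 := by nlinarith
      have := mul_pos hz2 this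
      linarith
    · intro hq
      set c := 1 + (q - ‖z‖ ^ 2) / z i ^ 2 with hc
      have hc1 : 1 < c := by
        have : 0 < (q - ‖z‖ ^ 2) / z i ^ 2 := div_pos (by linarith) hz2
        linarith
      have hsq : 1 < Real.sqrt c := by
        rw [Real.lt_sqrt (by norm_num)]; simpa using hc1
      refine ⟨(Real.sqrt c)⁻¹, ⟨by positivity, inv_lt_one_of_one_lt₀ hsq⟩, ?_⟩
      rw [inv_inv, Real.sq_sqrt (by linarith), hc]
      field_simp
      ring
  rw [← himg, lintegral_image_eq_lintegral_abs_deriv_mul measurableSet_Ioo hp' hinj,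
    ← lintegral_const_mul' _ _ (by norm_num)]
  have hmeas : Measurable fun s => ENNReal.ofReal |-(2 * z i ^ 2 * s⁻¹ ^ 3)| * w (p s) := by
    have : Measurable p := by simp only [hp]; fun_prop
    fun_prop
  rw [← lintegral_const_mul _ hmeas]
  refine setLIntegral_congr_fun measurableSet_Ioo fun s hs => ?_
  have hs' : 0 < s⁻¹ := inv_pos.2 hs.1
  simp only [norm_sq_scaleCoord, scaleCoord_apply, if_true]
  rw [abs_neg, abs_of_pos (by positivity)]
  have : ENNReal.ofReal (2 * z i ^ 2 * s⁻¹ ^ 3) =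
      2 * (ENNReal.ofReal s⁻¹ * ENNReal.ofReal ((s⁻¹ * z i) ^ 2)) := by
    have h2 : (2 : ℝ≥0∞) = ENNReal.ofReal 2 := by simp
    refine Eq.trans ?_ (congrArg (fun c => c * _) h2.symm)
    rw [← ENNReal.ofReal_mul hs'.le, ← ENNReal.ofReal_mul (by norm_num)]
    congr 1
    ring
  rw [this]
  ring

end Shell

end LQR

/-! ### Poincaré inequality for radial weights on a ball. -/

namespace LQR

section Poincare

variable {ι : Type*} [Fintype ι] [DecidableEq ι]

lemma hasDerivAt_scaleCoord (i : ι) (y : EuclideanSpace ℝ ι) (s : ℝ) :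
    HasDerivAt (fun s => scaleCoord i s y) (y i • EuclideanSpace.single i (1 : ℝ)) s := by
  simp only [scaleCoord_eq]
  have h := ((((hasDerivAt_id s).sub_const 1).mul_const (y i)).smul_const
    (EuclideanSpace.single i (1 : ℝ))).const_add y
  simpa using h

lemma scaleCoord_one (i : ι) (y : EuclideanSpace ℝ ι) : scaleCoord i 1 y = y := by
  simp [scaleCoord_eq]

/-- The fundamental theorem of calculus on the segment from the projection of y to y, followed by
Jensen. The segment stays in the ball because shrinking a coordinate does not increase the norm. -/
lemma sq_sub_scaleCoord_zero_le (i : ι) {h : EuclideanSpace ℝ ι → ℝ} {r : ℝ}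
    (hh : ∀ y, ‖y‖ ≤ r → ContDiffAt ℝ 1 h y) {y : EuclideanSpace ℝ ι} (hy : ‖y‖ ≤ r) :
    ENNReal.ofReal ((h y - h (scaleCoord i 0 y)) ^ 2) ≤ ENNReal.ofReal (y i ^ 2) *
      ∫⁻ s in Set.Ioo (0 : ℝ) 1, ENNReal.ofReal
        (fderiv ℝ h (scaleCoord i s y) (EuclideanSpace.single i (1 : ℝ)) ^ 2) := by
  set e := EuclideanSpace.single i (1 : ℝ) with he
  set g : ℝ → ℝ := fun s => fderiv ℝ h (scaleCoord i s y) e with hg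
  have hball : ∀ s ∈ Set.Icc (0 : ℝ) 1, ‖scaleCoord i s y‖ ≤ r := fun s hs =>
    (norm_scaleCoord_le i hs.1 hs.2 y).trans hy
  have hcs : Continuous fun s => scaleCoord i s y := by
    simp only [scaleCoord_eq]; fun_prop
  have hgc : ContinuousOn g (Set.Icc 0 1) := by
    intro s hs
    have h1 : ContinuousAt (fderiv ℝ h) (scaleCoord i s y) :=
      (hh _ (hball s hs)).continuousAt_fderiv (by norm_num)
    have h2 : ContinuousAt (fun s => fderiv ℝ h (scaleCoord i s y)) s :=
      ContinuousAt.comp (f := fun s => scaleCoord i s y) (g := fderiv ℝ h) h1 hcs.continuousAt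
    exact (h2.clm_apply continuousAt_const).continuousWithinAt
  have hgi : IntervalIntegrable g volume 0 1 :=
    (hgc.mono (by rw [Set.uIcc_of_le zero_le_one])).intervalIntegrable
  have hg2i : IntervalIntegrable (fun s => g s ^ 2) volume 0 1 :=
    ((hgc.pow 2).mono (by rw [Set.uIcc_of_le zero_le_one])).intervalIntegrable
  have hftc : ∫ s in (0 : ℝ)..1, y i * g s = h y - h (scaleCoord i 0 y) := by
    rw [intervalIntegral.integral_eq_sub_of_hasDerivAt (f := fun s => h (scaleCoord i s y))]
    · rw [scaleCoord_one]
    · intro s hs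
      rw [Set.uIcc_of_le zero_le_one] at hs
      have h1 := ((hh _ (hball s hs)).differentiableAt (by norm_num)).hasFDerivAt.comp_hasDerivAt s
        (hasDerivAt_scaleCoord i y s)
      refine h1.congr_deriv ?_
      simp [hg, he]
    · exact hgi.const_mul _
  rw [intervalIntegral.integral_const_mul] at hftc
  have hjensen : (∫ s in (0 : ℝ)..1, g s) ^ 2 ≤ ∫ s in (0 : ℝ)..1, g s ^ 2 := by
    set c := ∫ s in (0 : ℝ)..1, g s with hc
    have h0 : 0 ≤ ∫ s in (0 : ℝ)..1, (g s - c) ^ 2 :=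
      intervalIntegral.integral_nonneg zero_le_one fun s _ => sq_nonneg _
    have h1 : ∫ s in (0 : ℝ)..1, (g s - c) ^ 2 =
        ∫ s in (0 : ℝ)..1, (g s ^ 2 - 2 * c * g s + c ^ 2) := by
      congr 1; ext s; ring
    rw [h1, intervalIntegral.integral_add (hg2i.sub (hgi.const_mul _)) (by simp),
      intervalIntegral.integral_sub hg2i (hgi.const_mul _),
      intervalIntegral.integral_const_mul, ← hc] at h0
    simp at h0
    nlinarith
  have hlint : ∫⁻ s in Set.Ioo (0 : ℝ) 1, ENNReal.ofReal (g s ^ 2) =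
      ENNReal.ofReal (∫ s in (0 : ℝ)..1, g s ^ 2) := by
    rw [intervalIntegral.integral_of_le zero_le_one, ← restrict_Ioo_eq_restrict_Ioc,
      ofReal_integral_eq_lintegral_ofReal]
    · exact hg2i.1.mono_set Set.Ioo_subset_Ioc_self
    · exact Filter.Eventually.of_forall fun s => sq_nonneg _
  rw [hlint, ← ENNReal.ofReal_mul (sq_nonneg _), ← hftc, mul_pow]
  exact ENNReal.ofReal_le_ofReal (mul_le_mul_of_nonneg_left hjensen (sq_nonneg _))

/-- Poincaré inequality for radial weights `w (‖y‖ ^ 2)` supported in a ball. -/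
lemma lintegral_weight_sq_sub_neg_le {h : EuclideanSpace ℝ ι → ℝ} (hm : Measurable h) {r L : ℝ}
    (hh : ∀ y, ‖y‖ ≤ r → ContDiffAt ℝ 1 h y) (hL : ∀ y, ‖y‖ ≤ r → ‖fderiv ℝ h y‖ ≤ L)
    {w : ℝ → ℝ≥0∞} (hw : Measurable w) (hwr : ∀ p, r ^ 2 < p → w p = 0) (hr : 0 ≤ r) :
    Fintype.card ι * ∫⁻ y, w (‖y‖ ^ 2) * ENNReal.ofReal ((h y - h (-y)) ^ 2) ≤
      ENNReal.ofReal (4 * L ^ 2) * ∫⁻ y : EuclideanSpace ℝ ι,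
        w (‖y‖ ^ 2) * ENNReal.ofReal (‖y‖ ^ 2) := by
  have hwn : Measurable fun y : EuclideanSpace ℝ ι => w (‖y‖ ^ 2) := by fun_prop
  set W : EuclideanSpace ℝ ι → ℝ≥0∞ := fun z => ∫⁻ p in Set.Ioi (‖z‖ ^ 2), w p with hW
  have hwz : ∀ y : EuclideanSpace ℝ ι, ¬ ‖y‖ ≤ r → w (‖y‖ ^ 2) = 0 := fun y hy =>
    hwr _ (by push Not at hy; gcongr)
  have hWz : ∀ y : EuclideanSpace ℝ ι, ¬ ‖y‖ ≤ r → W y = 0 := fun y hy => by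
    simp only [hW]
    rw [setLIntegral_congr_fun (g := fun _ => 0) measurableSet_Ioi]
    · simp
    · intro p hp
      refine hwr _ (lt_of_lt_of_le ?_ (le_of_lt hp))
      push Not at hy; gcongr
  -- The same integration identity with G = 1 expresses ∫ W through any one coordinate. Summing over
  -- all coordinates relates it to ∫ w ‖y‖², and this is where the dimension factor is gained.
  have hone : ∀ i, 2 * ∫⁻ y : EuclideanSpace ℝ ι, w (‖y‖ ^ 2) * ENNReal.ofReal (y i ^ 2) =
      ∫⁻ z, W z := by
    intro i
    have := lintegral_scaleCoord i hw (G := fun _ => 1) measurable_const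
    simpa using this
  have hsumone : Fintype.card ι * ∫⁻ z, W z =
      2 * ∫⁻ y : EuclideanSpace ℝ ι, w (‖y‖ ^ 2) * ENNReal.ofReal (‖y‖ ^ 2) := by
    have h1 : ∀ y : EuclideanSpace ℝ ι, w (‖y‖ ^ 2) * ENNReal.ofReal (‖y‖ ^ 2) =
        ∑ i, w (‖y‖ ^ 2) * ENNReal.ofReal (y i ^ 2) := fun y => by
      rw [← Finset.mul_sum, ← ENNReal.ofReal_sum_of_nonneg fun i _ => sq_nonneg _,
        EuclideanSpace.real_norm_sq_eq]
    simp only [h1]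
    rw [lintegral_finsetSum _ (fun i _ => by fun_prop), Finset.mul_sum]
    simp [hone]
  set μ := (volume : Measure (EuclideanSpace ℝ ι)).withDensity fun y => w (‖y‖ ^ 2) with hμ
  have hflip : ∀ s, MeasurePreserving (flipCoords s) μ μ := by
    intro s
    refine ⟨(flipCoords s).continuous.measurable, ?_⟩
    ext t ht
    have hv := LinearIsometryEquiv.measurePreserving (flipCoords (ι := ι) s)
    rw [Measure.map_apply (flipCoords s).continuous.measurable ht,
      withDensity_apply _ ht, withDensity_apply _ ((flipCoords s).continuous.measurable ht),
      ← lintegral_indicator ht,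
      ← lintegral_indicator ((flipCoords s).continuous.measurable ht),
      ← hv.lintegral_comp (hwn.indicator ht)]
    refine lintegral_congr fun y => ?_
    simp [Set.indicator]
    rfl
  have hlw : ∀ f : EuclideanSpace ℝ ι → ℝ≥0∞, Measurable f →
      ∫⁻ y, f y ∂μ = ∫⁻ y, w (‖y‖ ^ 2) * f y := fun f hf => by
    rw [hμ, lintegral_withDensity_eq_lintegral_mul _ hwn hf]
    rfl
  set G : ι → EuclideanSpace ℝ ι → ℝ≥0∞ := fun i y =>
    ENNReal.ofReal (fderiv ℝ h y (EuclideanSpace.single i (1 : ℝ)) ^ 2) with hG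
  have hGm : ∀ i, Measurable (G i) := fun i =>
    ((measurable_fderiv_apply_const ℝ h _).pow_const 2).ennreal_ofReal
  have hproj : ∀ i, ∫⁻ y, ENNReal.ofReal ((h y - h (scaleCoord i 0 y)) ^ 2) ∂μ ≤
      ∫⁻ y, w (‖y‖ ^ 2) * (ENNReal.ofReal (y i ^ 2) *
        ∫⁻ s in Set.Ioo (0 : ℝ) 1, G i (scaleCoord i s y)) := by
    intro i
    have : Measurable fun y : EuclideanSpace ℝ ι => scaleCoord i 0 y :=
      measurable_scaleCoord i measurable_const measurable_id
    have hφ : Measurable fun y => ENNReal.ofReal ((h y - h (scaleCoord i 0 y)) ^ 2) :=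
      ((hm.sub (hm.comp this)).pow_const 2).ennreal_ofReal
    rw [hlw _ hφ]
    refine lintegral_mono fun y => ?_
    by_cases hy : ‖y‖ ≤ r
    · dsimp only
      gcongr
      exact sq_sub_scaleCoord_zero_le i hh hy
    · simp [hwz y hy]
  have hcoord : ∀ i, ∫⁻ y, ENNReal.ofReal ((h y - h (flipCoords {i} y)) ^ 2) ∂μ ≤
      2 * ∫⁻ z, G i z * W z := by
    intro i
    have hm0 : Measurable fun y : EuclideanSpace ℝ ι => scaleCoord i 0 y :=
      measurable_scaleCoord i measurable_const measurable_id
    have hφ : Measurable fun y => ENNReal.ofReal ((h y - h (scaleCoord i 0 y)) ^ 2) :=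
      ((hm.sub (hm.comp hm0)).pow_const 2).ennreal_ofReal
    have e := (hflip {i}).lintegral_comp hφ
    simp only [scaleCoord_zero_flipCoords] at e
    -- A point and its flip are compared through their common projection; by invariance under the
    -- flip both comparisons have the same integral.
    calc ∫⁻ y, ENNReal.ofReal ((h y - h (flipCoords {i} y)) ^ 2) ∂μ
        ≤ ∫⁻ y, (2 * ENNReal.ofReal ((h y - h (scaleCoord i 0 y)) ^ 2) +
            2 * ENNReal.ofReal ((h (flipCoords {i} y) - h (scaleCoord i 0 y)) ^ 2)) ∂μ := by
          refine lintegral_mono fun y => ?_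
          have h2 : (2 : ℝ≥0∞) = ENNReal.ofReal 2 := by simp
          dsimp only
          rw [← mul_add, ← ENNReal.ofReal_add (sq_nonneg _) (sq_nonneg _)]
          refine le_of_le_of_eq ?_ (congrArg (fun c => c * _) h2.symm)
          rw [← ENNReal.ofReal_mul (by norm_num)]
          refine ENNReal.ofReal_le_ofReal ?_
          nlinarith [sq_nonneg (h y + h (flipCoords {i} y) - 2 * h (scaleCoord i 0 y))]
      _ = 2 * (2 * ∫⁻ y, ENNReal.ofReal ((h y - h (scaleCoord i 0 y)) ^ 2) ∂μ) := by
          rw [lintegral_add_left (hφ.const_mul _), lintegral_const_mul _ hφ,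
            lintegral_const_mul' _ _ (by norm_num), e]
          ring
      _ ≤ 2 * (2 * ∫⁻ y, w (‖y‖ ^ 2) * (ENNReal.ofReal (y i ^ 2) *
            ∫⁻ s in Set.Ioo (0 : ℝ) 1, G i (scaleCoord i s y))) := by
          exact mul_le_mul' le_rfl (mul_le_mul' le_rfl (hproj i))
      _ = 2 * ∫⁻ z, G i z * W z := by rw [lintegral_scaleCoord i hw (hGm i)]
  have hWm : Measurable W := by
    have : Antitone fun q : ℝ => ∫⁻ p in Set.Ioi q, w p := fun a b hab =>
      lintegral_mono_set (Set.Ioi_subset_Ioi hab)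
    exact this.measurable.comp (measurable_norm.pow_const 2)
  have hgrad : ∀ z, (∑ i, G i z) * W z ≤ ENNReal.ofReal (L ^ 2) * W z := by
    intro z
    by_cases hz : ‖z‖ ≤ r
    · gcongr
      simp only [hG]
      rw [← ENNReal.ofReal_sum_of_nonneg fun i _ => sq_nonneg _]
      refine ENNReal.ofReal_le_ofReal ?_
      have h1 : ∀ i, fderiv ℝ h z (EuclideanSpace.single i (1 : ℝ)) = gradient h z i := by
        intro i
        have h2 : fderiv ℝ h z (EuclideanSpace.single i (1 : ℝ)) =
            inner ℝ (gradient h z) (EuclideanSpace.single i (1 : ℝ)) := by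
          simp [gradient]
        rw [h2, EuclideanSpace.inner_single_right]
        simp only [one_mul, conj_trivial]
      simp only [h1]
      rw [← EuclideanSpace.real_norm_sq_eq, gradient, LinearIsometryEquiv.norm_map]
      exact pow_le_pow_left₀ (norm_nonneg _) (hL z hz) 2
    · simp [hWz z hz]
  have hmain : ∫⁻ y, w (‖y‖ ^ 2) * ENNReal.ofReal ((h y - h (-y)) ^ 2) ≤
      2 * (ENNReal.ofReal (L ^ 2) * ∫⁻ z, W z) := by
    have h1 := lintegral_sq_sub_flipCoords_le hflip hm Finset.univ
    simp only [flipCoords_univ] at h1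
    have hφ : Measurable fun y => ENNReal.ofReal ((h y - h (-y)) ^ 2) :=
      ((hm.sub (hm.comp measurable_neg)).pow_const 2).ennreal_ofReal
    rw [hlw _ hφ] at h1
    refine h1.trans ((Finset.sum_le_sum fun i _ => hcoord i).trans ?_)
    have hGW : ∀ i, Measurable fun z => G i z * W z := fun i => (hGm i).mul hWm
    rw [← Finset.mul_sum, ← lintegral_finsetSum _ fun i _ => hGW i]
    gcongr
    rw [← lintegral_const_mul _ hWm]
    refine lintegral_mono fun z => ?_
    rw [← Finset.sum_mul]
    exact hgrad z
  calc Fintype.card ι * ∫⁻ y, w (‖y‖ ^ 2) * ENNReal.ofReal ((h y - h (-y)) ^ 2)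
      ≤ Fintype.card ι * (2 * (ENNReal.ofReal (L ^ 2) * ∫⁻ z, W z)) := by gcongr
    _ = 2 * (ENNReal.ofReal (L ^ 2) * (Fintype.card ι * ∫⁻ z, W z)) := by ring
    _ = _ := by
      rw [hsumone, show (4 : ℝ) * L ^ 2 = 2 * 2 * L ^ 2 by norm_num,
        ENNReal.ofReal_mul (by norm_num), ENNReal.ofReal_mul (by norm_num)]
      simp only [ENNReal.ofReal_ofNat]
      ring

end Poincare

end LQR

/-! ### Polar coordinates and the Poincaré inequality on the sphere. -/

namespace LQR

section Polar

variable {E : Type*} [NormedAddCommGroup E] [NormedSpace ℝ E] [MeasurableSpace E] [BorelSpace E]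
  [FiniteDimensional ℝ E] [Nontrivial E]

/-- Integration in polar coordinates. -/
lemma lintegral_polar (μ : Measure E) [μ.IsAddHaarMeasure] {f : E → ℝ≥0∞} (hf : Measurable f) :
    ∫⁻ x, f x ∂μ = ∫⁻ p in Set.Ioi (0 : ℝ), ENNReal.ofReal (p ^ (Module.finrank ℝ E - 1)) *
      ∫⁻ u, f (p • (u : E)) ∂μ.toSphere := by
  have h0 : ∫⁻ x, f x ∂μ = ∫⁻ x : ({0}ᶜ : Set E), f x ∂(μ.comap (↑)) := by
    rw [lintegral_subtype_comap (measurableSet_singleton _).compl, restrict_compl_singleton]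
  have hmp := (Measure.measurePreserving_homeomorphUnitSphereProd μ).symm
    (homeomorphUnitSphereProd E).toMeasurableEquiv
  have hsub : Measurable fun x : ({0}ᶜ : Set E) => f x := hf.comp measurable_subtype_coe
  have hmeas : Measurable fun a : Metric.sphere (0 : E) 1 × Set.Ioi (0 : ℝ) =>
      f ((homeomorphUnitSphereProd E).toMeasurableEquiv.symm a : E) := hsub.comp hmp.measurable
  rw [h0, ← hmp.lintegral_comp hsub, lintegral_prod_symm' _ hmeas,
    Measure.volumeIoiPow, lintegral_withDensity_eq_lintegral_mul]
  · rw [← lintegral_subtype_comap measurableSet_Ioi]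
    rfl
  · fun_prop
  · exact Measurable.lintegral_prod_left hmeas

end Polar

variable {m k : ℕ}

lemma lintegral_uniformSphere (f : Policy m k → ℝ≥0∞) (hf : Measurable f) :
    ∫⁻ u, f u ∂(uniformSphere m k) = ((volume : Measure (Policy m k)).toSphere Set.univ)⁻¹ *
      ∫⁻ u, f (u : Policy m k) ∂(volume : Measure (Policy m k)).toSphere := by
  rw [uniformSphere, lintegral_map hf measurable_subtype_coe, lintegral_smul_measure, smul_eq_mul]

/-- Poincaré inequality for the odd part of a function on the sphere of radius `r`. -/
lemma integral_sq_sub_neg_le (hm : 0 < m) (hk : 0 < k) {h : Policy m k → ℝ} (hh : Measurable h)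
    {r L : ℝ} (hr : 0 < r) (hc : ∀ y, ‖y‖ ≤ r → ContDiffAt ℝ 1 h y)
    (hL : ∀ y, ‖y‖ ≤ r → ‖fderiv ℝ h y‖ ≤ L) :
    ∫ u, (h (r • u) - h (-(r • u))) ^ 2 ∂(uniformSphere m k) ≤
      4 * r ^ 2 * L ^ 2 / ((m : ℝ) * k) := by
  have := isProbabilityMeasure_uniformSphere hm hk
  have := policy_nontrivial hm hk
  have hD : (0 : ℝ) < (m : ℝ) * k := by positivity
  set σ := (volume : Measure (Policy m k)).toSphere with hσ
  have hσ0 : σ Set.univ ≠ 0 := toSphere_univ_ne_zero hm hk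
  have hσt : σ Set.univ ≠ ⊤ := measure_ne_top _ _
  have hcont : ContinuousOn h (Metric.closedBall 0 r) := fun y hy =>
    (hc y (by simpa using hy)).continuousAt.continuousWithinAt
  obtain ⟨C, hC⟩ := (isCompact_closedBall (0 : Policy m k) r).exists_bound_of_continuousOn hcont
  have hC' : ∀ y : Policy m k, ‖y‖ ≤ r → |h y| ≤ C := fun y hy => hC y (by simpa using hy)
  set Ψ : ℝ → ℝ := fun p => ∫ u, (h (p • u) - h (-(p • u))) ^ 2 ∂(uniformSphere m k) with hΨ
  have hnorm : ∀ p : ℝ, 0 ≤ p → p ≤ r → ∀ u : Policy m k, ‖u‖ = 1 → ‖p • u‖ ≤ r :=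
    fun p h0 h1 u hu => by simpa [norm_smul, hu, abs_of_nonneg h0] using h1
  have hbd : ∀ p : ℝ, 0 ≤ p → p ≤ r → ∀ u : Policy m k, ‖u‖ = 1 →
      |(h (p • u) - h (-(p • u))) ^ 2| ≤ (2 * C) ^ 2 := fun p h0 h1 u hu => by
    have a := hC' _ (hnorm p h0 h1 u hu)
    have b := hC' (-(p • u)) (by rw [norm_neg]; exact hnorm p h0 h1 u hu)
    rw [abs_pow]
    refine pow_le_pow_left₀ (abs_nonneg _) ?_ 2
    exact (abs_sub _ _).trans (by linarith)
  have hΨl : ∀ p : ℝ, 0 ≤ p → p ≤ r → ∫⁻ u : Metric.sphere (0 : Policy m k) 1,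
      ENNReal.ofReal ((h (p • (u : Policy m k)) - h (-(p • (u : Policy m k)))) ^ 2) ∂σ =
      σ Set.univ * ENNReal.ofReal (Ψ p) := by
    intro p h0 h1
    have hmeas : Measurable fun u : Policy m k => (h (p • u) - h (-(p • u))) ^ 2 := by fun_prop
    rw [hΨ, ofReal_integral_eq_lintegral_ofReal
      (integrable_uniformSphere_of_bound hm hk hmeas.aestronglyMeasurable _ (hbd p h0 h1))
      (Filter.Eventually.of_forall fun u => sq_nonneg _),
      lintegral_uniformSphere _ hmeas.ennreal_ofReal, ← mul_assoc, ENNReal.mul_inv_cancel hσ0 hσt,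
      one_mul]
  have hΨc : ContinuousOn Ψ (Set.Icc 0 r) := by
    intro p hp
    refine tendsto_integral_filter_of_dominated_convergence (fun _ => (2 * C) ^ 2) ?_ ?_
      (integrable_const _) ?_
    · exact Filter.Eventually.of_forall fun q => by
        apply Measurable.aestronglyMeasurable; fun_prop
    · filter_upwards [self_mem_nhdsWithin] with q hq
      filter_upwards [ae_norm_uniformSphere] with u hu using hbd q hq.1 hq.2 u hu
    · filter_upwards [ae_norm_uniformSphere] with u hu
      have h1 : ContinuousAt (fun q : ℝ => h (q • u)) p :=
        ContinuousAt.comp (f := fun q : ℝ => q • u) (g := h)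
          (hc _ (hnorm p hp.1 hp.2 u hu)).continuousAt (by fun_prop)
      have h2 : ContinuousAt (fun q : ℝ => h (-(q • u))) p :=
        ContinuousAt.comp (f := fun q : ℝ => -(q • u)) (g := h)
          (hc _ (by rw [norm_neg]; exact hnorm p hp.1 hp.2 u hu)).continuousAt (by fun_prop)
      exact ((h1.sub h2).pow 2).continuousWithinAt
  have hcard : (Fintype.card (Fin k × Fin m) : ℝ≥0∞) = ENNReal.ofReal ((m : ℝ) * k) := by
    rw [Fintype.card_prod, Fintype.card_fin, Fintype.card_fin, ← Nat.cast_mul,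
      ENNReal.ofReal_natCast, mul_comm]
  -- arbitrarily close to `r` there is a radius with the claimed inequality
  have hex : ∀ a ∈ Set.Ioo 0 r, ∃ p ∈ Set.Ioo a r, Ψ p ≤ 4 * p ^ 2 * L ^ 2 / ((m : ℝ) * k) := by
    intro a ha
    by_contra! hcon
    -- With the shell as weight, the inequality on the ball is in polar coordinates an average of
    -- the spherical inequalities over radii in (a, r), so these cannot all fail.
    set w : ℝ → ℝ≥0∞ := (Set.Ioo (a ^ 2) (r ^ 2)).indicator fun _ => 1 with hw
    have hwm : Measurable w := measurable_const.indicator measurableSet_Ioo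
    have hwp : ∀ p : ℝ, 0 < p → w (p ^ 2) = (Set.Ioo a r).indicator (fun _ => 1) p := by
      intro p hp
      simp only [hw, Set.indicator, Set.mem_Ioo]
      simp only [pow_lt_pow_iff_left₀ ha.1.le hp.le two_ne_zero,
        pow_lt_pow_iff_left₀ hp.le hr.le two_ne_zero]
    have key := lintegral_weight_sq_sub_neg_le hh hc hL hwm (fun p hp => by
      simp only [hw, Set.indicator, Set.mem_Ioo]
      rw [if_neg]; intro h; linarith [h.2]) hr.le
    have hpol : ∀ f : Policy m k → ℝ, Measurable f →
        ∫⁻ y, w (‖y‖ ^ 2) * ENNReal.ofReal (f y) = ∫⁻ p in Set.Ioo a r,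
          ENNReal.ofReal (p ^ (Module.finrank ℝ (Policy m k) - 1)) *
            ∫⁻ u : Metric.sphere (0 : Policy m k) 1, ENNReal.ofReal (f (p • (u : Policy m k))) ∂σ := by
      intro f hf
      rw [lintegral_polar volume (by fun_prop), ← lintegral_indicator measurableSet_Ioi,
        ← lintegral_indicator measurableSet_Ioo]
      refine lintegral_congr fun p => ?_
      by_cases hp : 0 < p
      · rw [Set.indicator_of_mem (show p ∈ Set.Ioi (0 : ℝ) from hp)]
        have hn : ∀ u : Metric.sphere (0 : Policy m k) 1, w (‖p • (u : Policy m k)‖ ^ 2) =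
            (Set.Ioo a r).indicator (fun _ => 1) p := fun u => by
          rw [norm_smul, norm_eq_of_mem_sphere, mul_one, Real.norm_eq_abs, sq_abs, hwp p hp]
        simp only [hn]
        by_cases hpa : p ∈ Set.Ioo a r
        · simp [hpa, hσ]
        · simp [hpa]
      · rw [Set.indicator_of_notMem (by simpa using hp), Set.indicator_of_notMem]
        intro hpa
        exact hp (ha.1.trans hpa.1)
    rw [hpol _ (by fun_prop), hpol _ (by fun_prop),
      ← lintegral_const_mul' _ _ (ENNReal.natCast_ne_top _),
      ← lintegral_const_mul' _ _ ENNReal.ofReal_ne_top] at key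
    set d := Module.finrank ℝ (Policy m k) - 1 with hd
    have e1 : ∫⁻ p in Set.Ioo a r, (Fintype.card (Fin k × Fin m) : ℝ≥0∞) *
        (ENNReal.ofReal (p ^ d) * ∫⁻ u : Metric.sphere (0 : Policy m k) 1, ENNReal.ofReal
          ((h (p • (u : Policy m k)) - h (-(p • (u : Policy m k)))) ^ 2) ∂σ) =
        ∫⁻ p in Set.Ioo a r, σ Set.univ * ENNReal.ofReal (((m : ℝ) * k) * (p ^ d * Ψ p)) := by
      refine setLIntegral_congr_fun measurableSet_Ioo fun p hp => ?_
      have hp0 : 0 < p := ha.1.trans hp.1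
      rw [hΨl p hp0.le hp.2.le, hcard, ENNReal.ofReal_mul hD.le,
        ENNReal.ofReal_mul (p := p ^ d) (by positivity)]
      ring
    have e2 : ∫⁻ p in Set.Ioo a r, ENNReal.ofReal (4 * L ^ 2) *
        (ENNReal.ofReal (p ^ d) * ∫⁻ u : Metric.sphere (0 : Policy m k) 1, ENNReal.ofReal
          (‖p • (u : Policy m k)‖ ^ 2) ∂σ) =
        ∫⁻ p in Set.Ioo a r, σ Set.univ * ENNReal.ofReal ((4 * L ^ 2) * (p ^ d * p ^ 2)) := by
      refine setLIntegral_congr_fun measurableSet_Ioo fun p hp => ?_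
      have hp0 : 0 < p := ha.1.trans hp.1
      simp only [norm_smul, norm_eq_of_mem_sphere, mul_one, Real.norm_eq_abs, sq_abs,
        lintegral_const]
      rw [ENNReal.ofReal_mul (p := 4 * L ^ 2) (by positivity),
        ENNReal.ofReal_mul (p := p ^ d) (by positivity)]
      ring
    rw [e1, e2] at key
    refine absurd key (not_le.2 ?_)
    have hΨm : AEMeasurable Ψ (volume.restrict (Set.Ioo a r)) :=
      (hΨc.mono fun p hp => ⟨(ha.1.trans hp.1).le, hp.2.le⟩).aemeasurable measurableSet_Ioo
    have hne : volume.restrict (Set.Ioo a r) ≠ 0 := by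
      simp [Measure.restrict_eq_zero, ha.2]
    refine lintegral_strict_mono hne ?_ ?_ ?_
    · fun_prop
    · refine ne_of_lt (lt_of_le_of_lt (setLIntegral_mono (g := fun _ =>
        σ Set.univ * ENNReal.ofReal ((4 * L ^ 2) * (r ^ d * r ^ 2))) measurable_const ?_) ?_)
      · intro p hp
        have hp0 : 0 < p := ha.1.trans hp.1
        have := hp.2.le
        gcongr
      · rw [lintegral_const]
        refine ENNReal.mul_lt_top (ENNReal.mul_lt_top hσt.lt_top ENNReal.ofReal_lt_top) ?_
        simp
    · filter_upwards [ae_restrict_mem measurableSet_Ioo] with p hp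
      have hp0 : 0 < p := ha.1.trans hp.1
      have h1 := hcon p hp
      rw [div_lt_iff₀ hD] at h1
      refine (ENNReal.mul_lt_mul_iff_right hσ0 hσt).2 ?_
      have h2 : 4 * L ^ 2 * (p ^ d * p ^ 2) < (m : ℝ) * k * (p ^ d * Ψ p) := by
        have := mul_lt_mul_of_pos_left h1 (pow_pos hp0 d)
        nlinarith
      exact (ENNReal.ofReal_lt_ofReal_iff (lt_of_le_of_lt (by positivity) h2)).2 h2
  -- The spherical mean is continuous in the radius up to r, so a failure at r would persist at all
  -- radii just below r.
  by_contra! hlt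
  have hrc : ContinuousWithinAt (fun p => Ψ p - 4 * p ^ 2 * L ^ 2 / ((m : ℝ) * k)) (Set.Icc 0 r) r :=
    (hΨc r ⟨hr.le, le_rfl⟩).sub (by fun_prop)
  have hpos : 0 < Ψ r - 4 * r ^ 2 * L ^ 2 / ((m : ℝ) * k) := sub_pos.2 hlt
  have hev := hrc.eventually (lt_mem_nhds hpos)
  rw [eventually_nhdsWithin_iff, Metric.eventually_nhds_iff] at hev
  obtain ⟨δ, hδ, hev⟩ := hev
  obtain ⟨p, hp, hle⟩ := hex (max (r / 2) (r - δ))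
    ⟨lt_max_of_lt_left (by positivity), max_lt (by linarith) (by linarith)⟩
  have hp1 := (max_lt_iff.1 hp.1)
  have := hev (y := p) (by
    rw [Real.dist_eq, abs_lt]; constructor <;> linarith [hp.2]) ⟨by linarith, hp.2.le⟩
  linarith

end LQR

/-! ### Smooth PL functions on a sublevel set. -/

namespace LQR

section Descent

lemma IsLocallyLipschitzAt.mono {E : Type*} [NormedAddCommGroup E] {f : E → ℝ≥0∞} {l l' ζ ζ' : ℝ} {x : E}
    (h : IsLocallyLipschitzAt f l ζ x) (hl : l ≤ l') (hζ : ζ' ≤ ζ) :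
    IsLocallyLipschitzAt f l' ζ' x := fun y hy =>
  let ⟨h1, h2⟩ := h y (hy.trans hζ)
  ⟨h1, h2.trans (by gcongr)⟩

lemma IsLocallyLipschitzAt.norm_fderiv_le {E : Type*} [NormedAddCommGroup E]
    [InnerProductSpace ℝ E] {f : E → ℝ≥0∞} {l ζ : ℝ} {x : E}
    (h : IsLocallyLipschitzAt f l ζ x) (hζ : 0 < ζ) (hl : 0 ≤ l) :
    ‖fderiv ℝ (fun z => (f z).toReal) x‖ ≤ l := by
  refine norm_fderiv_le_of_lip' ℝ hl ?_
  filter_upwards [Metric.closedBall_mem_nhds x hζ] with y hy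
  exact (h y (by simpa [dist_eq_norm] using hy)).2

variable {E : Type*} [NormedAddCommGroup E] [InnerProductSpace ℝ E] [CompleteSpace E]

lemma HasLocallyLipschitzGradientAt.mono {f : E → ℝ≥0∞} {φ φ' β β' : ℝ} {x : E}
    (h : HasLocallyLipschitzGradientAt f φ β x) (hφ : φ ≤ φ') (hβ : β' ≤ β) :
    HasLocallyLipschitzGradientAt f φ' β' x := fun y hy =>
  let ⟨h1, h2, h3⟩ := h y (hy.trans hβ)
  ⟨h1, h2, h3.trans (by gcongr)⟩

/-- The remainder of the first order expansion is Lipschitz on small balls. -/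
lemma HasLocallyLipschitzGradientAt.abs_remainder_sub_le {f : E → ℝ≥0∞} {φ ρ r : ℝ} {x : E}
    (h : HasLocallyLipschitzGradientAt f φ ρ x) (hr : r ≤ ρ) (hφ : 0 ≤ φ) {y z : E}
    (hy : ‖y‖ ≤ r) (hz : ‖z‖ ≤ r) :
    |((f (x + y)).toReal - inner ℝ (gradient (fun z => (f z).toReal) x) y) -
      ((f (x + z)).toReal - inner ℝ (gradient (fun z => (f z).toReal) x) z)| ≤
      φ * r * ‖y - z‖ := by
  set F : E → ℝ := fun z => (f z).toReal with hF
  have hd : ∀ v ∈ Metric.closedBall (0 : E) r, HasFDerivWithinAt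
      (fun v => F (x + v) - inner ℝ (gradient F x) v)
      (innerSL ℝ (gradient F (x + v) - gradient F x)) (Metric.closedBall 0 r) v := by
    intro v hv
    have hv' : ‖v‖ ≤ r := by simpa using hv
    have h1 := ((h (x + v) (by simpa using hv'.trans hr)).2.1.differentiableAt
      (by norm_num)).hasGradientAt.hasFDerivAt
    have h2 : HasFDerivAt (fun v => F (x + v)) (innerSL ℝ (gradient F (x + v))) v :=
      (h1.comp v ((hasFDerivAt_id v).const_add x))
    have h3 : HasFDerivAt (fun v => inner ℝ (gradient F x) v) (innerSL ℝ (gradient F x)) v :=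
      (innerSL ℝ (gradient F x)).hasFDerivAt
    rw [map_sub]
    exact (h2.sub h3).hasFDerivWithinAt
  have := Convex.norm_image_sub_le_of_norm_hasFDerivWithin_le hd (C := φ * r) (fun v hv => by
    have hv' : ‖v‖ ≤ r := by simpa using hv
    rw [innerSL_apply_norm]
    have h3 := (h (x + v) (by simpa using hv'.trans hr)).2.2
    simp only [add_sub_cancel_left] at h3
    exact h3.trans (by gcongr)) (convex_closedBall _ _) (x := z) (y := y)
    (by simpa using hz) (by simpa using hy)
  simpa using this

/-- Quadratic upper bound. -/
lemma HasLocallyLipschitzGradientAt.le_quadratic {f : E → ℝ≥0∞} {φ ρ : ℝ} {x : E}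
    (h : HasLocallyLipschitzGradientAt f φ ρ x) {v : E} (hv : ‖v‖ ≤ ρ) :
    (f (x + v)).toReal ≤ (f x).toReal + inner ℝ (gradient (fun z => (f z).toReal) x) v +
      φ / 2 * ‖v‖ ^ 2 := by
  set F : E → ℝ := fun z => (f z).toReal with hF
  -- The function along the segment minus its quadratic model. The claim is k 1 ≤ k 0, and the
  -- gradient bound makes the derivative of k nonpositive.
  set k : ℝ → ℝ := fun t => F (x + t • v) - t * inner ℝ (gradient F x) v - φ / 2 * ‖v‖ ^ 2 * t ^ 2
    with hk
  have htv : ∀ t ∈ Set.Icc (0 : ℝ) 1, ‖t • v‖ ≤ ρ := fun t ht => by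
    rw [norm_smul, Real.norm_eq_abs, abs_of_nonneg ht.1]
    nlinarith [ht.2, norm_nonneg v]
  have hder : ∀ t ∈ Set.Icc (0 : ℝ) 1, HasDerivAt k (inner ℝ (gradient F (x + t • v)) v -
      inner ℝ (gradient F x) v - φ / 2 * ‖v‖ ^ 2 * (2 * t)) t := by
    intro t ht
    have h1 := ((h (x + t • v) (by simpa using htv t ht)).2.1.differentiableAt
      (by norm_num)).hasGradientAt.hasFDerivAt
    have h2 : HasDerivAt (fun t : ℝ => x + t • v) v t := by
      simpa using ((hasDerivAt_id t).smul_const v).const_add x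
    have h3 := h1.comp_hasDerivAt t h2
    have h4 := (h3.sub ((hasDerivAt_id t).mul_const (inner ℝ (gradient F x) v))).sub
      ((hasDerivAt_pow 2 t).const_mul (φ / 2 * ‖v‖ ^ 2))
    refine h4.congr_deriv ?_
    simp
    rfl
  have hanti : AntitoneOn k (Set.Icc 0 1) := by
    refine antitoneOn_of_deriv_nonpos (convex_Icc 0 1)
      (fun t ht => (hder t ht).continuousAt.continuousWithinAt) ?_ ?_
    · intro t ht
      rw [interior_Icc] at ht
      exact (hder t (Set.Ioo_subset_Icc_self ht)).differentiableAt.differentiableWithinAt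
    · intro t ht
      rw [interior_Icc] at ht
      have ht' := Set.Ioo_subset_Icc_self ht
      rw [(hder t ht').deriv, ← inner_sub_left]
      have h3 := (h (x + t • v) (by simpa using htv t ht')).2.2
      simp only [add_sub_cancel_left, norm_smul, Real.norm_eq_abs, abs_of_nonneg ht'.1] at h3
      have h4 := real_inner_le_norm (gradient F (x + t • v) - gradient F x) v
      nlinarith [norm_nonneg v]
  have := hanti (Set.left_mem_Icc.2 zero_le_one) (Set.right_mem_Icc.2 zero_le_one) zero_le_one
  simp only [hk, one_smul, zero_smul, add_zero, zero_mul, sub_zero, one_mul, one_pow, mul_one,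
    ne_eq, OfNat.ofNat_ne_zero, not_false_eq_true, zero_pow, mul_zero] at this
  simp only [hF] at this ⊢
  linarith

/-- The sublevel set of `f` at the height `B` above the value at `xs`. -/
def sublevel (f : E → ℝ≥0∞) (xs : E) (B : ℝ) : Set E :=
  {x | f x ≠ ⊤ ∧ (f x).toReal - (f xs).toReal ≤ B}

/-- A PL function with minimizer `xs` that is smooth and Lipschitz with uniform constants on a
sublevel set. -/
structure IsRegular (f : E → ℝ≥0∞) (xs : E) (B φ lam ρ μ : ℝ) : Prop where
  opt : ∀ x, f xs ≤ f x
  φ_pos : 0 < φ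
  lam_pos : 0 < lam
  ρ_pos : 0 < ρ
  smooth : ∀ x ∈ sublevel f xs B, HasLocallyLipschitzGradientAt f φ ρ x
  lipschitz : ∀ x ∈ sublevel f xs B, IsLocallyLipschitzAt f lam ρ x
  pl : IsPL f xs μ

namespace IsRegular

variable {f : E → ℝ≥0∞} {xs : E} {B φ lam ρ μ : ℝ}

lemma gap_nonneg (h : IsRegular f xs B φ lam ρ μ) {x : E} (hx : f x ≠ ⊤) :
    0 ≤ (f x).toReal - (f xs).toReal :=
  sub_nonneg.2 (ENNReal.toReal_mono hx (h.opt x))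

lemma norm_gradient_le (h : IsRegular f xs B φ lam ρ μ) {x : E} (hx : x ∈ sublevel f xs B) :
    ‖gradient (fun z => (f z).toReal) x‖ ≤ lam := by
  rw [gradient, LinearIsometryEquiv.norm_map]
  exact (h.lipschitz x hx).norm_fderiv_le h.ρ_pos h.lam_pos.le

/-- One step of gradient descent with a small step size. -/
lemma gradient_step (h : IsRegular f xs B φ lam ρ μ) {s : ℝ} (hs : 0 < s) (hsφ : φ * s ≤ 1 / 24)
    (hsl : s * lam ≤ ρ) {x : E} (hx : x ∈ sublevel f xs B) :
    x - s • gradient (fun z => (f z).toReal) x ∈ sublevel f xs B ∧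
    (f (x - s • gradient (fun z => (f z).toReal) x)).toReal ≤
      (f x).toReal - 47 / 48 * s * ‖gradient (fun z => (f z).toReal) x‖ ^ 2 ∧
    ‖gradient (fun z => (f z).toReal) x‖ ≤
      ‖gradient (fun z => (f z).toReal) (x - s • gradient (fun z => (f z).toReal) x)‖ +
        φ * s * ‖gradient (fun z => (f z).toReal) x‖ := by
  set g := gradient (fun z => (f z).toReal) x with hg
  have hle : ‖-(s • g)‖ ≤ ρ := by
    rw [norm_neg, norm_smul, Real.norm_eq_abs, abs_of_pos hs]
    exact (mul_le_mul_of_nonneg_left (h.norm_gradient_le hx) hs.le).trans hsl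
  have h1 := (h.smooth x hx).le_quadratic hle
  rw [← hg, inner_neg_right, real_inner_smul_right, real_inner_self_eq_norm_sq, norm_neg,
    norm_smul, Real.norm_eq_abs, abs_of_pos hs, ← sub_eq_add_neg] at h1
  have h2 := (h.smooth x hx) (x - s • g) (by rw [sub_sub_cancel_left]; exact hle)
  have h3 : (f (x - s • g)).toReal ≤ (f x).toReal - 47 / 48 * s * ‖g‖ ^ 2 := by
    have : φ * s * (s * ‖g‖ ^ 2) ≤ 1 / 24 * (s * ‖g‖ ^ 2) := by gcongr
    nlinarith
  refine ⟨⟨h2.1, ?_⟩, h3, ?_⟩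
  · have : 0 ≤ 47 / 48 * s * ‖g‖ ^ 2 := by positivity
    linarith [hx.2]
  · have h4 := h2.2.2
    rw [sub_sub_cancel_left, norm_neg, norm_smul, Real.norm_eq_abs, abs_of_pos hs, ← hg] at h4
    have h5 := norm_sub_norm_le g (gradient (fun z => (f z).toReal) (x - s • g))
    rw [norm_sub_rev] at h5
    linarith

/-- The gradient is controlled by the gap, with a constant independent of the radius `ρ`. -/
lemma mul_norm_gradient_sq_le (h : IsRegular f xs B φ lam ρ μ) {x : E}
    (hx : x ∈ sublevel f xs B) :
    μ * ‖gradient (fun z => (f z).toReal) x‖ ^ 2 ≤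
      (205 / 100) ^ 2 * φ ^ 2 * ((f x).toReal - (f xs).toReal) := by
  have hμ := h.pl.1
  have hφ := h.φ_pos
  set gr : E → E := gradient (fun z => (f z).toReal) with hgr
  set gap : E → ℝ := fun x => (f x).toReal - (f xs).toReal with hgap
  -- The usual bound of ‖∇f‖² by 2 φ times the gap needs a step of length ‖∇f‖ / φ, which may leave
  -- the ball of radius ρ. Short gradient steps are followed instead. By PL, √gap falls along them
  -- by about √μ / 2 times the distance travelled, while the gradient changes by at most φ times
  -- that distance and tends to 0. Hence ‖∇f x‖ ≤ 2 φ √(gap / μ), with 2.05 for 2 to absorb the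
  -- discretization.
  obtain ⟨s, hs, hsφ, hsl⟩ : ∃ s : ℝ, 0 < s ∧ φ * s ≤ 1 / 24 ∧ s * lam ≤ ρ := by
    have h1 := h.lam_pos
    have h2 := h.ρ_pos
    refine ⟨min (1 / (24 * φ)) (ρ / lam), by positivity, ?_, ?_⟩
    · calc φ * min (1 / (24 * φ)) (ρ / lam) ≤ φ * (1 / (24 * φ)) := by gcongr; exact min_le_left _ _
        _ = 1 / 24 := by field_simp
    · calc min (1 / (24 * φ)) (ρ / lam) * lam ≤ ρ / lam * lam := by gcongr; exact min_le_right _ _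
        _ = ρ := by field_simp
  set X : ℕ → E := fun n => (fun y => y - s • gr y)^[n] x with hX
  have hX1 : ∀ n, X (n + 1) = X n - s • gr (X n) := fun n => by
    simp only [hX, Function.iterate_succ_apply']
  have hXG : ∀ n, X n ∈ sublevel f xs B := by
    intro n
    induction n with
    | zero => simpa [hX] using hx
    | succ n ih => rw [hX1]; exact (h.gradient_step hs hsφ hsl ih).1
  have hdec : ∀ n, gap (X (n + 1)) ≤ gap (X n) - 47 / 48 * s * ‖gr (X n)‖ ^ 2 := fun n => by
    have := (h.gradient_step hs hsφ hsl (hXG n)).2.1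
    simp only [hgap, hX1]
    linarith
  have hgrad : ∀ n, ‖gr (X n)‖ ≤ ‖gr (X (n + 1))‖ + φ * s * ‖gr (X n)‖ := fun n => by
    rw [hX1]; exact (h.gradient_step hs hsφ hsl (hXG n)).2.2
  have hgap0 : ∀ n, 0 ≤ gap (X n) := fun n => h.gap_nonneg (hXG n).1
  have hpl : ∀ n, μ * gap (X n) ≤ ‖gr (X n)‖ ^ 2 := fun n => (h.pl.2 _ (hXG n).1).2
  have hlim : Filter.Tendsto (fun n => ‖gr (X n)‖) Filter.atTop (nhds 0) := by
    have hanti : Antitone fun n => gap (X n) := antitone_nat_of_succ_le fun n => by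
      have := hdec n
      have : 0 ≤ 47 / 48 * s * ‖gr (X n)‖ ^ 2 := by positivity
      linarith
    have hconv := tendsto_atTop_ciInf hanti ⟨0, by rintro _ ⟨n, rfl⟩; exact hgap0 n⟩
    have hdiff := hconv.sub (hconv.comp (Filter.tendsto_add_atTop_nat 1))
    rw [sub_self] at hdiff
    have hsq : Filter.Tendsto (fun n => ‖gr (X n)‖ ^ 2) Filter.atTop (nhds 0) := by
      have h1 := hdiff.const_mul (1 / (47 / 48 * s))
      rw [mul_zero] at h1
      refine squeeze_zero (fun n => sq_nonneg _) (fun n => ?_) h1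
      rw [one_div, ← div_eq_inv_mul, le_div_iff₀ (by positivity)]
      have := hdec n
      simp only [Function.comp]
      linarith
    have := hsq.sqrt
    simpa using this
  set c := 205 / 100 * φ / Real.sqrt μ with hc
  have hsμ : 0 < Real.sqrt μ := Real.sqrt_pos.2 hμ
  -- In each step the gradient norm falls by at most φ s G, and c √gap falls by at least as much.
  have hmono : Monotone fun n => ‖gr (X n)‖ - c * Real.sqrt (gap (X n)) := by
    refine monotone_nat_of_le_succ fun n => ?_
    set a := Real.sqrt (gap (X n)) with ha
    set b := Real.sqrt (gap (X (n + 1))) with hb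
    have ha0 : 0 ≤ a := Real.sqrt_nonneg _
    have hb0 : 0 ≤ b := Real.sqrt_nonneg _
    have ha2 : a ^ 2 = gap (X n) := Real.sq_sqrt (hgap0 n)
    have hb2 : b ^ 2 = gap (X (n + 1)) := Real.sq_sqrt (hgap0 (n + 1))
    have h1 := hdec n
    have h2 := hgrad n
    have h3 := hpl n
    rw [← ha2, ← hb2] at h1
    rw [← ha2] at h3
    set G := ‖gr (X n)‖ with hG
    have hG0 : 0 ≤ G := norm_nonneg _
    have hba : b ≤ a := by
      refine le_of_sq_le_sq ?_ ha0
      have : 0 ≤ 47 / 48 * s * G ^ 2 := by positivity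
      linarith
    have hma : Real.sqrt μ * a ≤ G := by
      refine le_of_sq_le_sq ?_ hG0
      rw [mul_pow, Real.sq_sqrt hμ.le]
      exact h3
    suffices hkey : φ * s * G ≤ c * (a - b) by linarith
    -- At zero gap one cannot divide by a, but there the descent inequality forces the gradient to
    -- vanish.
    rcases ha0.eq_or_lt with ha' | ha'
    · have hb' : b = 0 := le_antisymm (by rw [ha']; exact hba) hb0
      have : G ^ 2 ≤ 0 := by
        rw [← ha', hb'] at h1
        nlinarith
      have : G = 0 := by nlinarith
      rw [this, ← ha', hb']
      simp
    -- Here a² - b² ≤ 2 a (a - b) since b ≤ a. Dividing by a and using √μ a ≤ G bounds the drop of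
    -- √gap from below; the constant works because 2 · 48 / 47 ≤ 2.05.
    · have h4 : 47 / 48 * s * G ^ 2 ≤ 2 * a * (a - b) := by nlinarith
      have h5 : 47 / 48 * s * G * Real.sqrt μ ≤ 2 * (a - b) := by
        have : 47 / 48 * s * G * (Real.sqrt μ * a) ≤ 47 / 48 * s * G * G := by gcongr
        have h6 : (47 / 48 * s * G * Real.sqrt μ) * a ≤ (2 * (a - b)) * a := by nlinarith
        exact le_of_mul_le_mul_right h6 ha'
      rw [hc, div_mul_eq_mul_div, le_div_iff₀ hsμ]
      have h7 : 0 ≤ s * G * Real.sqrt μ := by positivity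
      have h8 : φ * (47 / 48 * s * G * Real.sqrt μ) ≤ φ * (2 * (a - b)) := by gcongr
      nlinarith [mul_nonneg hφ.le h7]
  have hfin : ‖gr (X 0)‖ - c * Real.sqrt (gap (X 0)) ≤ 0 := by
    refine ge_of_tendsto' hlim fun n => ?_
    have h1 := hmono (Nat.zero_le n)
    have h2 : 0 ≤ c * Real.sqrt (gap (X n)) := by positivity
    simp only at h1
    linarith
  have hX0 : X 0 = x := rfl
  rw [hX0] at hfin
  have h1 : Real.sqrt μ * ‖gr x‖ ≤ 205 / 100 * φ * Real.sqrt (gap x) := by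
    rw [hc, div_mul_eq_mul_div, sub_nonpos, le_div_iff₀ hsμ] at hfin
    linarith
  have h2 := pow_le_pow_left₀ (by positivity) h1 2
  rw [mul_pow, mul_pow, mul_pow, Real.sq_sqrt hμ.le, Real.sq_sqrt (hX0 ▸ hgap0 0)] at h2
  exact h2

/-- PL and its converse bound ‖∇f‖² by multiples of the gap from both sides, and a positive gap
cancels. For η ≤ 1 / (2φ) this keeps η μ below 2, so that 1 - η μ / 2 is a legitimate contraction
factor. -/
lemma le_of_gap_pos (h : IsRegular f xs B φ lam ρ μ) {x : E} (hx : x ∈ sublevel f xs B)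
    (hpos : 0 < (f x).toReal - (f xs).toReal) : μ ≤ 205 / 100 * φ := by
  have h1 := h.mul_norm_gradient_sq_le hx
  have h2 := (h.pl.2 x hx.1).2
  have hμ := h.pl.1
  have hφ := h.φ_pos
  refine le_of_sq_le_sq ?_ (by positivity)
  have h3 := (mul_le_mul_of_nonneg_left h2 hμ.le).trans h1
  have h4 : μ ^ 2 * ((f x).toReal - (f xs).toReal) ≤
      (205 / 100 * φ) ^ 2 * ((f x).toReal - (f xs).toReal) := by nlinarith
  exact le_of_mul_le_mul_right h4 hpos

/-- Small perturbations of a point of a sublevel set stay in a larger sublevel set. -/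
lemma add_mem_sublevel {d : ℝ} (h : IsRegular f xs (10 * d) φ lam ρ μ) (hμφ : μ ≤ 205 / 100 * φ)
    (hd : 0 < d) {r : ℝ} (hrρ : r ≤ ρ) (hrφ : φ ^ 2 * r ^ 2 ≤ d * μ) {x v : E}
    (hx : x ∈ sublevel f xs (9 / 2 * d)) (hv : ‖v‖ ≤ r) : x + v ∈ sublevel f xs (10 * d) := by
  have hφ := h.φ_pos
  have hμ := h.pl.1
  have hxG : x ∈ sublevel f xs (10 * d) := ⟨hx.1, hx.2.trans (by linarith)⟩
  have hvρ := hv.trans hrρ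
  refine ⟨((h.smooth x hxG) (x + v) (by simpa using hvρ)).1, ?_⟩
  have h1 := (h.smooth x hxG).le_quadratic hvρ
  set g := gradient (fun z => (f z).toReal) x with hg
  have h2 := (real_inner_le_norm g v).trans (mul_le_mul_of_nonneg_left hv (norm_nonneg g))
  have h3 := h.mul_norm_gradient_sq_le hxG
  rw [← hg] at h3
  -- Here 2.05² · 9/2 ≤ 4.35². Together with the quadratic term the total is 4.5 + 4.35 + 1.025 <
  -- 10, which is what the height 9/2 is chosen for.
  have h4 : (‖g‖ * r) ≤ 435 / 100 * d := by
    refine le_of_sq_le_sq ?_ (by positivity)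
    have hle : μ * ‖g‖ ^ 2 ≤ (205 / 100) ^ 2 * φ ^ 2 * (9 / 2 * d) :=
      h3.trans (mul_le_mul_of_nonneg_left hx.2 (by positivity))
    have h5 : (μ * ‖g‖ ^ 2) * (φ ^ 2 * r ^ 2) ≤
        ((205 / 100) ^ 2 * φ ^ 2 * (9 / 2 * d)) * (d * μ) :=
      mul_le_mul hle hrφ (by positivity) (by positivity)
    have h6 : (μ * φ ^ 2) * (‖g‖ * r) ^ 2 ≤ (μ * φ ^ 2) * (435 / 100 * d) ^ 2 := by
      have : 0 ≤ μ * φ ^ 2 * d ^ 2 := by positivity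
      nlinarith
    exact le_of_mul_le_mul_left h6 (by positivity)
  have h5 : φ / 2 * ‖v‖ ^ 2 ≤ 1025 / 1000 * d := by
    have h6 : φ / 2 * ‖v‖ ^ 2 ≤ φ / 2 * r ^ 2 := by gcongr
    have h7 : φ * (φ / 2 * r ^ 2) ≤ φ * (1025 / 1000 * d) := by nlinarith
    exact h6.trans (le_of_mul_le_mul_left h7 hφ)
  have := hx.2
  simp only [hg] at *
  linarith

end IsRegular

end Descent

end LQR

/-! ### Traces, the Frobenius norm, and Stein equations in a Banach algebra. -/

namespace LQR

section Trace

open scoped Matrix.Norms.Frobenius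

variable {n p q : Type*} [Fintype n] [Fintype p] [Fintype q]

lemma trace_transpose_mul_mul (N : Matrix n n ℝ) (X : Matrix n p ℝ) :
    (Xᵀ * N * X).trace = ∑ j, X.col j ⬝ᵥ (N *ᵥ X.col j) := by
  rw [Matrix.mul_assoc]
  simp only [Matrix.trace, Matrix.diag, Matrix.mul_apply, dotProduct,
    Matrix.mulVec, Matrix.transpose_apply, Matrix.col]

lemma frobenius_norm_sq (X : Matrix n p ℝ) : ‖X‖ ^ 2 = ∑ j, X.col j ⬝ᵥ X.col j := by
  rw [Matrix.frobenius_norm_def, ← Real.sqrt_eq_rpow, Real.sq_sqrt (by positivity),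
    Finset.sum_comm]
  simp [dotProduct, Matrix.col, sq]

lemma frobenius_norm_sq_eq_trace (X : Matrix n p ℝ) : ‖X‖ ^ 2 = (Xᵀ * X).trace := by
  classical
  have := trace_transpose_mul_mul (1 : Matrix n n ℝ) X
  simp only [Matrix.mul_one, Matrix.one_mulVec] at this
  rw [this, frobenius_norm_sq]

lemma mulVec_dotProduct_self_le (X : Matrix n p ℝ) (x : p → ℝ) :
    (X *ᵥ x) ⬝ᵥ (X *ᵥ x) ≤ ‖X‖ ^ 2 * (x ⬝ᵥ x) := by
  rw [Matrix.frobenius_norm_def, ← Real.sqrt_eq_rpow, Real.sq_sqrt (by positivity),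
    Finset.sum_mul]
  simp only [dotProduct, Matrix.mulVec]
  refine Finset.sum_le_sum fun i _ => ?_
  rw [← sq]
  refine (Finset.sum_mul_sq_le_sq_mul_sq _ _ _).trans (le_of_eq ?_)
  simp [sq]

lemma abs_dotProduct_mulVec_le (X : Matrix n n ℝ) (x : n → ℝ) :
    |x ⬝ᵥ (X *ᵥ x)| ≤ ‖X‖ * (x ⬝ᵥ x) := by
  have hx : 0 ≤ x ⬝ᵥ x := by
    simp only [dotProduct]; exact Finset.sum_nonneg fun i _ => mul_self_nonneg _
  refine abs_le_of_sq_le_sq ?_ (by positivity)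
  have h1 : (x ⬝ᵥ (X *ᵥ x)) ^ 2 ≤ (x ⬝ᵥ x) * ((X *ᵥ x) ⬝ᵥ (X *ᵥ x)) := by
    simp only [dotProduct, ← sq]
    exact Finset.sum_mul_sq_le_sq_mul_sq _ _ _
  have h2 := mulVec_dotProduct_self_le X x
  nlinarith

lemma dotProduct_self_nonneg' (x : n → ℝ) : 0 ≤ x ⬝ᵥ x := by
  simp only [dotProduct]; exact Finset.sum_nonneg fun i _ => mul_self_nonneg _

/-- A positive definite matrix is bounded below by a positive multiple of the identity. -/
lemma exists_pos_mul_le_of_posDef {N : Matrix n n ℝ} (hN : N.PosDef) :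
    ∃ c : ℝ, 0 < c ∧ ∀ x : n → ℝ, c * (x ⬝ᵥ x) ≤ x ⬝ᵥ (N *ᵥ x) := by
  classical
  rcases isEmpty_or_nonempty n with hn | hn
  · exact ⟨1, one_pos, fun x => by simp [dotProduct]⟩
  set S : Set (n → ℝ) := {x | x ⬝ᵥ x = 1} with hS
  have hcont : Continuous fun x : n → ℝ => x ⬝ᵥ x := by
    simp only [dotProduct]; fun_prop
  have hcontN : Continuous fun x : n → ℝ => x ⬝ᵥ (N *ᵥ x) := by
    simp only [dotProduct, Matrix.mulVec]; fun_prop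
  have hSc : IsCompact S := by
    refine Metric.isCompact_of_isClosed_isBounded (isClosed_eq hcont continuous_const) ?_
    refine (Metric.isBounded_closedBall (x := (0 : n → ℝ)) (r := 1)).subset fun x hx => ?_
    rw [mem_closedBall_zero_iff, pi_norm_le_iff_of_nonneg zero_le_one]
    intro i
    have h1 : x i * x i ≤ x ⬝ᵥ x :=
      Finset.single_le_sum (f := fun i => x i * x i) (fun i _ => mul_self_nonneg _)
        (Finset.mem_univ i)
    rw [show x ⬝ᵥ x = 1 from hx] at h1
    rw [Real.norm_eq_abs]
    exact abs_le_one_iff_mul_self_le_one.2 h1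
  have hSn : S.Nonempty := by
    obtain ⟨i⟩ := hn
    exact ⟨Pi.single i 1, by simp [hS]⟩
  obtain ⟨x₀, hx₀, hmin⟩ := hSc.exists_isMinOn hSn hcontN.continuousOn
  have hx₀0 : x₀ ≠ 0 := by
    rintro rfl
    simp [hS] at hx₀
  refine ⟨x₀ ⬝ᵥ (N *ᵥ x₀), by simpa using hN.dotProduct_mulVec_pos hx₀0, fun x => ?_⟩
  rcases eq_or_ne x 0 with rfl | hx
  · simp
  have hxx : 0 < x ⬝ᵥ x := lt_of_le_of_ne (dotProduct_self_nonneg' x)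
    (by rw [ne_comm, ne_eq, dotProduct_self_eq_zero]; exact hx)
  set a := Real.sqrt (x ⬝ᵥ x) with ha
  have ha0 : 0 < a := Real.sqrt_pos.2 hxx
  have ha2 : a * a = x ⬝ᵥ x := Real.mul_self_sqrt hxx.le
  have hmem : a⁻¹ • x ∈ S := by
    simp only [hS, Set.mem_ofPred_eq, smul_dotProduct, dotProduct_smul, smul_eq_mul, ← ha2]
    field_simp
  have := hmin hmem
  simp only [Set.mem_ofPred_eq, Matrix.mulVec_smul, smul_dotProduct, dotProduct_smul,
    smul_eq_mul] at this
  rw [← ha2]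
  calc _ ≤ (a⁻¹ * (a⁻¹ * x ⬝ᵥ (N *ᵥ x))) * (a * a) := by gcongr
    _ = x ⬝ᵥ (N *ᵥ x) := by field_simp

lemma mul_norm_sq_le_trace {N : Matrix n n ℝ} {c : ℝ}
    (hN : ∀ x : n → ℝ, c * (x ⬝ᵥ x) ≤ x ⬝ᵥ (N *ᵥ x)) (X : Matrix n p ℝ) :
    c * ‖X‖ ^ 2 ≤ (Xᵀ * N * X).trace := by
  rw [trace_transpose_mul_mul, frobenius_norm_sq, Finset.mul_sum]
  exact Finset.sum_le_sum fun j _ => hN _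

lemma trace_transpose_mul_mul_nonneg {N : Matrix n n ℝ} (hN : ∀ x : n → ℝ, 0 ≤ x ⬝ᵥ (N *ᵥ x))
    (X : Matrix n p ℝ) : 0 ≤ (Xᵀ * N * X).trace := by
  rw [trace_transpose_mul_mul]
  exact Finset.sum_nonneg fun j _ => hN _

lemma dotProduct_transpose_mul_mulVec (X : Matrix n p ℝ) (N : Matrix n q ℝ) (x : p → ℝ)
    (y : q → ℝ) : x ⬝ᵥ ((Xᵀ * N) *ᵥ y) = (X *ᵥ x) ⬝ᵥ (N *ᵥ y) := by
  rw [← Matrix.mulVec_mulVec, Matrix.dotProduct_mulVec, Matrix.vecMul_transpose]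

end Trace

section Series

variable {A : Type*} [NormedRing A]

/-- Division of n by t reduces the sum to finitely many geometric series. Squares suffice because a
matrix and its transpose have powers of equal Frobenius norm. -/
lemma summable_norm_sq_pow {a : A} {t : ℕ} (ht : t ≠ 0) (h : ‖a ^ t‖ < 1) :
    Summable fun n => ‖a ^ n‖ ^ 2 := by
  have : NeZero t := ⟨ht⟩
  rw [← (Nat.divModEquiv t).symm.summable_iff]
  have hs : Summable fun p : ℕ × Fin t => (‖a ^ t‖ ^ 2) ^ p.1 * ‖a ^ (p.2 : ℕ)‖ ^ 2 := by
    refine Summable.mul_of_nonneg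
      (f := fun q : ℕ => (‖a ^ t‖ ^ 2) ^ q) (g := fun s : Fin t => ‖a ^ (s : ℕ)‖ ^ 2) ?_
      (Summable.of_finite) (fun q => pow_nonneg (sq_nonneg _) q) (fun s => sq_nonneg _)
    exact summable_geometric_of_lt_one (by positivity)
      (pow_lt_one₀ (norm_nonneg _) h two_ne_zero)
  have hpow : ∀ (q : ℕ) (b : A), ‖(a ^ t) ^ q * b‖ ≤ ‖a ^ t‖ ^ q * ‖b‖ := by
    intro q b
    induction q with
    | zero => simp
    | succ q ih =>
      rw [pow_succ', mul_assoc, pow_succ', mul_assoc]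
      exact (norm_mul_le _ _).trans (by gcongr)
  refine hs.of_nonneg_of_le (fun p => sq_nonneg _) fun p => ?_
  simp only [Function.comp, Nat.divModEquiv_symm_apply]
  rw [← pow_mul, mul_comm 2, pow_mul, ← mul_pow]
  refine pow_le_pow_left₀ (norm_nonneg _) ?_ 2
  rw [pow_add, pow_mul']
  exact hpow _ _

/-- The norm of x need not be below 1: summability of the Neumann series is all that invertibility
needs. -/
lemma exists_unit_eq_one_sub {A : Type*} [NormedRing A] {x : A} (h : Summable (x ^ ·)) :
    ∃ u : Aˣ, (u : A) = 1 - x ∧ Ring.inverse (1 - x) = ∑' n : ℕ, x ^ n :=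
  ⟨⟨1 - x, ∑' n : ℕ, x ^ n, h.one_sub_mul_tsum_pow, h.tsum_pow_mul_one_sub⟩, rfl,
    Ring.inverse_unit
      (⟨1 - x, ∑' n : ℕ, x ^ n, h.one_sub_mul_tsum_pow, h.tsum_pow_mul_one_sub⟩ : Aˣ)⟩

variable [NormedAlgebra ℝ A]

/-- The operator `X ↦ a * X * b`. -/
noncomputable def sandwich (a b : A) : A →L[ℝ] A := ContinuousLinearMap.mulLeftRight ℝ A a b

lemma sandwich_apply (a b X : A) : sandwich a b X = a * X * b := rfl

lemma sandwich_pow (a b : A) (n : ℕ) : sandwich a b ^ n = sandwich (a ^ n) (b ^ n) := by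
  induction n with
  | zero => ext1 X; simp [sandwich_apply]
  | succ n ih =>
    ext1 X
    rw [pow_succ', ih]
    simp only [mul_apply_eq_comp, sandwich_apply]
    rw [pow_succ' a, pow_succ b]
    simp only [mul_assoc]

variable [CompleteSpace A]

lemma summable_sandwich {a b : A} (h : Summable fun n => ‖a ^ n‖ * ‖b ^ n‖) :
    Summable (sandwich a b ^ ·) := by
  refine Summable.of_norm_bounded h fun n => ?_
  rw [sandwich_pow]
  exact ContinuousLinearMap.opNorm_mulLeftRight_apply_apply_le ℝ A _ _

/-- The solution of the Stein equation `X - a X b = w`. -/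
noncomputable def stein (a b w : A) : A := Ring.inverse (1 - sandwich a b) w

lemma hasSum_stein {a b : A} (h : Summable fun n => ‖a ^ n‖ * ‖b ^ n‖) (w : A) :
    HasSum (fun n => a ^ n * w * b ^ n) (stein a b w) := by
  obtain ⟨u, hu, hinv⟩ := exists_unit_eq_one_sub (x := sandwich a b) (summable_sandwich h)
  have h1 := (summable_sandwich h).hasSum.mapL (ContinuousLinearMap.apply ℝ A w)
  simp only [ContinuousLinearMap.apply_apply, sandwich_pow, sandwich_apply] at h1
  rw [stein, hinv]
  simpa only [sandwich_pow] using h1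

lemma stein_eq {a b : A} (h : Summable fun n => ‖a ^ n‖ * ‖b ^ n‖) (w : A) :
    stein a b w = w + a * stein a b w * b := by
  obtain ⟨u, hu, hinv⟩ := exists_unit_eq_one_sub (x := sandwich a b) (summable_sandwich h)
  have h1 : (1 - sandwich a b) * Ring.inverse (1 - sandwich a b) = 1 := by
    rw [hinv]; exact (summable_sandwich h).one_sub_mul_tsum_pow
  have h2 := congrArg (fun f : A →L[ℝ] A => f w) h1
  simp only [mul_apply_eq_comp, _root_.sub_apply,
    one_apply_eq_self, sandwich_apply] at h2
  rw [stein]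
  exact sub_eq_iff_eq_add.1 h2

/-- Smoothness comes from that of inversion at a unit of the operator algebra, so the series is
never differentiated. -/
lemma contDiffAt_stein {E : Type*} [NormedAddCommGroup E] [NormedSpace ℝ E] {a b w : E → A}
    {x : E} {n : WithTop ℕ∞} (ha : ContDiffAt ℝ n a x) (hb : ContDiffAt ℝ n b x)
    (hw : ContDiffAt ℝ n w x) (h : Summable fun n => ‖a x ^ n‖ * ‖b x ^ n‖) :
    ContDiffAt ℝ n (fun y => stein (a y) (b y) (w y)) x := by
  obtain ⟨u, hu, -⟩ := exists_unit_eq_one_sub (x := sandwich (a x) (b x)) (summable_sandwich h)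
  have h1 : ContDiffAt ℝ n (fun y => sandwich (a y) (b y)) x := by
    unfold sandwich
    fun_prop
  have h2 : ContDiffAt ℝ n (fun y => Ring.inverse (1 - sandwich (a y) (b y))) x := by
    refine ContDiffAt.comp (g := Ring.inverse) (f := fun y => 1 - sandwich (a y) (b y)) x ?_
      (contDiffAt_const.sub h1)
    rw [← hu]
    exact contDiffAt_ringInverse ℝ u
  exact h2.clm_apply hw

end Series

end LQR

/-! ### The cost as a trace: stability, finiteness and smoothness. -/

namespace LQR

section Functionals

open scoped Matrix.Norms.Frobenius

variable {m : ℕ}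

/-- The trace as a continuous linear functional. -/
noncomputable def traceCLM (m : ℕ) : Matrix (Fin m) (Fin m) ℝ →L[ℝ] ℝ :=
  LinearMap.toContinuousLinearMap (Matrix.traceLinearMap (Fin m) ℝ ℝ)

lemma traceCLM_apply (X : Matrix (Fin m) (Fin m) ℝ) : traceCLM m X = X.trace := rfl

/-- The quadratic form `X ↦ sᵀ X s` as a continuous linear functional of the matrix. -/
noncomputable def quadCLM (s : State m) : Matrix (Fin m) (Fin m) ℝ →L[ℝ] ℝ :=
  LinearMap.toContinuousLinearMap
    { toFun := fun X => s ⬝ᵥ (X *ᵥ s)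
      map_add' := fun X Y => by rw [Matrix.add_mulVec, dotProduct_add]
      map_smul' := fun c X => by rw [Matrix.smul_mulVec, dotProduct_smul]; rfl }

lemma contDiff_matrix {E : Type*} [NormedAddCommGroup E] [NormedSpace ℝ E] {n : WithTop ℕ∞}
    {f : E → Matrix (Fin m) (Fin m) ℝ} (h : ∀ i j, ContDiff ℝ n fun x => f x i j) :
    ContDiff ℝ n f := by
  have : f = fun x => ∑ i, ∑ j, f x i j • Matrix.single i j (1 : ℝ) := by
    ext1 x
    conv_lhs => rw [Matrix.matrix_eq_sum_single (f x)]
    simp [Matrix.smul_single]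
  rw [this]
  exact ContDiff.sum fun i _ => ContDiff.sum fun j _ => (h i j).smul contDiff_const

end Functionals

namespace IsInitialLaw

variable {m : ℕ} {ν : Measure (State m)} {Cm : ℝ}

lemma integrable_mul (h : IsInitialLaw ν Cm) (i j : Fin m) : Integrable (fun s => s i * s j) ν := by
  have := h.isProb
  refine Integrable.of_bound (by fun_prop) Cm ?_
  filter_upwards [h.bounded] with s hs
  refine le_trans ?_ hs
  have hle : ∀ i, s i ^ 2 ≤ s ⬝ᵥ s := fun i => by
    rw [sq]
    exact Finset.single_le_sum (f := fun i => s i * s i) (fun i _ => mul_self_nonneg _)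
      (Finset.mem_univ i)
  rw [Real.norm_eq_abs]
  refine abs_le_of_sq_le_sq ?_ (dotProduct_self_nonneg' s)
  rw [mul_pow, sq (s ⬝ᵥ s)]
  exact mul_le_mul (hle i) (hle j) (sq_nonneg _) (dotProduct_self_nonneg' s)

lemma quad_eq (s : State m) (N : Matrix (Fin m) (Fin m) ℝ) :
    s ⬝ᵥ (N *ᵥ s) = ∑ i, ∑ j, N i j * (s i * s j) := by
  simp only [dotProduct, Matrix.mulVec, Finset.mul_sum]
  refine Finset.sum_congr rfl fun i _ => Finset.sum_congr rfl fun j _ => by ring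

lemma integrable_quad (h : IsInitialLaw ν Cm) (N : Matrix (Fin m) (Fin m) ℝ) :
    Integrable (fun s => s ⬝ᵥ (N *ᵥ s)) ν := by
  simp only [quad_eq]
  exact integrable_finsetSum _ fun i _ => integrable_finsetSum _ fun j _ =>
    (h.integrable_mul i j).const_mul _

/-- The identity covariance enters here: population quantities are traces of the matrices whose
quadratic forms are the sample quantities. -/
lemma integral_quad (h : IsInitialLaw ν Cm) (N : Matrix (Fin m) (Fin m) ℝ) :
    ∫ s, s ⬝ᵥ (N *ᵥ s) ∂ν = N.trace := by
  simp only [quad_eq]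
  have hj : ∀ i j, Integrable (fun s : State m => N i j * (s i * s j)) ν := fun i j =>
    (h.integrable_mul i j).const_mul _
  have hi : ∀ i, Integrable (fun s : State m => ∑ j, N i j * (s i * s j)) ν := fun i =>
    integrable_finsetSum _ fun j _ => hj i j
  rw [integral_finsetSum _ fun i _ => hi i]
  have h1 : ∀ i, ∫ s, ∑ j, N i j * (s i * s j) ∂ν = N i i := fun i => by
    rw [integral_finsetSum _ fun j _ => hj i j]
    simp only [integral_const_mul, h.covariance]
    simp [Matrix.one_apply]
  simp only [h1, Matrix.trace, Matrix.diag]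

lemma Cm_nonneg (h : IsInitialLaw ν Cm) : 0 ≤ Cm := by
  have := h.isProb
  obtain ⟨s, hs⟩ := h.bounded.exists
  exact (dotProduct_self_nonneg' s).trans hs

end IsInitialLaw

namespace System

open scoped Matrix.Norms.Frobenius

variable {m k : ℕ} (S : System m k)

/-- The discounted closed loop matrix `√γ (A - B K)`. -/
noncomputable def loop (K : Policy m k) : Matrix (Fin m) (Fin m) ℝ :=
  Real.sqrt S.γ • (S.A - S.B * K.mat)

/-- The matrix `Q + Kᵀ R K` of the stage cost. -/
noncomputable def weight (K : Policy m k) : Matrix (Fin m) (Fin m) ℝ :=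
  S.Q + K.matᵀ * S.R * K.mat

/-- The matrix of the quadratic form of the discounted cost at time `t`. -/
noncomputable def costTerm (K : Policy m k) (t : ℕ) : Matrix (Fin m) (Fin m) ℝ :=
  (S.loop K)ᵀ ^ t * S.weight K * S.loop K ^ t

lemma trajectory_eq (K : Policy m k) (s : State m) (t : ℕ) :
    S.trajectory K s t = (S.A - S.B * K.mat) ^ t *ᵥ s := by
  induction t with
  | zero => simp [trajectory]
  | succ t ih =>
    rw [trajectory, ih, control, pow_succ', ← Matrix.mulVec_mulVec, Matrix.sub_mulVec,
      ← Matrix.mulVec_mulVec, Matrix.mulVec_neg]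
    abel

lemma loop_pow (K : Policy m k) (t : ℕ) :
    S.loop K ^ t = Real.sqrt S.γ ^ t • (S.A - S.B * K.mat) ^ t := by
  rw [loop, smul_pow]

lemma quad_weight (K : Policy m k) (y : State m) :
    y ⬝ᵥ (S.weight K *ᵥ y) = S.stageCost y (control K y) := by
  rw [weight, Matrix.add_mulVec, dotProduct_add, Matrix.mul_assoc, dotProduct_transpose_mul_mulVec,
    stageCost, control, Matrix.mulVec_neg, neg_dotProduct_neg, Matrix.mulVec_mulVec]

/-- Splitting γ into √γ √γ absorbs the discount into the closed loop on both sides, so that the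
discounted problem is an undiscounted one for `loop`. -/
lemma quad_costTerm (K : Policy m k) (s : State m) (t : ℕ) :
    s ⬝ᵥ (S.costTerm K t *ᵥ s) =
      S.γ ^ t * S.stageCost (S.trajectory K s t) (control K (S.trajectory K s t)) := by
  rw [costTerm, ← Matrix.transpose_pow, Matrix.mul_assoc, dotProduct_transpose_mul_mulVec,
    ← Matrix.mulVec_mulVec, loop_pow, Matrix.smul_mulVec, Matrix.mulVec_smul, smul_dotProduct,
    dotProduct_smul, ← trajectory_eq, quad_weight, smul_eq_mul, smul_eq_mul, ← mul_assoc,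
    ← mul_pow, Real.mul_self_sqrt S.γ_pos.le]

lemma quad_Q_nonneg (y : State m) : 0 ≤ y ⬝ᵥ (S.Q *ᵥ y) := by
  simpa using S.Q_posDef.posSemidef.dotProduct_mulVec_nonneg y

lemma quad_R_nonneg (y : Fin k → ℝ) : 0 ≤ y ⬝ᵥ (S.R *ᵥ y) := by
  simpa using S.R_posDef.posSemidef.dotProduct_mulVec_nonneg y

lemma quad_weight_nonneg (K : Policy m k) (y : State m) : 0 ≤ y ⬝ᵥ (S.weight K *ᵥ y) := by
  rw [quad_weight, stageCost]
  exact add_nonneg (S.quad_Q_nonneg _) (S.quad_R_nonneg _)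

lemma quad_costTerm_nonneg (K : Policy m k) (s : State m) (t : ℕ) :
    0 ≤ s ⬝ᵥ (S.costTerm K t *ᵥ s) := by
  rw [costTerm, ← Matrix.transpose_pow, Matrix.mul_assoc, dotProduct_transpose_mul_mulVec,
    ← Matrix.mulVec_mulVec]
  exact S.quad_weight_nonneg _ _

lemma trace_costTerm_nonneg (K : Policy m k) (t : ℕ) : 0 ≤ (S.costTerm K t).trace := by
  rw [costTerm, ← Matrix.transpose_pow]
  exact trace_transpose_mul_mul_nonneg (S.quad_weight_nonneg K) _

lemma sampleCost_eq_tsum (K : Policy m k) (s : State m) :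
    S.sampleCost K s = ∑' t, ENNReal.ofReal (s ⬝ᵥ (S.costTerm K t *ᵥ s)) := by
  simp only [quad_costTerm, sampleCost]

lemma measurable_quad (N : Matrix (Fin m) (Fin m) ℝ) : Measurable fun s => s ⬝ᵥ (N *ᵥ s) := by
  simp only [IsInitialLaw.quad_eq]
  fun_prop

variable {S} {ν : Measure (State m)} {Cm : ℝ}

lemma cost_eq_tsum (hν : IsInitialLaw ν Cm) (K : Policy m k) :
    S.cost ν K = ∑' t, ENNReal.ofReal (S.costTerm K t).trace := by
  simp only [cost, sampleCost_eq_tsum]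
  rw [lintegral_tsum fun t => ((measurable_quad _).ennreal_ofReal).aemeasurable]
  congr 1
  ext1 t
  rw [← hν.integral_quad, ofReal_integral_eq_lintegral_ofReal (hν.integrable_quad _)
    (Filter.Eventually.of_forall fun s => S.quad_costTerm_nonneg K s t)]

variable (S) in
/-- Some power of the closed loop matrix is a contraction. -/
def Stab (K : Policy m k) : Prop := ∃ t ≠ 0, ‖S.loop K ^ t‖ < 1

lemma Stab.summable {K : Policy m k} (h : S.Stab K) :
    (Summable fun n => ‖(S.loop K)ᵀ ^ n‖ * ‖S.loop K ^ n‖) ∧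
      Summable fun n => ‖S.loop K ^ n‖ * ‖(S.loop K)ᵀ ^ n‖ := by
  obtain ⟨t, ht, h1⟩ := h
  have h2 := summable_norm_sq_pow ht h1
  simp only [← Matrix.transpose_pow, Matrix.frobenius_norm_transpose, ← sq]
  exact ⟨h2, h2⟩

variable (S) in
/-- The matrix of the quadratic form of the sample cost. -/
noncomputable def valueMat (K : Policy m k) : Matrix (Fin m) (Fin m) ℝ :=
  stein (S.loop K)ᵀ (S.loop K) (S.weight K)

variable (S) in
/-- The discounted state covariance matrix. -/
noncomputable def covMat (K : Policy m k) : Matrix (Fin m) (Fin m) ℝ :=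
  stein (S.loop K) (S.loop K)ᵀ 1

lemma Stab.hasSum_quad {K : Policy m k} (h : S.Stab K) (s : State m) :
    HasSum (fun t => s ⬝ᵥ (S.costTerm K t *ᵥ s)) (s ⬝ᵥ (S.valueMat K *ᵥ s)) :=
  (hasSum_stein h.summable.1 (S.weight K)).mapL (quadCLM s)

lemma Stab.hasSum_trace {K : Policy m k} (h : S.Stab K) :
    HasSum (fun t => (S.costTerm K t).trace) (S.valueMat K).trace :=
  (hasSum_stein h.summable.1 (S.weight K)).mapL (traceCLM m)

lemma Stab.sampleCost_eq {K : Policy m k} (h : S.Stab K) (s : State m) :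
    S.sampleCost K s = ENNReal.ofReal (s ⬝ᵥ (S.valueMat K *ᵥ s)) := by
  rw [sampleCost_eq_tsum, ← (h.hasSum_quad s).tsum_eq,
    ENNReal.ofReal_tsum_of_nonneg (S.quad_costTerm_nonneg K s) (h.hasSum_quad s).summable]

lemma Stab.cost_eq (hν : IsInitialLaw ν Cm) {K : Policy m k} (h : S.Stab K) :
    S.cost ν K = ENNReal.ofReal (S.valueMat K).trace := by
  rw [cost_eq_tsum hν, ← h.hasSum_trace.tsum_eq,
    ENNReal.ofReal_tsum_of_nonneg (S.trace_costTerm_nonneg K) h.hasSum_trace.summable]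

lemma Stab.quad_nonneg {K : Policy m k} (h : S.Stab K) (s : State m) :
    0 ≤ s ⬝ᵥ (S.valueMat K *ᵥ s) :=
  (h.hasSum_quad s).nonneg (S.quad_costTerm_nonneg K s)

lemma Stab.trace_nonneg {K : Policy m k} (h : S.Stab K) : 0 ≤ (S.valueMat K).trace :=
  h.hasSum_trace.nonneg (S.trace_costTerm_nonneg K)

/-- A policy has finite cost if and only if it stabilizes the discounted system. -/
lemma cost_ne_top_iff (hν : IsInitialLaw ν Cm) (K : Policy m k) :
    S.cost ν K ≠ ⊤ ↔ S.Stab K := by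
  refine ⟨fun h => ?_, fun h => by rw [h.cost_eq hν]; exact ENNReal.ofReal_ne_top⟩
  rw [cost_eq_tsum hν] at h
  have h1 : Filter.Tendsto (fun t => (S.costTerm K t).trace) Filter.atTop (nhds 0) := by
    have h2 := ENNReal.tendsto_atTop_zero_of_tsum_ne_top h
    have h3 := (ENNReal.tendsto_toReal ENNReal.zero_ne_top).comp h2
    simpa [Function.comp_def, ENNReal.toReal_ofReal (S.trace_costTerm_nonneg K _)] using h3
  -- The summands of a finite cost tend to 0, and each dominates c ‖L ^ t‖² since Q is positive
  -- definite. A summand below c with t > 0 thus exhibits a contracting power.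
  obtain ⟨c, hc, hQ⟩ := exists_pos_mul_le_of_posDef S.Q_posDef
  have hle : ∀ t, c * ‖S.loop K ^ t‖ ^ 2 ≤ (S.costTerm K t).trace := fun t => by
    rw [costTerm, ← Matrix.transpose_pow]
    refine mul_norm_sq_le_trace (fun x => (hQ x).trans ?_) _
    rw [quad_weight, stageCost]
    linarith [S.quad_R_nonneg (control K x)]
  have hev := (h1.eventually (gt_mem_nhds hc)).and (Filter.eventually_gt_atTop 0)
  obtain ⟨t, ht, ht0⟩ := hev.exists
  refine ⟨t, ht0.ne', ?_⟩
  have h4 := (hle t).trans_lt ht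
  have h5 : ‖S.loop K ^ t‖ ^ 2 < 1 := by
    by_contra! hcon
    nlinarith
  exact (sq_lt_one_iff₀ (norm_nonneg _)).1 h5

lemma contDiff_loop {n : WithTop ℕ∞} : ContDiff ℝ n S.loop := by
  refine contDiff_matrix fun i j => ?_
  simp only [loop, Matrix.smul_apply, Matrix.sub_apply, Matrix.mul_apply, Policy.mat,
    Matrix.of_apply, smul_eq_mul]
  fun_prop

lemma contDiff_loop_transpose {n : WithTop ℕ∞} : ContDiff ℝ n fun K => (S.loop K)ᵀ := by
  refine contDiff_matrix fun i j => ?_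
  simp only [loop, Matrix.transpose_apply, Matrix.smul_apply, Matrix.sub_apply, Matrix.mul_apply,
    Policy.mat, Matrix.of_apply, smul_eq_mul]
  fun_prop

lemma contDiff_weight {n : WithTop ℕ∞} : ContDiff ℝ n S.weight := by
  refine contDiff_matrix fun i j => ?_
  simp only [weight, Matrix.add_apply, Matrix.transpose_apply, Matrix.mul_apply,
    Policy.mat, Matrix.of_apply]
  fun_prop

lemma isOpen_setOf_stab : IsOpen {K | S.Stab K} := by
  have : {K | S.Stab K} = ⋃ t : ℕ, ⋃ _ : t ≠ 0, {K | ‖S.loop K ^ t‖ < 1} := by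
    ext K; simp [Stab]
  rw [this]
  refine isOpen_iUnion fun t => isOpen_iUnion fun _ => isOpen_lt ?_ continuous_const
  exact (((contDiff_loop (n := 0)).continuous).pow t).norm

lemma Stab.contDiffAt_valueMat {K : Policy m k} (h : S.Stab K) {n : WithTop ℕ∞} :
    ContDiffAt ℝ n S.valueMat K :=
  contDiffAt_stein contDiff_loop_transpose.contDiffAt contDiff_loop.contDiffAt
    contDiff_weight.contDiffAt h.summable.1

lemma Stab.contDiffAt_covMat {K : Policy m k} (h : S.Stab K) {n : WithTop ℕ∞} :
    ContDiffAt ℝ n S.covMat K :=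
  contDiffAt_stein contDiff_loop.contDiffAt contDiff_loop_transpose.contDiffAt
    contDiffAt_const h.summable.2

lemma Stab.eventually {K : Policy m k} (h : S.Stab K) : ∀ᶠ K' in nhds K, S.Stab K' :=
  isOpen_setOf_stab.mem_nhds h

lemma Stab.contDiffAt_cost (hν : IsInitialLaw ν Cm) {K : Policy m k} (h : S.Stab K)
    {n : WithTop ℕ∞} : ContDiffAt ℝ n (fun K => (S.cost ν K).toReal) K := by
  refine ((traceCLM m).contDiff.contDiffAt.comp K h.contDiffAt_valueMat).congr_of_eventuallyEq ?_
  filter_upwards [h.eventually] with K' h'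
  rw [h'.cost_eq hν, ENNReal.toReal_ofReal h'.trace_nonneg]
  rfl

lemma Stab.contDiffAt_sampleCost {K : Policy m k} (h : S.Stab K) (s : State m)
    {n : WithTop ℕ∞} : ContDiffAt ℝ n (fun K => (S.sampleCost K s).toReal) K := by
  refine ((quadCLM s).contDiff.contDiffAt.comp K h.contDiffAt_valueMat).congr_of_eventuallyEq ?_
  filter_upwards [h.eventually] with K' h'
  rw [h'.sampleCost_eq, ENNReal.toReal_ofReal (h'.quad_nonneg s)]
  rfl

end System

end LQR

/-! ### Performance differences, the gradient, and the PL inequality. -/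

namespace LQR

namespace System

open scoped Matrix.Norms.Frobenius

variable {m k : ℕ} {S : System m k}

/-- The policy with a given matrix. -/
def policyOf (V : Matrix (Fin k) (Fin m) ℝ) : Policy m k :=
  WithLp.toLp 2 fun p => V p.1 p.2

lemma mat_policyOf (V : Matrix (Fin k) (Fin m) ℝ) : (policyOf V).mat = V := rfl

lemma mat_add (K H : Policy m k) : (K + H).mat = K.mat + H.mat := rfl

lemma mat_smul (c : ℝ) (K : Policy m k) : (c • K).mat = c • K.mat := rfl

lemma norm_mat (K : Policy m k) : ‖K.mat‖ = ‖K‖ := by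
  rw [← sq_eq_sq₀ (norm_nonneg _) (norm_nonneg _), frobenius_norm_sq, EuclideanSpace.norm_sq_eq,
    Fintype.sum_prod_type, Finset.sum_comm]
  simp [Policy.mat, dotProduct, sq]

lemma valueMat_eq {K : Policy m k} (h : S.Stab K) :
    S.valueMat K = S.weight K + (S.loop K)ᵀ * S.valueMat K * S.loop K :=
  stein_eq h.summable.1 _

lemma covMat_eq {K : Policy m k} (h : S.Stab K) :
    S.covMat K = 1 + S.loop K * S.covMat K * (S.loop K)ᵀ :=
  stein_eq h.summable.2 _

lemma R_transpose : S.Rᵀ = S.R := by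
  simpa using S.R_posDef.isHermitian.eq

lemma Q_transpose : S.Qᵀ = S.Q := by
  simpa using S.Q_posDef.isHermitian.eq

lemma weight_transpose (K : Policy m k) : (S.weight K)ᵀ = S.weight K := by
  simp [weight, Matrix.mul_assoc, R_transpose, Q_transpose]

/-- The transpose as a continuous linear map. -/
noncomputable def transposeCLM (m : ℕ) : Matrix (Fin m) (Fin m) ℝ →L[ℝ] Matrix (Fin m) (Fin m) ℝ :=
  LinearMap.toContinuousLinearMap (Matrix.transposeLinearEquiv (Fin m) (Fin m) ℝ ℝ).toLinearMap

lemma transposeCLM_apply (X : Matrix (Fin m) (Fin m) ℝ) : transposeCLM m X = Xᵀ := rfl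

lemma valueMat_transpose {K : Policy m k} (h : S.Stab K) : (S.valueMat K)ᵀ = S.valueMat K := by
  have h1 := hasSum_stein h.summable.1 (S.weight K)
  have h2 := h1.mapL (transposeCLM m)
  simp only [transposeCLM_apply, Matrix.transpose_mul, Matrix.transpose_pow,
    Matrix.transpose_transpose, weight_transpose, ← Matrix.mul_assoc] at h2
  exact h2.unique h1

lemma covMat_transpose {K : Policy m k} (h : S.Stab K) : (S.covMat K)ᵀ = S.covMat K := by
  have h1 := hasSum_stein h.summable.2 (1 : Matrix (Fin m) (Fin m) ℝ)
  have h2 := h1.mapL (transposeCLM m)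
  simp only [transposeCLM_apply, Matrix.transpose_mul, Matrix.transpose_pow,
    Matrix.transpose_transpose, Matrix.transpose_one, ← Matrix.mul_assoc] at h2
  exact h2.unique h1

/-- The covariance matrix is the sum of L ^ t (L ^ t)ᵀ, and cyclicity turns each term into tr((L ^
t)ᵀ N L ^ t). Inequalities between quadratic forms can thus be paired with the covariance. -/
lemma trace_mul_covMat_nonneg {K : Policy m k} (h : S.Stab K) {N : Matrix (Fin m) (Fin m) ℝ}
    (hN : ∀ x, 0 ≤ x ⬝ᵥ (N *ᵥ x)) : 0 ≤ (N * S.covMat K).trace := by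
  have h1 := ((hasSum_stein h.summable.2 (1 : Matrix (Fin m) (Fin m) ℝ)).mul_left N).mapL
    (traceCLM m)
  refine h1.nonneg fun t => ?_
  rw [traceCLM_apply, mul_one, ← Matrix.mul_assoc, Matrix.trace_mul_comm, ← Matrix.mul_assoc,
    ← Matrix.transpose_pow]
  exact trace_transpose_mul_mul_nonneg hN _

variable (S) in
/-- The matrix `E = R K - √γ Bᵀ P L`, with value matrix `P` and closed loop `L`. -/
noncomputable def gradMat (K : Policy m k) : Matrix (Fin k) (Fin m) ℝ :=
  S.R * K.mat - Real.sqrt S.γ • (S.Bᵀ * S.valueMat K * S.loop K)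

variable (S) in
/-- The curvature matrix `R + γ Bᵀ P B` of the one-step lookahead cost. -/
noncomputable def hessMat (K : Policy m k) : Matrix (Fin k) (Fin k) ℝ :=
  S.R + S.γ • (S.Bᵀ * S.valueMat K * S.B)

variable (S) in
/-- The difference of the lookahead costs of `K + H` and `K` as a quadratic form. -/
noncomputable def advMat (K H : Policy m k) : Matrix (Fin m) (Fin m) ℝ :=
  H.matᵀ * S.gradMat K + (S.gradMat K)ᵀ * H.mat + H.matᵀ * S.hessMat K * H.mat

lemma loop_add (K H : Policy m k) :
    S.loop (K + H) = S.loop K - Real.sqrt S.γ • (S.B * H.mat) := by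
  simp only [loop, mat_add, Matrix.mul_add, smul_sub, smul_add]
  abel

lemma advMat_eq {K : Policy m k} (h : S.Stab K) (H : Policy m k) :
    S.advMat K H = S.weight (K + H) - S.weight K +
      (S.loop (K + H))ᵀ * S.valueMat K * S.loop (K + H) -
        (S.loop K)ᵀ * S.valueMat K * S.loop K := by
  have hg : Real.sqrt S.γ * Real.sqrt S.γ = S.γ := Real.mul_self_sqrt S.γ_pos.le
  rw [loop_add]
  simp only [advMat, gradMat, hessMat, weight, mat_add, Matrix.transpose_sub, Matrix.transpose_add,
    Matrix.transpose_mul, Matrix.transpose_smul, Matrix.transpose_transpose, valueMat_transpose h,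
    R_transpose, Matrix.mul_add, Matrix.add_mul, Matrix.mul_sub, Matrix.sub_mul, Matrix.mul_smul,
    Matrix.smul_mul, Matrix.mul_assoc]
  -- Only the term quadratic in H needs √γ √γ = γ.
  match_scalars <;> first | ring1 | linear_combination -hg

lemma dotProduct_transpose_mul_mulVec_assoc {n p : Type*} [Fintype n] [Fintype p]
    (X : Matrix n p ℝ) (N : Matrix n n ℝ) (x : p → ℝ) :
    x ⬝ᵥ ((Xᵀ * N * X) *ᵥ x) = (X *ᵥ x) ⬝ᵥ (N *ᵥ (X *ᵥ x)) := by
  rw [← Matrix.mulVec_mulVec, dotProduct_transpose_mul_mulVec]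

/-- The performance difference identity. -/
lemma trace_valueMat_add {K H : Policy m k} (h : S.Stab K) (h' : S.Stab (K + H)) :
    (S.valueMat (K + H)).trace =
      (S.valueMat K).trace + (S.advMat K H * S.covMat (K + H)).trace := by
  -- Any P can be paired with the Stein equation of the new covariance. Applied to both value
  -- matrices, this expresses their traces through the same covariance, where their own Stein
  -- equations can be compared.
  have key : ∀ P : Matrix (Fin m) (Fin m) ℝ, P.trace = (P * S.covMat (K + H)).trace -
      ((S.loop (K + H))ᵀ * P * S.loop (K + H) * S.covMat (K + H)).trace := fun P => by
    have h1 : P = P * (S.covMat (K + H) - S.loop (K + H) * S.covMat (K + H) * (S.loop (K + H))ᵀ) := by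
      conv_lhs => rw [← Matrix.mul_one P]
      congr 1
      exact eq_sub_of_add_eq (covMat_eq h').symm
    conv_lhs => rw [h1]
    rw [Matrix.mul_sub, Matrix.trace_sub]
    congr 1
    rw [← Matrix.mul_assoc, Matrix.trace_mul_comm]
    simp only [Matrix.mul_assoc]
  rw [key (S.valueMat (K + H)), key (S.valueMat K), advMat_eq h]
  have h2 := congrArg (fun X => (X * S.covMat (K + H)).trace) (valueMat_eq h')
  have h3 := congrArg (fun X => (X * S.covMat (K + H)).trace) (valueMat_eq h)
  simp only [Matrix.sub_mul, Matrix.add_mul, Matrix.trace_sub, Matrix.trace_add] at h2 h3 ⊢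
  linarith

lemma quad_hessMat_ge {K : Policy m k} (h : S.Stab K) {c : ℝ}
    (hc : ∀ x, c * (x ⬝ᵥ x) ≤ x ⬝ᵥ (S.R *ᵥ x)) (x : Fin k → ℝ) :
    c * (x ⬝ᵥ x) ≤ x ⬝ᵥ (S.hessMat K *ᵥ x) := by
  rw [hessMat, Matrix.add_mulVec, dotProduct_add, Matrix.smul_mulVec, dotProduct_smul,
    dotProduct_transpose_mul_mulVec_assoc]
  have := mul_nonneg S.γ_pos.le (h.quad_nonneg (S.B *ᵥ x))
  rw [smul_eq_mul]
  linarith [hc x]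

/-- Gradient domination in terms of `gradMat`. -/
lemma trace_valueMat_sub_le {K K' : Policy m k} (h : S.Stab K) (h' : S.Stab K') {c : ℝ}
    (hc0 : 0 < c) (hc : ∀ x, c * (x ⬝ᵥ x) ≤ x ⬝ᵥ (S.R *ᵥ x)) :
    (S.valueMat K).trace - (S.valueMat K').trace ≤
      ‖S.gradMat K‖ ^ 2 / c * (S.covMat K').trace := by
  obtain ⟨H, rfl⟩ : ∃ H, K' = K + H := ⟨K' - K, by abel⟩
  rw [trace_valueMat_add h h']
  set E := S.gradMat K
  -- Completing the square: since `hessMat` is at least c, c times the quadratic form at x is at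
  -- least ‖c H x + E x‖² + (‖E‖² ‖x‖² - ‖E x‖²) ≥ 0.
  have h1 : 0 ≤ ((S.advMat K H + (‖E‖ ^ 2 / c) • 1) * S.covMat (K + H)).trace := by
    refine trace_mul_covMat_nonneg h' fun x => ?_
    have hE := mulVec_dotProduct_self_le E x
    have hS := quad_hessMat_ge h hc (H.mat *ᵥ x)
    have hsq : 0 ≤ (c • (H.mat *ᵥ x) + E *ᵥ x) ⬝ᵥ (c • (H.mat *ᵥ x) + E *ᵥ x) :=
      dotProduct_self_nonneg' _
    simp only [add_dotProduct, dotProduct_add, smul_dotProduct, dotProduct_smul, smul_eq_mul,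
      dotProduct_comm (E *ᵥ x) (H.mat *ᵥ x)] at hsq
    have hadv : x ⬝ᵥ ((S.advMat K H + (‖E‖ ^ 2 / c) • 1) *ᵥ x) =
        2 * ((H.mat *ᵥ x) ⬝ᵥ (E *ᵥ x)) + (H.mat *ᵥ x) ⬝ᵥ (S.hessMat K *ᵥ (H.mat *ᵥ x)) +
          ‖E‖ ^ 2 / c * (x ⬝ᵥ x) := by
      rw [advMat, Matrix.mul_assoc]
      simp only [Matrix.add_mulVec, dotProduct_add, Matrix.smul_mulVec, dotProduct_smul,
        Matrix.one_mulVec, ← Matrix.mulVec_mulVec, Matrix.dotProduct_mulVec _ (_)ᵀ,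
        Matrix.vecMul_transpose, smul_eq_mul]
      rw [dotProduct_comm (E *ᵥ x)]
      ring
    rw [hadv]
    have h2 : 0 ≤ c * (2 * ((H.mat *ᵥ x) ⬝ᵥ (E *ᵥ x)) +
        (H.mat *ᵥ x) ⬝ᵥ (S.hessMat K *ᵥ (H.mat *ᵥ x)) + ‖E‖ ^ 2 / c * (x ⬝ᵥ x)) := by
      have h3 : c * (‖E‖ ^ 2 / c * (x ⬝ᵥ x)) = ‖E‖ ^ 2 * (x ⬝ᵥ x) := by field_simp
      rw [mul_add, h3]
      nlinarith [mul_le_mul_of_nonneg_left hS hc0.le]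
    exact nonneg_of_mul_nonneg_right h2 hc0
  rw [Matrix.add_mul, Matrix.trace_add, Matrix.smul_mul, Matrix.one_mul, Matrix.trace_smul,
    smul_eq_mul] at h1
  linarith

/-- The covariance is 1 + Z with Z symmetric and positive semidefinite, so ‖E (1 + Z)‖² = ‖E‖² + 2
tr(Eᵀ E Z) + ‖E Z‖² has only nonnegative terms. -/
lemma norm_gradMat_le {K : Policy m k} (h : S.Stab K) :
    ‖S.gradMat K‖ ^ 2 ≤ ‖S.gradMat K * S.covMat K‖ ^ 2 := by
  set E := S.gradMat K
  set Z := S.loop K * S.covMat K * (S.loop K)ᵀ with hZ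
  have hZt : Zᵀ = Z := by simp [hZ, covMat_transpose h, Matrix.mul_assoc]
  rw [covMat_eq h, ← hZ, frobenius_norm_sq_eq_trace, frobenius_norm_sq_eq_trace]
  have h1 : 0 ≤ (Eᵀ * E * Z).trace := by
    have : (Eᵀ * E * Z).trace = (((S.loop K)ᵀ * (Eᵀ * E) * S.loop K) * S.covMat K).trace := by
      rw [hZ, ← Matrix.mul_assoc, Matrix.trace_mul_comm]
      simp only [Matrix.mul_assoc]
    rw [this]
    refine trace_mul_covMat_nonneg h fun x => ?_
    rw [dotProduct_transpose_mul_mulVec_assoc, ← Matrix.mulVec_mulVec, Matrix.dotProduct_mulVec,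
      Matrix.vecMul_transpose]
    exact dotProduct_self_nonneg' _
  have h2 : 0 ≤ ((E * Z)ᵀ * (E * Z)).trace := by
    rw [← frobenius_norm_sq_eq_trace]; positivity
  have h3 : ((E * (1 + Z))ᵀ * (E * (1 + Z))).trace =
      (Eᵀ * E).trace + 2 * (Eᵀ * E * Z).trace + ((E * Z)ᵀ * (E * Z)).trace := by
    have h4 : (Z * (Eᵀ * E)).trace = (Eᵀ * E * Z).trace := Matrix.trace_mul_comm _ _
    simp only [Matrix.mul_add, Matrix.mul_one, Matrix.transpose_add, Matrix.add_mul,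
      Matrix.trace_add, Matrix.transpose_mul, hZt, Matrix.mul_assoc] at h4 ⊢
    rw [h4]; ring
  linarith

/-- The gradient is 2 E Σ, with Σ the covariance matrix. The performance difference identity makes
the difference quotient along v explicit, so continuity of Σ gives the limit. -/
lemma inner_gradient_cost {ν : Measure (State m)} {Cm : ℝ} (hν : IsInitialLaw ν Cm)
    {K : Policy m k} (h : S.Stab K) (v : Policy m k) :
    inner ℝ (gradient (fun K => (S.cost ν K).toReal) K) v =
      2 * ((v.matᵀ * S.gradMat K) * S.covMat K).trace := by
  have hd : DifferentiableAt ℝ (fun K => (S.cost ν K).toReal) K :=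
    (h.contDiffAt_cost hν (n := 1)).differentiableAt one_ne_zero
  have h1 := (hd.hasGradientAt.hasFDerivAt.hasLineDerivAt v).tendsto_slope_zero
  rw [InnerProductSpace.toDual_apply_apply] at h1
  have hline : Filter.Tendsto (fun t : ℝ => K + t • v) (nhdsWithin 0 {0}ᶜ) (nhds K) := by
    have : Continuous fun t : ℝ => K + t • v := by fun_prop
    have h2 := this.tendsto 0
    rw [zero_smul, add_zero] at h2
    exact h2.mono_left nhdsWithin_le_nhds
  have hcov : Filter.Tendsto (fun t : ℝ => S.covMat (K + t • v)) (nhdsWithin 0 {0}ᶜ)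
      (nhds (S.covMat K)) :=
    (h.contDiffAt_covMat (n := 0)).continuousAt.tendsto.comp hline
  have ht : Filter.Tendsto (fun t : ℝ => t) (nhdsWithin 0 {0}ᶜ) (nhds 0) :=
    nhdsWithin_le_nhds
  set N := v.matᵀ * S.gradMat K + (S.gradMat K)ᵀ * v.mat with hN
  have h3 : Filter.Tendsto (fun t : ℝ => traceCLM m
      ((N + t • (v.matᵀ * S.hessMat K * v.mat)) * S.covMat (K + t • v)))
      (nhdsWithin 0 {0}ᶜ) (nhds (traceCLM m ((N + (0 : ℝ) • (v.matᵀ * S.hessMat K * v.mat)) *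
        S.covMat K))) :=
    ((traceCLM m).continuous.tendsto _).comp
      ((tendsto_const_nhds.add (ht.smul tendsto_const_nhds)).mul hcov)
  have h4 : Filter.Tendsto (fun t : ℝ =>
      t⁻¹ • ((S.cost ν (K + t • v)).toReal - (S.cost ν K).toReal))
      (nhdsWithin 0 {0}ᶜ) (nhds (traceCLM m ((N + (0 : ℝ) • (v.matᵀ * S.hessMat K * v.mat)) *
        S.covMat K))) := by
    refine h3.congr' ?_
    filter_upwards [hline.eventually h.eventually, self_mem_nhdsWithin] with t hst ht0
    have ht0 : t ≠ 0 := ht0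
    rw [hst.cost_eq hν, h.cost_eq hν, ENNReal.toReal_ofReal hst.trace_nonneg,
      ENNReal.toReal_ofReal h.trace_nonneg, trace_valueMat_add h hst, add_sub_cancel_left,
      traceCLM_apply, ← Matrix.trace_smul]
    have hadv : S.advMat K (t • v) = t • (N + t • (v.matᵀ * S.hessMat K * v.mat)) := by
      simp only [advMat, mat_smul, Matrix.transpose_smul, Matrix.smul_mul, Matrix.mul_smul, hN]
      module
    rw [hadv, Matrix.smul_mul t (N + _), inv_smul_smul₀ ht0]
  rw [tendsto_nhds_unique h1 h4, zero_smul, add_zero, traceCLM_apply, hN, Matrix.add_mul,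
    Matrix.trace_add, two_mul]
  congr 1
  rw [← Matrix.trace_transpose]
  simp only [Matrix.transpose_mul, Matrix.transpose_transpose, covMat_transpose h]
  exact Matrix.trace_mul_comm _ _

/-- The Polyak-Łojasiewicz inequality for the population cost. -/
lemma exists_isPL {ν : Measure (State m)} {Cm : ℝ} (hν : IsInitialLaw ν Cm)
    {Kstar : Policy m k} (h : S.Stab Kstar) : ∃ μ, IsPL (S.cost ν) Kstar μ := by
  obtain ⟨c, hc0, hc⟩ := exists_pos_mul_le_of_posDef S.R_posDef
  have htr : 0 ≤ (S.covMat Kstar).trace := by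
    simpa using trace_mul_covMat_nonneg h (N := 1) fun x => by
      simpa using dotProduct_self_nonneg' x
  refine ⟨4 * c / ((S.covMat Kstar).trace + 1), by positivity, fun K hK => ?_⟩
  rw [cost_ne_top_iff hν] at hK
  refine ⟨hK.contDiffAt_cost hν, ?_⟩
  rw [hK.cost_eq hν, h.cost_eq hν, ENNReal.toReal_ofReal hK.trace_nonneg,
    ENNReal.toReal_ofReal h.trace_nonneg]
  -- Testing the gradient against its own direction E Σ bounds its norm from below by 2 ‖E Σ‖, hence
  -- by 2 ‖E‖.
  set v := policyOf (S.gradMat K * S.covMat K) with hv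
  have hv2 : ‖v‖ ^ 2 = ‖S.gradMat K * S.covMat K‖ ^ 2 := by rw [← norm_mat, hv, mat_policyOf]
  have h1 := inner_gradient_cost hν hK v
  have h2 : ((v.matᵀ * S.gradMat K) * S.covMat K).trace = ‖v‖ ^ 2 := by
    rw [hv2, frobenius_norm_sq_eq_trace, hv, mat_policyOf, Matrix.mul_assoc]
  rw [h2] at h1
  have h3 : 2 * ‖v‖ ≤ ‖gradient (fun K => (S.cost ν K).toReal) K‖ := by
    have h4 := real_inner_le_norm (gradient (fun K => (S.cost ν K).toReal) K) v
    rcases (norm_nonneg v).eq_or_lt with h0 | h0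
    · rw [← h0]; simp
    · refine le_of_mul_le_mul_right ?_ h0
      nlinarith
  have h5 : 4 * ‖S.gradMat K‖ ^ 2 ≤ ‖gradient (fun K => (S.cost ν K).toReal) K‖ ^ 2 := by
    have h6 := norm_gradMat_le hK
    nlinarith [norm_nonneg v]
  refine le_trans ?_ h5
  have h7 := trace_valueMat_sub_le hK h hc0 hc
  rw [div_mul_eq_mul_div, div_le_iff₀ (by positivity)]
  have h8 : c * ((S.valueMat K).trace - (S.valueMat Kstar).trace) ≤
      ‖S.gradMat K‖ ^ 2 * (S.covMat Kstar).trace := by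
    have h9 := mul_le_mul_of_nonneg_left h7 hc0.le
    have h10 : c * (‖S.gradMat K‖ ^ 2 / c * (S.covMat Kstar).trace) =
      ‖S.gradMat K‖ ^ 2 * (S.covMat Kstar).trace := by field_simp
    linarith
  nlinarith [sq_nonneg ‖S.gradMat K‖]

end System

end LQR

/-! ### Compact sublevel sets: existence of a minimizer and of curvature parameters. -/

namespace LQR

/-- A function that is continuously differentiable near a compact set is Lipschitz, with a uniform
constant, on the balls contained in that set. -/
lemma exists_lipschitz_on_balls {E F : Type*} [NormedAddCommGroup E] [NormedSpace ℝ E]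
    [NormedAddCommGroup F] [NormedSpace ℝ F] {g : E → F} {N : Set E} (hN : IsCompact N)
    (hg : ∀ x ∈ N, ContDiffAt ℝ 1 g x) :
    ∃ C, 0 ≤ C ∧ ∀ x δ, Metric.closedBall x δ ⊆ N → ∀ y, ‖y - x‖ ≤ δ →
      ‖g y - g x‖ ≤ C * ‖y - x‖ := by
  have hcont : ContinuousOn (fun x => fderiv ℝ g x) N := fun x hx =>
    ((hg x hx).fderiv_right (m := 0) le_rfl).continuousAt.continuousWithinAt
  obtain ⟨C, hC⟩ := hN.exists_bound_of_continuousOn hcont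
  refine ⟨max C 0, le_max_right _ _, fun x δ hx y hy => ?_⟩
  have hδ : 0 ≤ δ := (norm_nonneg _).trans hy
  exact (convex_closedBall x δ).norm_image_sub_le_of_norm_fderiv_le
    (fun z hz => (hg z (hx hz)).differentiableAt one_ne_zero)
    (fun z hz => (hC z (hx hz)).trans (le_max_left _ _)) (Metric.mem_closedBall_self hδ)
    (mem_closedBall_iff_norm.2 hy)

lemma contDiffAt_gradient {E : Type*} [NormedAddCommGroup E] [InnerProductSpace ℝ E]
    [CompleteSpace E] {g : E → ℝ} {x : E} (hg : ContDiffAt ℝ 2 g x) :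
    ContDiffAt ℝ 1 (gradient g) x :=
  (InnerProductSpace.toDual ℝ E).symm.toContinuousLinearEquiv.contDiff.contDiffAt.comp x
    (hg.fderiv_right (m := 1) (by norm_num))

namespace System

open scoped Matrix.Norms.Frobenius

variable {m k : ℕ} {S : System m k} {ν : Measure (State m)} {Cm : ℝ}

/-- The cost at time zero alone contains tr(Kᵀ R K). -/
lemma exists_coercive (S : System m k) : ∃ c, 0 < c ∧ ∀ {ν : Measure (State m)} {Cm : ℝ},
    IsInitialLaw ν Cm → ∀ K, ENNReal.ofReal (c * ‖K‖ ^ 2) ≤ S.cost ν K := by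
  obtain ⟨c, hc0, hc⟩ := exists_pos_mul_le_of_posDef S.R_posDef
  refine ⟨c, hc0, fun hν K => ?_⟩
  rw [cost_eq_tsum hν]
  refine le_trans (ENNReal.ofReal_le_ofReal ?_) (ENNReal.le_tsum 0)
  have h1 := mul_norm_sq_le_trace hc K.mat
  have h2 : 0 ≤ S.Q.trace := S.Q_posDef.posSemidef.trace_nonneg
  rw [norm_mat] at h1
  simp only [costTerm, pow_zero, one_mul, mul_one, weight, Matrix.trace_add]
  linarith

lemma continuous_trace_costTerm (t : ℕ) : Continuous fun K => (S.costTerm K t).trace := by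
  have h1 : Continuous S.loop := (contDiff_loop (n := 0)).continuous
  have h2 : Continuous fun K => (S.loop K)ᵀ := (contDiff_loop_transpose (n := 0)).continuous
  have h3 : Continuous S.weight := (contDiff_weight (n := 0)).continuous
  exact (traceCLM m).continuous.comp (((h2.pow t).mul h3).mul (h1.pow t))

/-- A series of nonnegative continuous functions is lower semicontinuous. Together with coercivity
this makes sublevel sets compact although the cost takes the value ∞. -/
lemma lowerSemicontinuous_cost (hν : IsInitialLaw ν Cm) : LowerSemicontinuous (S.cost ν) := by
  have : S.cost ν = fun K => ∑' t, ENNReal.ofReal (S.costTerm K t).trace :=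
    funext fun K => cost_eq_tsum hν K
  rw [this]
  exact lowerSemicontinuous_tsum fun t =>
    (ENNReal.continuous_ofReal.comp (continuous_trace_costTerm t)).lowerSemicontinuous

lemma isCompact_cost_le (hν : IsInitialLaw ν Cm) {b : ℝ≥0∞} (hb : b ≠ ⊤) :
    IsCompact {K | S.cost ν K ≤ b} := by
  refine Metric.isCompact_of_isClosed_isBounded
    ((lowerSemicontinuous_cost hν).isClosed_preimage b) ?_
  obtain ⟨c, hc0, hc⟩ := S.exists_coercive
  refine (Metric.isBounded_closedBall (x := (0 : Policy m k)) (r := b.toReal / c + 1)).subset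
    fun K hK => ?_
  rw [mem_closedBall_zero_iff]
  have h1 := (ENNReal.ofReal_le_iff_le_toReal hb).1 ((hc hν K).trans hK)
  rw [mul_comm, ← le_div_iff₀ hc0] at h1
  nlinarith [sq_nonneg (‖K‖ - 1 / 2)]

lemma exists_isOptimal (hν : IsInitialLaw ν Cm) {K₀ : Policy m k} (hK₀ : S.cost ν K₀ ≠ ⊤) :
    ∃ Kstar, S.IsOptimal ν Kstar := by
  obtain ⟨Ks, -, hmin⟩ := LowerSemicontinuousOn.exists_isMinOn (s := {K | S.cost ν K ≤ S.cost ν K₀})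
    ⟨K₀, le_refl (S.cost ν K₀)⟩ (isCompact_cost_le hν hK₀) ((lowerSemicontinuous_cost hν).lowerSemicontinuousOn _)
  refine ⟨Ks, fun K => ?_⟩
  by_cases hK : S.cost ν K ≤ S.cost ν K₀
  · exact hmin hK
  · have h0 : S.cost ν Ks ≤ S.cost ν K₀ := hmin (show S.cost ν K₀ ≤ S.cost ν K₀ from le_rfl)
    exact h0.trans (not_le.1 hK).le

lemma IsOptimal.cost_ne_top {Kstar K : Policy m k} (h : S.IsOptimal ν Kstar)
    (hK : S.cost ν K ≠ ⊤) : S.cost ν Kstar ≠ ⊤ :=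
  ne_top_of_le_ne_top hK (h K)

lemma IsOptimal.gap_nonneg {Kstar K : Policy m k} (h : S.IsOptimal ν Kstar)
    (hK : S.cost ν K ≠ ⊤) : 0 ≤ S.gap ν Kstar K :=
  sub_nonneg.2 (ENNReal.toReal_mono hK (h K))

lemma IsOptimal.mem_boundedSet {Kstar K₀ : Policy m k} (h : S.IsOptimal ν Kstar)
    (hK : S.cost ν K₀ ≠ ⊤) : K₀ ∈ S.boundedSet ν Kstar K₀ :=
  ⟨hK, by linarith [h.gap_nonneg hK]⟩

lemma IsOptimal.isCompact_boundedSet (hν : IsInitialLaw ν Cm) {Kstar K₀ : Policy m k}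
    (h : S.IsOptimal ν Kstar) (hK : S.cost ν K₀ ≠ ⊤) : IsCompact (S.boundedSet ν Kstar K₀) := by
  have hB : 0 ≤ 10 * S.gap ν Kstar K₀ + (S.cost ν Kstar).toReal := by
    have := h.gap_nonneg hK
    positivity
  have : S.boundedSet ν Kstar K₀ =
      {K | S.cost ν K ≤ ENNReal.ofReal (10 * S.gap ν Kstar K₀ + (S.cost ν Kstar).toReal)} := by
    ext K
    constructor
    · rintro ⟨h1, h2⟩
      refine (ENNReal.le_ofReal_iff_toReal_le h1 hB).2 ?_
      unfold gap at h2 ⊢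
      linarith
    · intro h1
      have h1' : S.cost ν K ≠ ⊤ := ne_top_of_le_ne_top ENNReal.ofReal_ne_top h1
      refine ⟨h1', ?_⟩
      have h2 := (ENNReal.le_ofReal_iff_toReal_le h1' hB).1 h1
      unfold gap at h2 ⊢
      linarith
  rw [this]
  exact isCompact_cost_le hν ENNReal.ofReal_ne_top

/-- The almost sure bound on the initial state makes a Lipschitz constant of the value matrix serve
almost every sample cost. -/
lemma abs_sampleCost_sub_le {K K' : Policy m k} (h : S.Stab K) (h' : S.Stab K') {s : State m}
    (hs : s ⬝ᵥ s ≤ Cm) : |(S.sampleCost K' s).toReal - (S.sampleCost K s).toReal| ≤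
      ‖S.valueMat K' - S.valueMat K‖ * Cm := by
  rw [h.sampleCost_eq, h'.sampleCost_eq, ENNReal.toReal_ofReal (h.quad_nonneg s),
    ENNReal.toReal_ofReal (h'.quad_nonneg s), ← dotProduct_sub, ← Matrix.sub_mulVec]
  exact (abs_dotProduct_mulVec_le _ _).trans (mul_le_mul_of_nonneg_left hs (norm_nonneg _))

/-- Finite curvature parameters exist. -/
lemma IsOptimal.exists_isCurvature (hν : IsInitialLaw ν Cm) {Kstar K₀ : Policy m k}
    (h : S.IsOptimal ν Kstar) (hK₀ : S.cost ν K₀ ≠ ⊤) :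
    ∃ (φK βK lamK ζK : Policy m k → ℝ) (φ lam ρ μ : ℝ),
      IsCurvature S ν Kstar K₀ φK βK lamK ζK φ lam ρ μ := by
  obtain ⟨μ, hμ⟩ := exists_isPL hν ((cost_ne_top_iff hν _).1 (h.cost_ne_top hK₀))
  set G := S.boundedSet ν Kstar K₀ with hG
  have hGc : IsCompact G := h.isCompact_boundedSet hν hK₀
  -- Stability is an open condition, so some compact thickening of the bounded set still consists of
  -- stabilizing policies; δ serves as a common radius for all its points.
  obtain ⟨δ, hδ, hsub⟩ := hGc.exists_cthickening_subset_open isOpen_setOf_stab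
    fun K hK => (cost_ne_top_iff hν _).1 hK.1
  have hN : IsCompact (Metric.cthickening δ G) := hGc.cthickening
  have hball : ∀ K ∈ G, Metric.closedBall K δ ⊆ Metric.cthickening δ G := fun K hK =>
    Metric.closedBall_subset_cthickening hK δ
  have hst : ∀ K ∈ G, ∀ K', ‖K' - K‖ ≤ δ → S.Stab K' := fun K hK K' hK' =>
    hsub (hball K hK (mem_closedBall_iff_norm.2 hK'))
  obtain ⟨c₁, hc₁, h₁⟩ := exists_lipschitz_on_balls hN
    (g := fun K => (S.cost ν K).toReal) fun K hK => (hsub hK).contDiffAt_cost hν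
  obtain ⟨c₂, hc₂, h₂⟩ := exists_lipschitz_on_balls hN
    (g := gradient fun K => (S.cost ν K).toReal) fun K hK =>
      contDiffAt_gradient ((hsub hK).contDiffAt_cost hν)
  obtain ⟨c₃, hc₃, h₃⟩ := exists_lipschitz_on_balls hN (g := S.valueMat) fun K hK =>
    (hsub hK).contDiffAt_valueMat
  have hCm := hν.Cm_nonneg
  have hlam : 0 < c₁ + c₃ * Cm + 1 := by positivity
  have hne : G.Nonempty := ⟨K₀, h.mem_boundedSet hK₀⟩
  refine ⟨fun _ => c₂ + 1, fun _ => δ, fun _ => c₁ + c₃ * Cm + 1, fun _ => δ, c₂ + 1,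
    c₁ + c₃ * Cm + 1, δ, μ, ?_⟩
  refine ⟨fun K _ => ⟨by positivity, hδ, hlam, hδ⟩, fun K hK K' hK' => ?_, fun K hK K' hK' => ?_,
    fun K hK => ?_, ?_, ?_, ?_, hδ, hμ⟩
  · have hs := hst K hK K' hK'
    refine ⟨(cost_ne_top_iff hν _).2 hs, hs.contDiffAt_cost hν,
      (h₂ K δ (hball K hK) K' hK').trans ?_⟩
    gcongr
    linarith
  · refine ⟨(cost_ne_top_iff hν _).2 (hst K hK K' hK'), (h₁ K δ (hball K hK) K' hK').trans ?_⟩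
    gcongr
    nlinarith
  · filter_upwards [hν.bounded] with s hs K' hK'
    have hs' := hst K hK K' hK'
    refine ⟨(hs'.sampleCost_eq s).trans_ne ENNReal.ofReal_ne_top,
      (abs_sampleCost_sub_le ((cost_ne_top_iff hν _).1 hK.1) hs' hs).trans ?_⟩
    calc ‖S.valueMat K' - S.valueMat K‖ * Cm ≤ c₃ * ‖K' - K‖ * Cm :=
          mul_le_mul_of_nonneg_right (h₃ K δ (hball K hK) K' hK') hCm
      _ = c₃ * Cm * ‖K' - K‖ := by ring
      _ ≤ _ := by gcongr; linarith
  · rw [hne.image_const]; exact isLUB_singleton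
  · rw [hne.image_const]; exact isLUB_singleton
  · simp only [min_self]
    rw [hne.image_const]; exact isGLB_singleton

end System

end LQR

/-! ### Sample costs and the first two moments of the two-point estimate. -/

namespace LQR

namespace System

open scoped Matrix.Norms.Frobenius

variable {m k : ℕ} {S : System m k} {ν : Measure (State m)} {Cm : ℝ}

lemma measurable_sampleCost (S : System m k) :
    Measurable fun p : Policy m k × State m => S.sampleCost p.1 p.2 := by
  simp only [sampleCost_eq_tsum]
  refine Measurable.tsum fun t => Measurable.ennreal_ofReal ?_
  have h1 : Continuous S.loop := (contDiff_loop (n := 0)).continuous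
  have h2 : Continuous fun K => (S.loop K)ᵀ := (contDiff_loop_transpose (n := 0)).continuous
  have h3 : Continuous S.weight := (contDiff_weight (n := 0)).continuous
  have h4 : Continuous fun K => S.costTerm K t := ((h2.pow t).mul h3).mul (h1.pow t)
  refine Continuous.measurable ?_
  exact continuous_snd.dotProduct ((h4.comp continuous_fst).matrix_mulVec continuous_snd)

lemma measurable_gradEst (S : System m k) (r : ℝ) :
    Measurable fun p : Policy m k × (Policy m k × State m) => gradEst S r p.1 p.2.1 p.2.2 := by
  have h := S.measurable_sampleCost.ennreal_toReal
  have h1 : Measurable fun p : Policy m k × (Policy m k × State m) =>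
      (S.sampleCost (p.1 + r • p.2.1) p.2.2).toReal :=
    h.comp (g := fun p : Policy m k × State m => (S.sampleCost p.1 p.2).toReal)
      (f := fun p : Policy m k × (Policy m k × State m) => (p.1 + r • p.2.1, p.2.2)) (by fun_prop)
  have h2 : Measurable fun p : Policy m k × (Policy m k × State m) =>
      (S.sampleCost (p.1 - r • p.2.1) p.2.2).toReal :=
    h.comp (g := fun p : Policy m k × State m => (S.sampleCost p.1 p.2).toReal)
      (f := fun p : Policy m k × (Policy m k × State m) => (p.1 - r • p.2.1, p.2.2)) (by fun_prop)
  unfold gradEst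
  exact ((h1.sub h2).mul_const _).smul (by fun_prop)

/-- If every sample cost is almost surely locally Lipschitz at each point of a set of policies of
finite cost, then almost surely this holds, in infinitesimal form, at all points of the set. -/
lemma ae_norm_fderiv_sampleCost_le (hν : IsInitialLaw ν Cm) {G : Set (Policy m k)} {lam ρ : ℝ}
    (hlam : 0 ≤ lam) (hρ : 0 < ρ) (hG : ∀ K ∈ G, S.cost ν K ≠ ⊤)
    (h : ∀ K ∈ G, ∀ᵐ s ∂ν, IsLocallyLipschitzAt (fun K' => S.sampleCost K' s) lam ρ K) :
    ∀ᵐ s ∂ν, ∀ K ∈ G, ‖fderiv ℝ (fun K' => (S.sampleCost K' s).toReal) K‖ ≤ lam := by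
  -- The exceptional null set of initial states may depend on the policy. A countable dense set of
  -- policies needs only one null set, and continuity of the derivative of each sample cost extends
  -- the bound to the whole set.
  obtain ⟨c, hcG, hc, hd⟩ :=
    (TopologicalSpace.IsSeparable.of_separableSpace G).exists_countable_dense_subset
  have h1 : ∀ᵐ s ∂ν, ∀ K ∈ c, IsLocallyLipschitzAt (fun K' => S.sampleCost K' s) lam ρ K :=
    (ae_ball_iff hc).2 fun K hK => h K (hcG hK)
  filter_upwards [h1] with s hs K hK
  have hst := (cost_ne_top_iff hν _).1 (hG K hK)
  have hcont : ContinuousAt (fun K => ‖fderiv ℝ (fun K' => (S.sampleCost K' s).toReal) K‖) K :=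
    ((hst.contDiffAt_sampleCost s (n := 1)).fderiv_right (m := 0) le_rfl).continuousAt.norm
  refine le_of_tendsto_of_frequently hcont ?_
  refine (mem_closure_iff_frequently.1 (hd hK)).mono fun K' hK' => ?_
  exact (hs K' hK').norm_fderiv_le hρ hlam

variable {Kstar x : Policy m k} {d φ lam ρ μ r : ℝ} {s : State m}

/-- The infinitesimal bound holds at all policies of G for one and the same initial state; the mean
value inequality on the ball turns it back into a two-point bound. -/
lemma abs_sampleCost_sub_le_of_norm_fderiv_le {G : Set (Policy m k)}
    (hG : ∀ K ∈ G, S.Stab K)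
    (hs : ∀ K ∈ G, ‖fderiv ℝ (fun K' => (S.sampleCost K' s).toReal) K‖ ≤ lam)
    (hr : 0 < r) (hx : ∀ v, ‖v‖ ≤ r → x + v ∈ G) {u : Policy m k} (hu : ‖u‖ = 1) :
    |(S.sampleCost (x + r • u) s).toReal - (S.sampleCost (x - r • u) s).toReal| ≤
      2 * r * lam := by
  have hru : ‖r • u‖ = r := by rw [norm_smul, hu, Real.norm_eq_abs, abs_of_pos hr, mul_one]
  have hmem : ∀ z ∈ Metric.closedBall x r, z ∈ G := fun z hz => by
    have := hx (z - x) (mem_closedBall_iff_norm.1 hz)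
    rwa [add_sub_cancel] at this
  have h1 := (convex_closedBall x r).norm_image_sub_le_of_norm_fderiv_le (𝕜 := ℝ)
    (f := fun K' => (S.sampleCost K' s).toReal)
    (fun z hz => ((hG z (hmem z hz)).contDiffAt_sampleCost s (n := 1)).differentiableAt
      one_ne_zero)
    (fun z hz => hs z (hmem z hz)) (x := x - r • u) (y := x + r • u)
    (by simp [hru]) (by simp [hru])
  refine h1.trans (le_of_eq ?_)
  rw [show x + r • u - (x - r • u) = (2 : ℝ) • (r • u) by module, norm_smul, hru]
  norm_num
  ring

/-- This pointwise bound keeps every step within the radius of smoothness and gives integrability;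
its square is too large by a factor D for the variance term. -/
lemma norm_gradEst_le {G : Set (Policy m k)}
    (hG : ∀ K ∈ G, S.Stab K)
    (hs : ∀ K ∈ G, ‖fderiv ℝ (fun K' => (S.sampleCost K' s).toReal) K‖ ≤ lam)
    (hr : 0 < r) (hx : ∀ v, ‖v‖ ≤ r → x + v ∈ G) {u : Policy m k} (hu : ‖u‖ = 1) :
    ‖gradEst S r x u s‖ ≤ (m : ℝ) * k * lam := by
  have h1 := abs_sampleCost_sub_le_of_norm_fderiv_le hG hs hr hx hu
  rw [gradEst, norm_smul, hu, mul_one, Real.norm_eq_abs, abs_mul]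
  have hD : (0 : ℝ) ≤ (m : ℝ) * k / (2 * r) := by positivity
  rw [abs_of_nonneg hD]
  calc _ ≤ 2 * r * lam * ((m : ℝ) * k / (2 * r)) := mul_le_mul_of_nonneg_right h1 hD
    _ = _ := by field_simp

/-- Almost every direction is a unit vector, and almost every sample cost is good. -/
lemma ae_prod_uniformSphere (hm : 0 < m) (hk : 0 < k) [IsProbabilityMeasure ν] {p : State m → Prop}
    (hp : ∀ᵐ s ∂ν, p s) :
    ∀ᵐ z ∂(uniformSphere m k).prod ν, ‖z.1‖ = 1 ∧ p z.2 := by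
  have := isProbabilityMeasure_uniformSphere hm hk
  exact (Measure.quasiMeasurePreserving_fst.ae (ae_norm_uniformSphere)).and
    (Measure.quasiMeasurePreserving_snd.ae hp)

section Moments

variable {G : Set (Policy m k)}

lemma integrable_comp_gradEst (hm : 0 < m) (hk : 0 < k) [IsProbabilityMeasure ν]
    (hG : ∀ K ∈ G, S.Stab K)
    (hs : ∀ᵐ s ∂ν, ∀ K ∈ G, ‖fderiv ℝ (fun K' => (S.sampleCost K' s).toReal) K‖ ≤ lam)
    (hr : 0 < r) (hx : ∀ v, ‖v‖ ≤ r → x + v ∈ G) {b : Policy m k → ℝ} (hb : Continuous b) :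
    Integrable (fun z : Policy m k × State m => b (gradEst S r x z.1 z.2))
      ((uniformSphere m k).prod ν) := by
  have := isProbabilityMeasure_uniformSphere hm hk
  obtain ⟨C, hC⟩ := (isCompact_closedBall (0 : Policy m k) ((m : ℝ) * k * lam)).exists_bound_of_continuousOn
    hb.continuousOn
  refine Integrable.of_bound (hb.measurable.comp
    ((S.measurable_gradEst r).comp measurable_prodMk_left)).aestronglyMeasurable C ?_
  filter_upwards [ae_prod_uniformSphere hm hk hs] with z hz
  exact hC _ (mem_closedBall_zero_iff.2 (norm_gradEst_le hG hz.2 hr hx hz.1))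

/-- For each fixed initial state the spherical Poincaré inequality bounds the mean squared
difference by 4 r² λ² / D, and (D / (2r))² times this is D λ². -/
lemma integral_norm_gradEst_sq_le (hm : 0 < m) (hk : 0 < k) [IsProbabilityMeasure ν]
    (hG : ∀ K ∈ G, S.Stab K)
    (hs : ∀ᵐ s ∂ν, ∀ K ∈ G, ‖fderiv ℝ (fun K' => (S.sampleCost K' s).toReal) K‖ ≤ lam)
    (hr : 0 < r) (hx : ∀ v, ‖v‖ ≤ r → x + v ∈ G) :
    ∫ z, ‖gradEst S r x z.1 z.2‖ ^ 2 ∂(uniformSphere m k).prod ν ≤ (m : ℝ) * k * lam ^ 2 := by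
  have := isProbabilityMeasure_uniformSphere hm hk
  have hD : (0 : ℝ) < (m : ℝ) * k := by positivity
  have hint := integrable_comp_gradEst hm hk hG hs hr hx (b := fun y => ‖y‖ ^ 2) (by fun_prop)
  rw [integral_prod_symm _ hint]
  have hbound : ∀ᵐ s ∂ν, ∫ u, ‖gradEst S r x u s‖ ^ 2 ∂uniformSphere m k ≤
      (m : ℝ) * k * lam ^ 2 := by
    filter_upwards [hs] with s hs
    have h1 := integral_sq_sub_neg_le hm hk (h := fun y => (S.sampleCost (x + y) s).toReal)
      (S.measurable_sampleCost.ennreal_toReal.comp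
        (f := fun y : Policy m k => (x + y, s)) (by fun_prop)) hr
      (fun y hy => ((hG _ (hx y hy)).contDiffAt_sampleCost s).comp y (by fun_prop))
      (L := lam) fun y hy => by
        rw [fderiv_comp_add_left (f := fun K' => (S.sampleCost K' s).toReal)]
        exact hs _ (hx y hy)
    have h2 : ∀ᵐ u ∂uniformSphere m k, ‖gradEst S r x u s‖ ^ 2 =
        ((m : ℝ) * k / (2 * r)) ^ 2 * ((S.sampleCost (x + r • u) s).toReal -
          (S.sampleCost (x + -(r • u)) s).toReal) ^ 2 := by
      filter_upwards [ae_norm_uniformSphere] with u hu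
      rw [gradEst, norm_smul, hu, mul_one, Real.norm_eq_abs, sq_abs, mul_pow, mul_comm,
        ← sub_eq_add_neg]
    rw [integral_congr_ae h2, integral_const_mul]
    calc _ ≤ ((m : ℝ) * k / (2 * r)) ^ 2 * (4 * r ^ 2 * lam ^ 2 / ((m : ℝ) * k)) :=
          mul_le_mul_of_nonneg_left h1 (sq_nonneg _)
      _ = _ := by field_simp; ring
  calc _ ≤ ∫ _, (m : ℝ) * k * lam ^ 2 ∂ν :=
        integral_mono_ae hint.integral_prod_right (integrable_const _) hbound
    _ = _ := by simp

lemma integral_sampleCost (hν : IsInitialLaw ν Cm) {K : Policy m k} (h : S.Stab K) :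
    Integrable (fun s => (S.sampleCost K s).toReal) ν ∧
      ∫ s, (S.sampleCost K s).toReal ∂ν = (S.cost ν K).toReal := by
  have h1 : (fun s => (S.sampleCost K s).toReal) = fun s => s ⬝ᵥ (S.valueMat K *ᵥ s) := by
    ext s
    rw [h.sampleCost_eq, ENNReal.toReal_ofReal (h.quad_nonneg s)]
  rw [h1, h.cost_eq hν, ENNReal.toReal_ofReal h.trace_nonneg]
  exact ⟨hν.integrable_quad _, hν.integral_quad _⟩

/-- For a fixed direction, averaging over the initial state replaces sample costs by population
costs. Only the population cost has to be expanded for the bias. -/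
lemma integral_inner_gradEst (hm : 0 < m) (hk : 0 < k) (hν : IsInitialLaw ν Cm)
    (hG : ∀ K ∈ G, S.Stab K)
    (hs : ∀ᵐ s ∂ν, ∀ K ∈ G, ‖fderiv ℝ (fun K' => (S.sampleCost K' s).toReal) K‖ ≤ lam)
    (hr : 0 < r) (hx : ∀ v, ‖v‖ ≤ r → x + v ∈ G) (w : Policy m k) :
    ∫ z, inner ℝ (gradEst S r x z.1 z.2) w ∂(uniformSphere m k).prod ν =
      (m : ℝ) * k / (2 * r) * ∫ u, ((S.cost ν (x + r • u)).toReal -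
        (S.cost ν (x + -(r • u))).toReal) * inner ℝ u w ∂uniformSphere m k := by
  have := isProbabilityMeasure_uniformSphere hm hk
  have := hν.isProb
  have hint := integrable_comp_gradEst hm hk hG hs hr hx (b := fun y => inner ℝ y w) (by fun_prop)
  rw [integral_prod _ hint, ← integral_const_mul]
  refine integral_congr_ae ?_
  filter_upwards [ae_norm_uniformSphere] with u hu
  have hru : ‖r • u‖ ≤ r := by rw [norm_smul, hu, Real.norm_eq_abs, abs_of_pos hr, mul_one]
  obtain ⟨h1, h2⟩ := integral_sampleCost hν (hG _ (hx (r • u) hru))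
  obtain ⟨h3, h4⟩ := integral_sampleCost hν (hG _ (hx (-(r • u)) (by rwa [norm_neg])))
  rw [← h2, ← h4, ← integral_sub h1 h3]
  have h5 : ∀ s, inner ℝ (gradEst S r x u s) w = (m : ℝ) * k / (2 * r) * inner ℝ u w *
      ((S.sampleCost (x + r • u) s).toReal - (S.sampleCost (x + -(r • u)) s).toReal) := fun s => by
    rw [gradEst, real_inner_smul_left, ← sub_eq_add_neg]
    ring
  simp only [h5]
  rw [integral_const_mul]
  ring

/-- The two-point estimate is a nearly unbiased estimate of the gradient. -/
lemma le_integral_inner_gradEst (hm : 0 < m) (hk : 0 < k) (hν : IsInitialLaw ν Cm)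
    (hG : ∀ K ∈ G, S.Stab K)
    (hs : ∀ᵐ s ∂ν, ∀ K ∈ G, ‖fderiv ℝ (fun K' => (S.sampleCost K' s).toReal) K‖ ≤ lam)
    (hr : 0 < r) (hx : ∀ v, ‖v‖ ≤ r → x + v ∈ G) (hφ : 0 ≤ φ) (hrρ : r ≤ ρ)
    (hsm : HasLocallyLipschitzGradientAt (S.cost ν) φ ρ x) :
    ‖gradient (fun K => (S.cost ν K).toReal) x‖ ^ 2 -
        φ * r * ‖gradient (fun K => (S.cost ν K).toReal) x‖ ≤
      ∫ z, inner ℝ (gradEst S r x z.1 z.2) (gradient (fun K => (S.cost ν K).toReal) x)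
        ∂(uniformSphere m k).prod ν := by
  have := isProbabilityMeasure_uniformSphere hm hk
  have hD : (0 : ℝ) < (m : ℝ) * k := by positivity
  set w := gradient (fun K => (S.cost ν K).toReal) x with hw
  have hmeas : Measurable fun y => (S.cost ν (x + y)).toReal :=
    ((lowerSemicontinuous_cost hν).measurable.comp (measurable_const_add x)).ennreal_toReal
  rw [integral_inner_gradEst hm hk hν hG hs hr hx]
  -- Splitting off the linear part leaves a (φ r)-Lipschitz remainder; the linear part contributes
  -- exactly ‖w‖² by the second moments of the sphere.
  set q : Policy m k → ℝ := fun y => (S.cost ν (x + y)).toReal - inner ℝ w y with hq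
  have hqm : Measurable q := hmeas.sub (by fun_prop)
  have hL : ∀ y z, ‖y‖ ≤ r → ‖z‖ ≤ r → |q y - q z| ≤ φ * r * ‖y - z‖ := fun y z hy hz =>
    hsm.abs_remainder_sub_le hrρ hφ hy hz
  have hb := abs_integral_sub_mul_inner_le hm hk hr.le hL hqm w
  have hru : ∀ u : Policy m k, ‖u‖ = 1 → ‖r • u‖ ≤ r := fun u hu => by
    rw [norm_smul, hu, Real.norm_eq_abs, abs_of_pos hr, mul_one]
  have hi1 : Integrable (fun u => (q (r • u) - q (-(r • u))) * inner ℝ u w)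
      (uniformSphere m k) := by
    refine integrable_uniformSphere_of_bound hm hk ?_ (φ * r * (2 * r) * ‖w‖) fun u hu => ?_
    · exact (((hqm.comp (by fun_prop)).sub (hqm.comp (by fun_prop))).mul
        (by fun_prop)).aestronglyMeasurable
    · rw [abs_mul]
      have h1 := hL (r • u) (-(r • u)) (hru u hu) (by rw [norm_neg]; exact hru u hu)
      have h2 : ‖r • u - -(r • u)‖ ≤ 2 * r := by
        rw [sub_neg_eq_add, two_mul]
        exact (norm_add_le _ _).trans (add_le_add (hru u hu) (hru u hu))
      have h3 : |inner ℝ u w| ≤ ‖w‖ := by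
        simpa [hu] using abs_real_inner_le_norm u w
      exact mul_le_mul (h1.trans (mul_le_mul_of_nonneg_left h2 (by positivity))) h3 (abs_nonneg _)
        (by positivity)
  have hsplit : ∀ u, ((S.cost ν (x + r • u)).toReal - (S.cost ν (x + -(r • u))).toReal) *
      inner ℝ u w = (q (r • u) - q (-(r • u))) * inner ℝ u w + 2 * r * inner ℝ u w ^ 2 :=
    fun u => by
      simp only [hq, inner_neg_right, real_inner_smul_right, real_inner_comm u w]
      ring
  simp only [hsplit]
  rw [integral_add hi1 ((integrable_inner_sq hm hk w).const_mul _), integral_const_mul,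
    integral_inner_sq hm hk]
  have h1 := (abs_le.1 hb).1
  have h2 : (m : ℝ) * k / (2 * r) * (-(2 * r * (φ * r) * ‖w‖ / ((m : ℝ) * k)) +
      2 * r * (‖w‖ ^ 2 / ((m : ℝ) * k))) = ‖w‖ ^ 2 - φ * r * ‖w‖ := by
    field_simp
    ring
  rw [← h2]
  gcongr

end Moments

end System

end LQR

/-! ### Expected one-step decrease, and orbits driven by independent noise. -/

namespace LQR

namespace System

variable {m k : ℕ} {S : System m k} {ν : Measure (State m)} {Cm : ℝ}
variable {Kstar x : Policy m k} {d φ lam ρ μ r η ε : ℝ}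

/-- The suboptimality of a policy, infinite for policies of infinite cost. -/
noncomputable def subopt (S : System m k) (ν : Measure (State m)) (Kstar K : Policy m k) : ℝ≥0∞ :=
  S.cost ν K - S.cost ν Kstar

lemma subopt_eq (hs : S.cost ν Kstar ≠ ⊤) {K : Policy m k} (hK : S.cost ν K ≠ ⊤) :
    S.subopt ν Kstar K = ENNReal.ofReal (S.gap ν Kstar K) := by
  rw [gap, ENNReal.ofReal_sub _ ENNReal.toReal_nonneg, ENNReal.ofReal_toReal hK,
    ENNReal.ofReal_toReal hs, subopt]

/-- In `ℝ≥0∞` an infinite cost stays an infinite gap, so a bound on `subopt` carries finiteness of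
the cost with it, and no integrability along the process has to be tracked. -/
lemma subopt_le_ofReal_iff (hs : S.cost ν Kstar ≠ ⊤) {K : Policy m k} {b : ℝ} (hb : 0 ≤ b) :
    S.subopt ν Kstar K ≤ ENNReal.ofReal b ↔ K ∈ sublevel (S.cost ν) Kstar b := by
  by_cases hK : S.cost ν K = ⊤
  · simp [subopt, sublevel, hK, hs]
  · rw [subopt_eq hs hK, ENNReal.ofReal_le_ofReal_iff hb]
    exact ⟨fun h => ⟨hK, h⟩, fun h => h.2⟩

lemma measurable_subopt (hν : IsInitialLaw ν Cm) (Kstar : Policy m k) :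
    Measurable (S.subopt ν Kstar) :=
  (lowerSemicontinuous_cost hν).measurable.sub_const _

/-- The update of the two-point method. -/
noncomputable def step (S : System m k) (η r : ℝ) (K : Policy m k) (z : Policy m k × State m) :
    Policy m k :=
  K - η • gradEst S r K z.1 z.2

/-- The expected decrease of the suboptimality in one step. -/
lemma lintegral_subopt_step_le (hm : 0 < m) (hk : 0 < k) (hν : IsInitialLaw ν Cm)
    (h : IsRegular (S.cost ν) Kstar d φ lam ρ μ)
    (hs : ∀ᵐ s ∂ν, ∀ K ∈ sublevel (S.cost ν) Kstar d,
      ‖fderiv ℝ (fun K' => (S.sampleCost K' s).toReal) K‖ ≤ lam)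
    (hr : 0 < r) (hrρ : r ≤ ρ) (hη : 0 < η) (hηρ : η * ((m : ℝ) * k * lam) ≤ ρ)
    (hx : ∀ v, ‖v‖ ≤ r → x + v ∈ sublevel (S.cost ν) Kstar d) :
    ∫⁻ z, S.subopt ν Kstar (S.step η r x z) ∂(uniformSphere m k).prod ν ≤
      ENNReal.ofReal (S.gap ν Kstar x -
        η * (‖gradient (fun K => (S.cost ν K).toReal) x‖ ^ 2 -
          φ * r * ‖gradient (fun K => (S.cost ν K).toReal) x‖) +
        φ / 2 * η ^ 2 * ((m : ℝ) * k * lam ^ 2)) := by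
  have := isProbabilityMeasure_uniformSphere hm hk
  have := hν.isProb
  have hx0 : x ∈ sublevel (S.cost ν) Kstar d := by simpa using hx 0 (by simpa using hr.le)
  have hst : S.cost ν Kstar ≠ ⊤ := ne_top_of_le_ne_top hx0.1 (h.opt x)
  have hG : ∀ K ∈ sublevel (S.cost ν) Kstar d, S.Stab K := fun K hK =>
    (cost_ne_top_iff hν _).1 hK.1
  have hsm := h.smooth x hx0
  set w := gradient (fun K => (S.cost ν K).toReal) x with hw
  have hi0 : Integrable (fun z : Policy m k × State m =>
      (inner ℝ (gradEst S r x z.1 z.2) w : ℝ)) ((uniformSphere m k).prod ν) :=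
    integrable_comp_gradEst hm hk hG hs hr hx (b := fun y => inner ℝ y w) (by fun_prop)
  have hi1 : Integrable (fun z : Policy m k × State m =>
      ‖gradEst S r x z.1 z.2‖ ^ 2) ((uniformSphere m k).prod ν) :=
    integrable_comp_gradEst hm hk hG hs hr hx (b := fun y => ‖y‖ ^ 2) (by fun_prop)
  set U : Policy m k × State m → ℝ := fun z =>
    S.gap ν Kstar x - η * inner ℝ (gradEst S r x z.1 z.2) w +
      φ / 2 * η ^ 2 * ‖gradEst S r x z.1 z.2‖ ^ 2 with hU
  have hle : ∀ᵐ z ∂(uniformSphere m k).prod ν, S.cost ν (S.step η r x z) ≠ ⊤ ∧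
      S.gap ν Kstar (S.step η r x z) ≤ U z := by
    filter_upwards [ae_prod_uniformSphere hm hk hs] with z hz
    set g := gradEst S r x z.1 z.2 with hg
    have hgn : ‖g‖ ≤ (m : ℝ) * k * lam := norm_gradEst_le hG hz.2 hr hx hz.1
    have hηg : ‖-(η • g)‖ ≤ ρ := by
      rw [norm_neg, norm_smul, Real.norm_eq_abs, abs_of_pos hη]
      exact (mul_le_mul_of_nonneg_left hgn hη.le).trans hηρ
    have hstep : S.step η r x z = x + -(η • g) := sub_eq_add_neg _ _
    rw [hstep]
    refine ⟨(hsm (x + -(η • g)) (by simpa using hηg)).1, ?_⟩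
    have h1 := hsm.le_quadratic hηg
    rw [← hw, inner_neg_right, real_inner_smul_right, norm_neg, norm_smul, Real.norm_eq_abs,
      mul_pow, sq_abs, real_inner_comm] at h1
    simp only [hU, gap, ← hg]
    linarith
  have hU0 : 0 ≤ᵐ[(uniformSphere m k).prod ν] U := by
    filter_upwards [hle] with z hz
    exact (h.gap_nonneg hz.1).trans hz.2
  have hiU : Integrable U ((uniformSphere m k).prod ν) :=
    ((integrable_const _).sub (hi0.const_mul η)).add (hi1.const_mul _)
  have hUint : ∫ z, U z ∂(uniformSphere m k).prod ν = S.gap ν Kstar x -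
      η * ∫ z, inner ℝ (gradEst S r x z.1 z.2) w ∂(uniformSphere m k).prod ν +
      φ / 2 * η ^ 2 * ∫ z, ‖gradEst S r x z.1 z.2‖ ^ 2 ∂(uniformSphere m k).prod ν := by
    have hi2 : Integrable (fun z : Policy m k × State m =>
        S.gap ν Kstar x - η * inner ℝ (gradEst S r x z.1 z.2) w) ((uniformSphere m k).prod ν) :=
      (integrable_const _).sub (hi0.const_mul η)
    simp only [hU]
    rw [integral_add hi2 (hi1.const_mul _), integral_sub (integrable_const _) (hi0.const_mul η), integral_const_mul,
      integral_const_mul]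
    simp
  calc ∫⁻ z, S.subopt ν Kstar (S.step η r x z) ∂(uniformSphere m k).prod ν
      ≤ ∫⁻ z, ENNReal.ofReal (U z) ∂(uniformSphere m k).prod ν := by
        refine lintegral_mono_ae ?_
        filter_upwards [hle] with z hz
        rw [subopt_eq hst hz.1]
        exact ENNReal.ofReal_le_ofReal hz.2
    _ = ENNReal.ofReal (∫ z, U z ∂(uniformSphere m k).prod ν) :=
        (ofReal_integral_eq_lintegral_ofReal hiU hU0).symm
    _ ≤ _ := by
        refine ENNReal.ofReal_le_ofReal ?_
        rw [hUint]
        have h1 := le_integral_inner_gradEst hm hk hν hG hs hr hx h.φ_pos.le hrρ hsm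
        have h2 := integral_norm_gradEst_sq_le hm hk hG hs hr hx
        have h3 : 0 ≤ φ / 2 * η ^ 2 := by
          have := h.φ_pos
          positivity
        rw [← hw] at h1
        have h4 := mul_le_mul_of_nonneg_left h1 hη.le
        have h5 := mul_le_mul_of_nonneg_left h2 h3
        linarith

/-- The two one-step bounds that the analysis of the method needs. -/
lemma lintegral_subopt_step_le_of_params (hm : 0 < m) (hk : 0 < k) (hν : IsInitialLaw ν Cm)
    (h : IsRegular (S.cost ν) Kstar d φ lam ρ μ)
    (hs : ∀ᵐ s ∂ν, ∀ K ∈ sublevel (S.cost ν) Kstar d,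
      ‖fderiv ℝ (fun K' => (S.sampleCost K' s).toReal) K‖ ≤ lam)
    (hr : 0 < r) (hrρ : r ≤ ρ) (hη : 0 < η) (hηρ : η * ((m : ℝ) * k * lam) ≤ ρ)
    (hrε : φ ^ 2 * r ^ 2 ≤ ε * μ / 120)
    (hηε : η * (240 * φ * ((m : ℝ) * k) * lam ^ 2) ≤ ε * μ)
    (hx : ∀ v, ‖v‖ ≤ r → x + v ∈ sublevel (S.cost ν) Kstar d) :
    ∫⁻ z, S.subopt ν Kstar (S.step η r x z) ∂(uniformSphere m k).prod ν ≤
      ENNReal.ofReal (S.gap ν Kstar x + η * ε * μ / 240) ∧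
    ∫⁻ z, S.subopt ν Kstar (S.step η r x z) ∂(uniformSphere m k).prod ν ≤
      ENNReal.ofReal ((1 - η * μ / 2) * S.gap ν Kstar x + η * ε * μ / 160) := by
  have hmain := lintegral_subopt_step_le hm hk hν h hs hr hrρ hη hηρ hx
  have hx0 : x ∈ sublevel (S.cost ν) Kstar d := by simpa using hx 0 (by simpa using hr.le)
  have hpl := (h.pl.2 x hx0.1).2
  set w := ‖gradient (fun K => (S.cost ν K).toReal) x‖ with hw
  -- The variance term costs ηεμ/480. Completing squares, the bias costs φ² r² / 4 ≤ εμ/480 if the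
  -- whole of w² is spent, and φ² r² / 2 ≤ εμ/240 if half of w² is kept for PL. The sums are the
  -- 1/240 and 1/160 of the claim.
  have h1 : φ / 2 * η ^ 2 * ((m : ℝ) * k * lam ^ 2) ≤ η * (ε * μ) / 480 := by
    have := mul_le_mul_of_nonneg_left hηε hη.le
    linarith
  have h2 : φ * r * w - w ^ 2 ≤ ε * μ / 480 := by
    nlinarith [sq_nonneg (w - φ * r / 2)]
  have h3 : φ * r * w - w ^ 2 ≤ ε * μ / 240 - w ^ 2 / 2 := by
    nlinarith [sq_nonneg (w - φ * r)]
  have h4 := mul_le_mul_of_nonneg_left h2 hη.le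
  have h5 := mul_le_mul_of_nonneg_left h3 hη.le
  have h6 := mul_le_mul_of_nonneg_left hpl hη.le
  refine ⟨hmain.trans (ENNReal.ofReal_le_ofReal ?_), hmain.trans (ENNReal.ofReal_le_ofReal ?_)⟩
  · linarith
  · unfold gap at hmain ⊢
    linarith

end System

/-! ### Processes driven by independent noise -/

section Orbits

variable {X Z Ω : Type*}

/-- The orbit of `x₀` under the random dynamical system `F` with the noise sequence `ζ`. -/
def orbit (F : X → Z → X) (x₀ : X) (ζ : ℕ → Z) : ℕ → X
  | 0 => x₀
  | t + 1 => F (orbit F x₀ ζ t) (ζ t)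

lemma orbit_congr {F : X → Z → X} {x₀ : X} {ζ ζ' : ℕ → Z} {t : ℕ} (h : ∀ i < t, ζ i = ζ' i) :
    ∀ s ≤ t, orbit F x₀ ζ s = orbit F x₀ ζ' s := by
  intro s
  induction s with
  | zero => intro _; rfl
  | succ s ih =>
    intro hs
    rw [orbit, orbit, ih (by omega), h s (by omega)]

variable [MeasurableSpace X] [MeasurableSpace Z] [MeasurableSpace Ω]

lemma measurable_orbit {F : X → Z → X} (hF : Measurable fun p : X × Z => F p.1 p.2) (x₀ : X)
    (t : ℕ) : Measurable fun ζ : ℕ → Z => orbit F x₀ ζ t := by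
  induction t with
  | zero => exact measurable_const
  | succ t ih => exact hF.comp (ih.prodMk (measurable_pi_apply t))

variable {P : Measure Ω} {ξ : ℕ → Ω → Z} {π : Measure Z}

/-- The event that the orbit stays in `A` up to time `t`. -/
def staysIn (F : X → Z → X) (x₀ : X) (A : Set X) (t : ℕ) : Set (ℕ → Z) :=
  {ζ | ∀ s ≤ t, orbit F x₀ ζ s ∈ A}

lemma measurableSet_staysIn {F : X → Z → X} (hF : Measurable fun p : X × Z => F p.1 p.2) (x₀ : X)
    {A : Set X} (hA : MeasurableSet A) (t : ℕ) : MeasurableSet (staysIn F x₀ A t) := by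
  have : staysIn F x₀ A t = ⋂ s, ⋂ _ : s ≤ t, (fun ζ => orbit F x₀ ζ s) ⁻¹' A := by
    ext ζ; simp [staysIn]
  rw [this]
  exact MeasurableSet.iInter fun s => MeasurableSet.iInter fun _ => measurable_orbit hF x₀ s hA

/-- If the expectation of `Φ` after one step from `x ∈ A` is at most `Ψ x`, then the expectation
of `Φ` at time `t + 1` on the event of staying in `A` up to time `t` is at most that of `Ψ` at
time `t`. -/
lemma lintegral_orbit_succ_le [Nonempty Z] [IsProbabilityMeasure P] [SFinite π]
    (hξ : ∀ t, Measurable (ξ t)) (hlaw : ∀ t, P.map (ξ t) = π) (hind : iIndepFun ξ P)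
    {F : X → Z → X} (hF : Measurable fun p : X × Z => F p.1 p.2) (x₀ : X) {A : Set X}
    (hA : MeasurableSet A) {Φ Ψ : X → ℝ≥0∞} (hΦ : Measurable Φ) (hΨ : Measurable Ψ)
    (h : ∀ x ∈ A, ∫⁻ z, Φ (F x z) ∂π ≤ Ψ x) (t : ℕ) :
    ∫⁻ ω in {ω | (fun i => ξ i ω) ∈ staysIn F x₀ A t}, Φ (orbit F x₀ (fun i => ξ i ω) (t + 1)) ∂P ≤
      ∫⁻ ω in {ω | (fun i => ξ i ω) ∈ staysIn F x₀ A t}, Ψ (orbit F x₀ (fun i => ξ i ω) t) ∂P := by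
  classical
  obtain ⟨z₀⟩ := ‹Nonempty Z›
  set hist : Ω → (Finset.range t → Z) := fun ω i => ξ i ω with hhist
  have hhm : Measurable hist := measurable_pi_lambda _ fun i => hξ i
  -- Histories are padded by an arbitrary value: the orbit up to time t reads only the noise before
  -- t. So it is a function of a finite history independent of the noise at time t, and Tonelli
  -- applies.
  let ext : (Finset.range t → Z) → ℕ → Z := fun v i =>
    if hi : i ∈ Finset.range t then v ⟨i, hi⟩ else z₀
  have hext : Measurable ext := by
    refine measurable_pi_lambda _ fun i => ?_
    by_cases hi : i ∈ Finset.range t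
    · simp only [ext, hi, dite_true]; exact measurable_pi_apply _
    · simp only [ext, hi, dite_false]; exact measurable_const
  have heq : ∀ ω, ∀ s ≤ t, orbit F x₀ (fun i => ξ i ω) s = orbit F x₀ (ext (hist ω)) s :=
    fun ω => orbit_congr fun i hi => by simp [ext, hhist, hi]
  set B := ext ⁻¹' staysIn F x₀ A t with hB
  have hBm : MeasurableSet B := hext (measurableSet_staysIn hF x₀ hA t)
  have hset : {ω | (fun i => ξ i ω) ∈ staysIn F x₀ A t} = hist ⁻¹' B := by
    ext ω
    exact forall₂_congr fun s hs => by rw [heq ω s hs]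
  set G : (Finset.range t → Z) → X := fun v => orbit F x₀ (ext v) t with hG
  have hGm : Measurable G := (measurable_orbit hF x₀ t).comp hext
  have hindep : IndepFun hist (ξ t) P :=
    (hind.indepFun_finset (Finset.range t) {t} (by simp) hξ).comp measurable_id
      (measurable_pi_apply (⟨t, by simp⟩ : ({t} : Finset ℕ)))
  have hprod : P.map (fun ω => (hist ω, ξ t ω)) = (P.map hist).prod π := by
    rw [(indepFun_iff_map_prod_eq_prod_map_map hhm.aemeasurable (hξ t).aemeasurable).1 hindep,
      hlaw t]
  have hΦm : Measurable fun p : (Finset.range t → Z) × Z => Φ (F (G p.1) p.2) :=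
    hΦ.comp (hF.comp ((hGm.comp measurable_fst).prodMk measurable_snd))
  have hindm : Measurable fun p : (Finset.range t → Z) × Z =>
      B.indicator (fun _ => (1 : ℝ≥0∞)) p.1 * Φ (F (G p.1) p.2) :=
    ((measurable_const.indicator hBm).comp measurable_fst).mul hΦm
  rw [hset, ← lintegral_indicator (hhm hBm), ← lintegral_indicator (hhm hBm)]
  calc ∫⁻ ω, (hist ⁻¹' B).indicator (fun ω => Φ (orbit F x₀ (fun i => ξ i ω) (t + 1))) ω ∂P
      = ∫⁻ ω, B.indicator (fun _ => (1 : ℝ≥0∞)) (hist ω) * Φ (F (G (hist ω)) (ξ t ω)) ∂P := by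
        refine lintegral_congr fun ω => ?_
        have h1 : orbit F x₀ (fun i => ξ i ω) (t + 1) = F (G (hist ω)) (ξ t ω) :=
          congrArg (fun x => F x (ξ t ω)) (heq ω t le_rfl)
        by_cases hω : hist ω ∈ B
        · rw [Set.indicator_of_mem (show ω ∈ hist ⁻¹' B from hω), Set.indicator_of_mem hω, one_mul,
            h1]
        · simp [hω]
    _ = ∫⁻ p, B.indicator (fun _ => (1 : ℝ≥0∞)) p.1 * Φ (F (G p.1) p.2) ∂(P.map hist).prod π := by
        rw [← hprod, lintegral_map hindm (hhm.prodMk (hξ t))]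
    _ = ∫⁻ v, B.indicator (fun _ => (1 : ℝ≥0∞)) v * ∫⁻ z, Φ (F (G v) z) ∂π ∂P.map hist := by
        rw [lintegral_prod _ hindm.aemeasurable]
        refine lintegral_congr fun v => ?_
        exact lintegral_const_mul (f := fun z => Φ (F (G v) z)) (B.indicator (fun _ => 1) v)
          (hΦm.comp measurable_prodMk_left)
    _ ≤ ∫⁻ v, B.indicator (fun _ => (1 : ℝ≥0∞)) v * Ψ (G v) ∂P.map hist := by
        refine lintegral_mono fun v => ?_
        by_cases hv : v ∈ B
        · simp only [hv, Set.indicator_of_mem, one_mul]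
          exact h _ (hv t le_rfl)
        · simp [hv]
    _ = ∫⁻ ω, B.indicator (fun _ => (1 : ℝ≥0∞)) (hist ω) * Ψ (G (hist ω)) ∂P :=
        lintegral_map ((measurable_const.indicator hBm).mul (hΨ.comp hGm)) hhm
    _ = ∫⁻ ω, (hist ⁻¹' B).indicator (fun ω => Ψ (orbit F x₀ (fun i => ξ i ω) t)) ω ∂P := by
        refine lintegral_congr fun ω => ?_
        by_cases hω : hist ω ∈ B
        · rw [Set.indicator_of_mem (show ω ∈ hist ⁻¹' B from hω), Set.indicator_of_mem hω, one_mul,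
            heq ω t le_rfl]
        · simp [hω]

end Orbits

end LQR

/-! ### Maximal inequality, geometric decay, and the numerical bounds. -/

namespace LQR

section Orbits

variable {X Z Ω : Type*} [MeasurableSpace X] [MeasurableSpace Z] [MeasurableSpace Ω]
variable {P : Measure Ω} {ξ : ℕ → Ω → Z} {π : Measure Z} {F : X → Z → X} {x₀ : X}
variable {Φ : X → ℝ≥0∞} {M b q c : ℝ≥0∞}

/-- Maximal inequality for a process that is an almost supermartingale until it leaves the sublevel
set `{Φ ≤ M}`. -/
lemma lintegral_orbit_add_exit_le [Nonempty Z] [IsProbabilityMeasure P] [SFinite π]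
    (hξ : ∀ t, Measurable (ξ t)) (hlaw : ∀ t, P.map (ξ t) = π) (hind : iIndepFun ξ P)
    (hF : Measurable fun p : X × Z => F p.1 p.2) (hΦ : Measurable Φ) (hx₀ : Φ x₀ ≤ M)
    (h : ∀ x, Φ x ≤ M → ∫⁻ z, Φ (F x z) ∂π ≤ Φ x + b) (t : ℕ) :
    ∫⁻ ω in {ω | (fun i => ξ i ω) ∈ staysIn F x₀ {x | Φ x ≤ M} t},
        Φ (orbit F x₀ (fun i => ξ i ω) t) ∂P +
      M * P {ω | (fun i => ξ i ω) ∈ staysIn F x₀ {x | Φ x ≤ M} t}ᶜ ≤ Φ x₀ + t * b ∧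
    ∫⁻ ω in {ω | (fun i => ξ i ω) ∈ staysIn F x₀ {x | Φ x ≤ M} t},
        Φ (orbit F x₀ (fun i => ξ i ω) (t + 1)) ∂P +
      M * P {ω | (fun i => ξ i ω) ∈ staysIn F x₀ {x | Φ x ≤ M} t}ᶜ ≤
        Φ x₀ + (t + 1 : ℕ) * b := by
  have hA : MeasurableSet {x | Φ x ≤ M} := measurableSet_le hΦ measurable_const
  have hξm : Measurable fun ω i => ξ i ω := measurable_pi_lambda _ hξ
  have hSm : ∀ t, MeasurableSet {ω | (fun i => ξ i ω) ∈ staysIn F x₀ {x | Φ x ≤ M} t} := fun t =>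
    hξm (measurableSet_staysIn hF x₀ hA t)
  have hstep : ∀ t, ∫⁻ ω in {ω | (fun i => ξ i ω) ∈ staysIn F x₀ {x | Φ x ≤ M} t},
        Φ (orbit F x₀ (fun i => ξ i ω) (t + 1)) ∂P ≤
      ∫⁻ ω in {ω | (fun i => ξ i ω) ∈ staysIn F x₀ {x | Φ x ≤ M} t},
        Φ (orbit F x₀ (fun i => ξ i ω) t) ∂P + b := fun t => by
    refine (lintegral_orbit_succ_le hξ hlaw hind hF x₀ hA hΦ (hΦ.add_const b) h t).trans ?_
    rw [lintegral_add_right _ measurable_const, setLIntegral_const]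
    gcongr
    exact mul_le_of_le_one_right' prob_le_one
  -- Paths that stayed until t move one step further. This is the second claim as well as half of
  -- the induction step for the first.
  have hnext : ∀ t, ∫⁻ ω in {ω | (fun i => ξ i ω) ∈ staysIn F x₀ {x | Φ x ≤ M} t},
        Φ (orbit F x₀ (fun i => ξ i ω) t) ∂P +
      M * P {ω | (fun i => ξ i ω) ∈ staysIn F x₀ {x | Φ x ≤ M} t}ᶜ ≤ Φ x₀ + t * b →
      ∫⁻ ω in {ω | (fun i => ξ i ω) ∈ staysIn F x₀ {x | Φ x ≤ M} t},
        Φ (orbit F x₀ (fun i => ξ i ω) (t + 1)) ∂P +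
      M * P {ω | (fun i => ξ i ω) ∈ staysIn F x₀ {x | Φ x ≤ M} t}ᶜ ≤
        Φ x₀ + (t + 1 : ℕ) * b := fun t ht => by
    calc _ ≤ (∫⁻ ω in {ω | (fun i => ξ i ω) ∈ staysIn F x₀ {x | Φ x ≤ M} t},
          Φ (orbit F x₀ (fun i => ξ i ω) t) ∂P + b) +
          M * P {ω | (fun i => ξ i ω) ∈ staysIn F x₀ {x | Φ x ≤ M} t}ᶜ := by
          gcongr; exact hstep t
      _ ≤ (Φ x₀ + t * b) + b := by rw [add_right_comm]; gcongr
      _ = _ := by push_cast; ring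
  suffices hmain : ∫⁻ ω in {ω | (fun i => ξ i ω) ∈ staysIn F x₀ {x | Φ x ≤ M} t},
        Φ (orbit F x₀ (fun i => ξ i ω) t) ∂P +
      M * P {ω | (fun i => ξ i ω) ∈ staysIn F x₀ {x | Φ x ≤ M} t}ᶜ ≤ Φ x₀ + t * b from
    ⟨hmain, hnext t hmain⟩
  induction t with
  | zero =>
    have huniv : {ω | (fun i => ξ i ω) ∈ staysIn F x₀ {x | Φ x ≤ M} 0} = Set.univ := by
      ext ω
      simp [staysIn, orbit, hx₀]
    rw [huniv]
    simp [orbit]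
  | succ t ih =>
    refine le_trans ?_ (hnext t ih)
    set S₀ := {ω | (fun i => ξ i ω) ∈ staysIn F x₀ {x | Φ x ≤ M} t} with hS₀
    set S₁ := {ω | (fun i => ξ i ω) ∈ staysIn F x₀ {x | Φ x ≤ M} (t + 1)} with hS₁
    have hsub : S₁ ⊆ S₀ := fun ω hω s hs => hω s (hs.trans t.le_succ)
    -- On paths that leave exactly at time t + 1 the value is at least M, so their part of the
    -- integral pays for M times their probability.
    have hexit : ∀ ω ∈ S₀ \ S₁, M ≤ Φ (orbit F x₀ (fun i => ξ i ω) (t + 1)) := by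
      rintro ω ⟨h0, h1⟩
      by_contra! hlt
      refine h1 fun s hs => ?_
      rcases Nat.le_succ_iff.1 hs with hs | rfl
      · exact h0 s hs
      · exact hlt.le
    have hcompl : P S₁ᶜ ≤ P (S₀ \ S₁) + P S₀ᶜ := by
      refine (measure_mono ?_).trans (measure_union_le _ _)
      intro ω hω
      by_cases h0 : ω ∈ S₀
      · exact Or.inl ⟨h0, hω⟩
      · exact Or.inr h0
    have hsplit : ∫⁻ ω in S₁, Φ (orbit F x₀ (fun i => ξ i ω) (t + 1)) ∂P + M * P (S₀ \ S₁) ≤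
        ∫⁻ ω in S₀, Φ (orbit F x₀ (fun i => ξ i ω) (t + 1)) ∂P := by
      rw [← lintegral_inter_add_sdiff _ S₀ (hSm (t + 1)), Set.inter_eq_self_of_subset_right hsub]
      gcongr
      rw [← setLIntegral_const]
      exact setLIntegral_mono' ((hSm t).diff (hSm (t + 1))) hexit
    calc _ ≤ ∫⁻ ω in S₁, Φ (orbit F x₀ (fun i => ξ i ω) (t + 1)) ∂P +
          M * (P (S₀ \ S₁) + P S₀ᶜ) := by gcongr
      _ = (∫⁻ ω in S₁, Φ (orbit F x₀ (fun i => ξ i ω) (t + 1)) ∂P + M * P (S₀ \ S₁)) +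
          M * P S₀ᶜ := by ring
      _ ≤ _ := by gcongr

/-- Geometric decay of the expectation of a process that contracts, up to an additive error, until
it leaves a set. -/
lemma lintegral_orbit_le_of_contraction [Nonempty Z] [IsProbabilityMeasure P] [SFinite π]
    (hξ : ∀ t, Measurable (ξ t)) (hlaw : ∀ t, P.map (ξ t) = π) (hind : iIndepFun ξ P)
    (hF : Measurable fun p : X × Z => F p.1 p.2) (hΦ : Measurable Φ) {A : Set X}
    (hA : MeasurableSet A) (hqc : q * c + b = c)
    (h : ∀ x ∈ A, ∫⁻ z, Φ (F x z) ∂π ≤ q * Φ x + b) (t : ℕ) :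
    ∫⁻ ω in {ω | (fun i => ξ i ω) ∈ staysIn F x₀ A t},
        Φ (orbit F x₀ (fun i => ξ i ω) (t + 1)) ∂P ≤ q ^ (t + 1) * Φ x₀ + c := by
  have hstep : ∀ t, ∫⁻ ω in {ω | (fun i => ξ i ω) ∈ staysIn F x₀ A t},
        Φ (orbit F x₀ (fun i => ξ i ω) (t + 1)) ∂P ≤
      q * ∫⁻ ω in {ω | (fun i => ξ i ω) ∈ staysIn F x₀ A t},
        Φ (orbit F x₀ (fun i => ξ i ω) t) ∂P + b := fun t => by
    have hm : Measurable fun ω => Φ (orbit F x₀ (fun i => ξ i ω) t) :=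
      hΦ.comp ((measurable_orbit hF x₀ t).comp (measurable_pi_lambda _ hξ))
    refine (lintegral_orbit_succ_le hξ hlaw hind hF x₀ hA hΦ ((hΦ.const_mul q).add_const b)
      h t).trans ?_
    rw [lintegral_add_right _ measurable_const, setLIntegral_const, lintegral_const_mul _ hm]
    gcongr
    exact mul_le_of_le_one_right' prob_le_one
  suffices hmain : ∫⁻ ω in {ω | (fun i => ξ i ω) ∈ staysIn F x₀ A t},
      Φ (orbit F x₀ (fun i => ξ i ω) t) ∂P ≤ q ^ t * Φ x₀ + c by
    calc _ ≤ q * (q ^ t * Φ x₀ + c) + b := (hstep t).trans (by gcongr)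
      _ = q ^ (t + 1) * Φ x₀ + (q * c + b) := by ring
      _ = _ := by rw [hqc]
  induction t with
  | zero =>
    simp only [orbit, pow_zero, one_mul, setLIntegral_const]
    exact (mul_le_of_le_one_right' prob_le_one).trans le_self_add
  | succ t ih =>
    calc _ ≤ ∫⁻ ω in {ω | (fun i => ξ i ω) ∈ staysIn F x₀ A t},
          Φ (orbit F x₀ (fun i => ξ i ω) (t + 1)) ∂P :=
          lintegral_mono_set (show {ω | (fun i => ξ i ω) ∈ staysIn F x₀ A (t + 1)} ⊆
            {ω | (fun i => ξ i ω) ∈ staysIn F x₀ A t} from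
              fun ω hω s hs => hω s (hs.trans t.le_succ))
      _ ≤ q * (q ^ t * Φ x₀ + c) + b := (hstep t).trans (by gcongr)
      _ = q ^ (t + 1) * Φ x₀ + (q * c + b) := by ring
      _ = _ := by rw [hqc]

end Orbits

section Numerics

variable {d ε μ η : ℝ} {n : ℕ}

/-- The bounds on the probabilities of leaving the region of stability and of ending there with a
large gap sum up to less than `1 / 4`. -/
lemma failure_bound_lt (hd : 0 < d) (hε : 0 < ε) (hμ : 0 < μ) (hη : 0 < η)
    (hημ : η * μ ≤ 205 / 200) (hlog : ε * Real.log (120 * d / ε) < 10 / 3 * d)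
    (hz : 1 < 120 * d / ε) (hn : n + 1 = numIter η μ d ε) :
    (d + n * (η * ε * μ / 240)) / (9 / 2 * d) +
      min (d + (n + 1 : ℕ) * (η * ε * μ / 240)) ((1 - η * μ / 2) ^ (n + 1) * d + ε / 80) / ε <
        1 / 4 := by
  set z := 120 * d / ε with hzdef
  set L := Real.log z with hL
  have hz0 : 0 < z := by linarith
  have hL0 : 0 < L := Real.log_pos hz
  have hdz : d = z * ε / 120 := by rw [hzdef]; field_simp
  have hημ0 : 0 < η * μ := mul_pos hη hμ
  have hn1 : (n : ℝ) * (η * μ) < 4 * L := by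
    have h1 : ((n + 1 : ℕ) : ℝ) < 4 / (η * μ) * L + 1 := by
      rw [hn]
      exact Nat.ceil_lt_add_one (by positivity)
    push_cast at h1
    have h2 : (n : ℝ) < 4 / (η * μ) * L := by linarith
    calc (n : ℝ) * (η * μ) < 4 / (η * μ) * L * (η * μ) := by gcongr
      _ = 4 * L := by field_simp
  have hn2 : 4 * L ≤ ((n + 1 : ℕ) : ℝ) * (η * μ) := by
    have h1 : 4 / (η * μ) * L ≤ ((n + 1 : ℕ) : ℝ) := by
      rw [hn]
      exact Nat.le_ceil _
    calc 4 * L = 4 / (η * μ) * L * (η * μ) := by field_simp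
      _ ≤ _ := by gcongr
  -- The total drift is below ε L / 60, and the hypothesis on ε bounds ε L by 10/3 d. Then (1 +
  -- 1/18) / (9/2) = 19/81.
  have hdrift : (n : ℝ) * (η * ε * μ / 240) ≤ d / 18 := by
    have h1 := mul_lt_mul_of_pos_right hn1 hε
    have h2 : ε * L < 10 / 3 * d := hlog
    linarith
  have hexit : (d + n * (η * ε * μ / 240)) / (9 / 2 * d) ≤ 19 / 81 := by
    rw [div_le_iff₀ (by positivity)]
    linarith
  -- In terms of z the hypothesis on ε reads L < z / 36. With 1 - 1/z ≤ L it excludes all z between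
  -- the roots of z² - 36 z + 36, about 1.03 and 34.97.
  have hLz : L < z / 36 := by
    have h2 : ε * L < 10 / 3 * d := hlog
    rw [hdz] at h2
    have h3 : ε * L < ε * (z / 36) := by linarith
    exact lt_of_mul_lt_mul_left h3 hε.le
  have hLge : 1 - z⁻¹ ≤ L := Real.one_sub_inv_le_log_of_pos hz0
  have hquad : 0 < z ^ 2 - 36 * z + 36 := by
    have h1 : 1 - z⁻¹ < z / 36 := hLge.trans_lt hLz
    have h2 : (1 - z⁻¹) * (36 * z) < z / 36 * (36 * z) := by gcongr
    have h3 : (1 - z⁻¹) * (36 * z) = 36 * z - 36 := by field_simp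
    nlinarith
  have hfinal : min (d + (n + 1 : ℕ) * (η * ε * μ / 240))
      ((1 - η * μ / 2) ^ (n + 1) * d + ε / 80) / ε ≤ 141 / 10000 := by
    rw [div_le_iff₀ hε]
    rcases lt_or_ge z (11 / 10) with hz1 | hz1
    -- Near z = 1 the initial gap is already about ε / 120, and the drift bound alone suffices.
    · refine (min_le_left _ _).trans ?_
      have hz2 : z ≤ 103 / 100 := by nlinarith
      have h1 : η * ε * μ ≤ 205 / 200 * ε := by nlinarith
      have h2 : d ≤ 103 / 12000 * ε := by nlinarith
      push_cast
      linarith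
    -- For large z the contraction has brought the initial gap down by z⁻², to at most ε / (120 z);
    -- the stationary error ε / 80 dominates.
    · refine (min_le_right _ _).trans ?_
      have hz2 : 20 ≤ z := by nlinarith
      have hpow : (1 - η * μ / 2) ^ (n + 1) ≤ (z ^ 2)⁻¹ := by
        have h1 : 1 - η * μ / 2 ≤ Real.exp (-(η * μ / 2)) := by
          have := Real.add_one_le_exp (-(η * μ / 2))
          linarith
        calc (1 - η * μ / 2) ^ (n + 1) ≤ Real.exp (-(η * μ / 2)) ^ (n + 1) :=
              pow_le_pow_left₀ (by linarith) h1 _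
          _ = Real.exp (-(((n + 1 : ℕ) : ℝ) * (η * μ) / 2)) := by
              rw [← Real.exp_nat_mul]
              congr 1
              ring
          _ ≤ Real.exp (-(2 * L)) := Real.exp_le_exp.2 (by linarith)
          _ = (z ^ 2)⁻¹ := by
              rw [Real.exp_neg, two_mul, Real.exp_add, hL, Real.exp_log hz0, sq]
      have h2 : (1 - η * μ / 2) ^ (n + 1) * d ≤ ε / 2400 := by
        calc _ ≤ (z ^ 2)⁻¹ * d := by gcongr
          _ = ε / (120 * z) := by rw [hdz]; field_simp
          _ ≤ ε / (120 * 20) := by gcongr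
          _ = ε / 2400 := by norm_num
      linarith
  linarith [show (19 / 81 : ℝ) + 141 / 10000 < 1 / 4 by norm_num]

/-- The number of iterations with the largest step size. -/
lemma numIter_maxStep_le {D φ lam ρ : ℝ} (hε : 0 < ε) (hμ : 0 < μ) (hD : 1 ≤ D)
    (hφ : 0 < φ) (hlam : 0 < lam) (hρ : 0 < ρ) :
    (numIter (maxStep D ε φ lam ρ μ) μ d ε : ℝ) ≤
      4 / μ * (240 * φ * lam ^ 2 / μ + 2 * φ * ε + lam * ε / ρ) * (D / ε) *
        max 0 (Real.log (120 * d / ε)) + 1 := by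
  have hD0 : 0 < D := by linarith
  set e := maxStep D ε φ lam ρ μ with he
  have he0 : 0 < e := by
    rw [he, maxStep]
    positivity
  -- The reciprocal of a minimum is one of the reciprocals, hence at most their sum.
  have hinv : 1 / e ≤ 240 * φ * D * lam ^ 2 / (ε * μ) + 2 * φ + D * lam / ρ := by
    have h1 : 0 ≤ 240 * φ * D * lam ^ 2 / (ε * μ) := by positivity
    have h2 : 0 ≤ 2 * φ := by positivity
    have h3 : 0 ≤ D * lam / ρ := by positivity
    rw [he, maxStep]
    rcases min_choice (min (ε * μ / (240 * φ * D * lam ^ 2)) (1 / (2 * φ))) (ρ / (D * lam))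
      with h | h <;> rw [h]
    · rcases min_choice (ε * μ / (240 * φ * D * lam ^ 2)) (1 / (2 * φ)) with h | h <;> rw [h]
      · rw [one_div_div]; linarith
      · rw [one_div_one_div]; linarith
    · rw [one_div_div]; linarith
  have hcoef : 4 / (e * μ) ≤
      4 / μ * (240 * φ * lam ^ 2 / μ + 2 * φ * ε + lam * ε / ρ) * (D / ε) := by
    calc 4 / (e * μ) = 4 / μ * (1 / e) := by field_simp
      _ ≤ 4 / μ * (240 * φ * D * lam ^ 2 / (ε * μ) + 2 * φ * D + D * lam / ρ) := by
          gcongr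
          refine hinv.trans ?_
          have : 2 * φ ≤ 2 * φ * D := le_mul_of_one_le_right (by positivity) hD
          linarith
      _ = _ := by field_simp
  set L := Real.log (120 * d / ε) with hL
  rw [numIter, ← hL]
  rcases le_total L 0 with hL0 | hL0
  · rw [Nat.ceil_eq_zero.2 (mul_nonpos_of_nonneg_of_nonpos (by positivity) hL0), max_eq_left hL0]
    simp
  · rw [max_eq_right hL0]
    refine (Nat.ceil_lt_add_one (by positivity)).le.trans ?_
    gcongr

end Numerics

end LQR

/-! ### Assembly: success probability and query count. -/

namespace LQR

variable {m k : ℕ} {S : System m k} {ν : Measure (State m)} {Cm : ℝ} {Kstar K₀ : Policy m k}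
variable {φK βK lamK ζK : Policy m k → ℝ} {φ lam ρ μ ε η r : ℝ}

namespace IsCurvature

lemma le_of_mem (h : IsCurvature S ν Kstar K₀ φK βK lamK ζK φ lam ρ μ) {K : Policy m k}
    (hK : K ∈ S.boundedSet ν Kstar K₀) : φK K ≤ φ ∧ lamK K ≤ lam ∧ ρ ≤ βK K ∧ ρ ≤ ζK K := by
  have h1 := h.isGLB_ρ.1 (Set.mem_image_of_mem _ hK)
  exact ⟨h.isLUB_φ.1 (Set.mem_image_of_mem _ hK), h.isLUB_lam.1 (Set.mem_image_of_mem _ hK),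
    h1.trans (min_le_left _ _), h1.trans (min_le_right _ _)⟩

lemma isRegular (h : IsCurvature S ν Kstar K₀ φK βK lamK ζK φ lam ρ μ)
    (hopt : S.IsOptimal ν Kstar) (hK₀ : S.cost ν K₀ ≠ ⊤) :
    IsRegular (S.cost ν) Kstar (10 * S.gap ν Kstar K₀) φ lam ρ μ := by
  have h0 := hopt.mem_boundedSet hK₀
  have h1 := h.le_of_mem h0
  have h2 := h.pos K₀ h0
  exact ⟨hopt, h2.1.trans_le h1.1, h2.2.2.1.trans_le h1.2.1, h.ρ_pos,
    fun K hK => (h.smooth K hK).mono (h.le_of_mem hK).1 (h.le_of_mem hK).2.2.1,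
    fun K hK => (h.lipschitz K hK).mono (h.le_of_mem hK).2.1 (h.le_of_mem hK).2.2.2, h.pl⟩

lemma ae_norm_fderiv_le (h : IsCurvature S ν Kstar K₀ φK βK lamK ζK φ lam ρ μ)
    (hν : IsInitialLaw ν Cm) (hlam : 0 ≤ lam) :
    ∀ᵐ s ∂ν, ∀ K ∈ S.boundedSet ν Kstar K₀,
      ‖fderiv ℝ (fun K' => (S.sampleCost K' s).toReal) K‖ ≤ lam := by
  refine System.ae_norm_fderiv_sampleCost_le hν hlam h.ρ_pos (fun K hK => hK.1) fun K hK => ?_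
  filter_upwards [h.lipschitz_sample K hK] with s hs
  exact hs.mono (h.le_of_mem hK).2.1 (h.le_of_mem hK).2.2.2

end IsCurvature

lemma iter_eq_orbit (ξ : ℕ → Policy m k × State m) (t : ℕ) :
    iter S η r K₀ ξ t = orbit (S.step η r) K₀ ξ t := by
  induction t with
  | zero => rfl
  | succ t ih => rw [iter, ih]; rfl

lemma step_bounds {D : ℝ} (hD : 0 < D) (hφ : 0 < φ) (hlam : 0 < lam)
    (h : η ≤ maxStep D ε φ lam ρ μ) :
    η * (240 * φ * D * lam ^ 2) ≤ ε * μ ∧ η ≤ 1 / (2 * φ) ∧ η * (D * lam) ≤ ρ := by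
  rw [maxStep, le_min_iff, le_min_iff] at h
  exact ⟨(le_div_iff₀ (by positivity)).1 h.1.1, h.1.2, (le_div_iff₀ (by positivity)).1 h.2⟩

lemma radius_bounds (hε : 0 < ε) (hμ : 0 < μ) (hφ : 0 < φ) (hr : 0 < r)
    (h : r ≤ maxRadius ε φ lam ρ μ) : φ ^ 2 * r ^ 2 ≤ ε * μ / 120 ∧ r ≤ ρ := by
  rw [maxRadius, le_min_iff, le_min_iff] at h
  refine ⟨?_, h.2⟩
  have h1 : r ^ 2 ≤ (1 / (2 * φ) * Real.sqrt (ε * μ / 30)) ^ 2 :=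
    pow_le_pow_left₀ hr.le h.1.2 2
  rw [mul_pow, Real.sq_sqrt (by positivity)] at h1
  calc φ ^ 2 * r ^ 2 ≤ φ ^ 2 * ((1 / (2 * φ)) ^ 2 * (ε * μ / 30)) := by gcongr
    _ = _ := by field_simp; ring

/-- The two-point method reaches an `ε`-optimal policy with probability greater than `3 / 4`. -/
theorem success_probability (hm : 0 < m) (hk : 0 < k) (hν : IsInitialLaw ν Cm)
    (hK₀ : S.cost ν K₀ ≠ ⊤) (hopt : S.IsOptimal ν Kstar)
    (h : IsCurvature S ν Kstar K₀ φK βK lamK ζK φ lam ρ μ) (hε : 0 < ε)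
    (hlog : ε * Real.log (120 * S.gap ν Kstar K₀ / ε) < 10 / 3 * S.gap ν Kstar K₀)
    (hη : 0 < η) (hη' : η ≤ maxStep ((m : ℝ) * k) ε φ lam ρ μ)
    (hr : 0 < r) (hr' : r ≤ maxRadius ε φ lam ρ μ)
    {Ω : Type*} [MeasurableSpace Ω] (P : Measure Ω) [IsProbabilityMeasure P]
    (ξ : ℕ → Ω → Policy m k × State m) (hξ : ∀ t, Measurable (ξ t))
    (hlaw : ∀ t, P.map (ξ t) = (uniformSphere m k).prod ν) (hind : iIndepFun ξ P) :
    3 / 4 < P {ω |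
      (∀ t < numIter η μ (S.gap ν Kstar K₀) ε,
        S.sampleCost (iter S η r K₀ (fun i => ξ i ω) t + r • (ξ t ω).1) (ξ t ω).2 ≠ ⊤ ∧
        S.sampleCost (iter S η r K₀ (fun i => ξ i ω) t - r • (ξ t ω).1) (ξ t ω).2 ≠ ⊤) ∧
      S.cost ν (iter S η r K₀ (fun i => ξ i ω) (numIter η μ (S.gap ν Kstar K₀) ε)) ≠ ⊤ ∧
      S.gap ν Kstar (iter S η r K₀ (fun i => ξ i ω) (numIter η μ (S.gap ν Kstar K₀) ε)) ≤ ε} := by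
  have := isProbabilityMeasure_uniformSphere hm hk
  have := hν.isProb
  have hst : S.cost ν Kstar ≠ ⊤ := hopt.cost_ne_top hK₀
  set d := S.gap ν Kstar K₀ with hd
  have hd0 : 0 < d := by
    refine (hopt.gap_nonneg hK₀).lt_of_ne fun h0 => ?_
    rw [← hd] at h0
    -- If d = 0, then `Real.log 0 = 0` and the hypothesis on ε reads 0 < 0.
    simp [← h0] at hlog
  have hreg := h.isRegular hopt hK₀
  rw [← hd] at hreg
  have hφ := hreg.φ_pos
  have hlam := hreg.lam_pos
  have hμ := hreg.pl.1
  have hs := h.ae_norm_fderiv_le hν hlam.le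
  have hD : (0 : ℝ) < (m : ℝ) * k := by positivity
  obtain ⟨hη1, hη2, hη3⟩ := step_bounds hD hφ hlam hη'
  obtain ⟨hr1, hr2⟩ := radius_bounds hε hμ hφ hr hr'
  simp only [iter_eq_orbit]
  rcases le_or_gt (120 * d / ε) 1 with hz | hz
  -- A nonpositive logarithm means no iteration at all, and then d ≤ ε already.
  · have hT : numIter η μ d ε = 0 := by
      refine Nat.ceil_eq_zero.2 (mul_nonpos_of_nonneg_of_nonpos (by positivity)
        (Real.log_nonpos (by positivity) hz))
    have hdε : d ≤ ε := by
      rw [div_le_one hε] at hz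
      linarith
    have huniv : {ω | (∀ t < numIter η μ d ε,
        S.sampleCost (orbit (S.step η r) K₀ (fun i => ξ i ω) t + r • (ξ t ω).1) (ξ t ω).2 ≠ ⊤ ∧
        S.sampleCost (orbit (S.step η r) K₀ (fun i => ξ i ω) t - r • (ξ t ω).1) (ξ t ω).2 ≠ ⊤) ∧
      S.cost ν (orbit (S.step η r) K₀ (fun i => ξ i ω) (numIter η μ d ε)) ≠ ⊤ ∧
      S.gap ν Kstar (orbit (S.step η r) K₀ (fun i => ξ i ω) (numIter η μ d ε)) ≤ ε} =
        Set.univ := by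
      ext ω
      simp [hT, orbit, hK₀, ← hd, hdε]
    rw [huniv, measure_univ]
    exact ENNReal.div_lt_of_lt_mul (by norm_num)
  have hK₀G : K₀ ∈ sublevel (S.cost ν) Kstar (10 * d) := hopt.mem_boundedSet hK₀
  have hμφ : μ ≤ 205 / 100 * φ := hreg.le_of_gap_pos hK₀G hd0
  have hεd : ε ≤ 120 * d := by
    rw [one_lt_div hε] at hz
    exact hz.le
  have hrd : φ ^ 2 * r ^ 2 ≤ d * μ := by
    refine hr1.trans ?_
    nlinarith
  have hημ : η * μ ≤ 205 / 200 := by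
    calc η * μ ≤ 1 / (2 * φ) * (205 / 100 * φ) := by gcongr
      _ = 205 / 200 := by field_simp; norm_num
  obtain ⟨n, hn⟩ : ∃ n, n + 1 = numIter η μ d ε := by
    refine ⟨numIter η μ d ε - 1, Nat.succ_pred_eq_of_pos (Nat.ceil_pos.2 ?_)⟩
    have := Real.log_pos hz
    positivity
  have hnum := failure_bound_lt hd0 hε hμ hη hημ hlog hz hn
  set M : ℝ := 9 / 2 * d with hM
  have hM0 : 0 < M := by positivity
  set Φ := S.subopt ν Kstar with hΦ
  have hΦm : Measurable Φ := System.measurable_subopt hν Kstar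
  have hF : Measurable fun p : Policy m k × (Policy m k × State m) => S.step η r p.1 p.2 :=
    measurable_fst.sub ((S.measurable_gradEst r).const_smul η)
  have hΦM : ∀ K, Φ K ≤ ENNReal.ofReal M → K ∈ sublevel (S.cost ν) Kstar M := fun K hK =>
    (System.subopt_le_ofReal_iff hst hM0.le).1 hK
  have hball : ∀ K, Φ K ≤ ENNReal.ofReal M → ∀ v, ‖v‖ ≤ r →
      K + v ∈ sublevel (S.cost ν) Kstar (10 * d) := fun K hK v hv =>
    hreg.add_mem_sublevel hμφ hd0 hr2 hrd (hΦM K hK) hv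
  have hΦ₀ : Φ K₀ = ENNReal.ofReal d := System.subopt_eq hst hK₀
  have hq0 : 0 ≤ 1 - η * μ / 2 := by linarith
  have hstep : ∀ K, Φ K ≤ ENNReal.ofReal M →
      ∫⁻ z, Φ (S.step η r K z) ∂(uniformSphere m k).prod ν ≤
        Φ K + ENNReal.ofReal (η * ε * μ / 240) ∧
      ∫⁻ z, Φ (S.step η r K z) ∂(uniformSphere m k).prod ν ≤
        ENNReal.ofReal (1 - η * μ / 2) * Φ K + ENNReal.ofReal (η * ε * μ / 160) := fun K hK => by
    have h1 := System.lintegral_subopt_step_le_of_params hm hk hν hreg hs hr hr2 hη hη3 hr1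
      (by linarith) (hball K hK)
    have h2 := (hΦM K hK).1
    have h3 := hopt.gap_nonneg h2
    rwa [ENNReal.ofReal_add h3 (by positivity),
      ENNReal.ofReal_add (mul_nonneg hq0 h3) (by positivity), ENNReal.ofReal_mul hq0,
      ← System.subopt_eq hst h2] at h1
  -- There are n + 1 steps, and confinement is needed only up to time n, when the cost is last
  -- queried. The final iterate is controlled by its expectation on this event.
  set E := {ω | (fun i => ξ i ω) ∈ staysIn (S.step η r) K₀ {x | Φ x ≤ ENNReal.ofReal M} n} with hE
  have hΦ₀M : Φ K₀ ≤ ENNReal.ofReal M := by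
    rw [hΦ₀]
    exact ENNReal.ofReal_le_ofReal (by linarith)
  obtain ⟨hex, hdr⟩ := lintegral_orbit_add_exit_le hξ hlaw hind hF hΦm hΦ₀M
    (fun K hK => (hstep K hK).1) n
  -- ε / 80 is the fixed point of c = (1 - ημ/2) c + ηεμ/160.
  have hco := lintegral_orbit_le_of_contraction (x₀ := K₀) (c := ENNReal.ofReal (ε / 80)) hξ hlaw
    hind hF hΦm (measurableSet_le hΦm (measurable_const (a := ENNReal.ofReal M)))
    (by
      rw [← ENNReal.ofReal_mul hq0, ← ENNReal.ofReal_add (by positivity) (by positivity)]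
      congr 1
      ring) (fun K hK => (hstep K hK).2) n
  rw [← hE] at hex hdr hco
  have hPE : P Eᶜ ≤ ENNReal.ofReal ((d + n * (η * ε * μ / 240)) / M) := by
    rw [ENNReal.ofReal_div_of_pos hM0, ENNReal.le_div_iff_mul_le
      (Or.inl (ENNReal.ofReal_pos.2 hM0).ne') (Or.inl ENNReal.ofReal_ne_top), mul_comm]
    refine (le_add_self.trans hex).trans (le_of_eq ?_)
    rw [hΦ₀, ENNReal.ofReal_add hd0.le (by positivity), ENNReal.ofReal_mul (Nat.cast_nonneg n),
      ENNReal.ofReal_natCast]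
  set w := min (d + (n + 1 : ℕ) * (η * ε * μ / 240))
    ((1 - η * μ / 2) ^ (n + 1) * d + ε / 80) with hw
  have hw0 : 0 ≤ w := le_min (by positivity) (by positivity)
  have hW : ∫⁻ ω in E, Φ (orbit (S.step η r) K₀ (fun i => ξ i ω) (n + 1)) ∂P ≤
      ENNReal.ofReal w := by
    rw [hw, ENNReal.ofReal_min]
    refine le_min ?_ ?_
    · refine (le_self_add.trans hdr).trans (le_of_eq ?_)
      rw [hΦ₀, ENNReal.ofReal_add hd0.le (by positivity), ENNReal.ofReal_mul (Nat.cast_nonneg _),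
        ENNReal.ofReal_natCast]
    · refine hco.trans (le_of_eq ?_)
      rw [hΦ₀, ENNReal.ofReal_add (by positivity) (by positivity),
        ENNReal.ofReal_mul (by positivity), ENNReal.ofReal_pow hq0]
  have hPbad : P (E ∩ {ω | ENNReal.ofReal ε ≤
      Φ (orbit (S.step η r) K₀ (fun i => ξ i ω) (n + 1))}) ≤ ENNReal.ofReal (w / ε) := by
    have hm1 : Measurable fun ω => Φ (orbit (S.step η r) K₀ (fun i => ξ i ω) (n + 1)) :=
      hΦm.comp ((measurable_orbit hF K₀ (n + 1)).comp (measurable_pi_lambda _ hξ))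
    rw [ENNReal.ofReal_div_of_pos hε, ENNReal.le_div_iff_mul_le
      (Or.inl (ENNReal.ofReal_pos.2 hε).ne') (Or.inl ENNReal.ofReal_ne_top), mul_comm]
    refine le_trans ?_ ((mul_meas_ge_le_lintegral (μ := P.restrict E) hm1
      (ENNReal.ofReal ε)).trans hW)
    rw [Measure.restrict_apply (measurableSet_le measurable_const hm1), Set.inter_comm]
  have hnull : P {ω | ∀ t, ‖(ξ t ω).1‖ = 1}ᶜ = 0 := by
    have h1 : ∀ t, ∀ᵐ ω ∂P, ‖(ξ t ω).1‖ = 1 := fun t => by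
      have h2 : ∀ᵐ z ∂P.map (ξ t), ‖z.1‖ = 1 := by
        rw [hlaw t]
        exact Measure.quasiMeasurePreserving_fst.ae ae_norm_uniformSphere
      exact ae_of_ae_map (hξ t).aemeasurable h2
    exact ae_all_iff.2 h1
  set good := {ω | (∀ t < numIter η μ d ε,
        S.sampleCost (orbit (S.step η r) K₀ (fun i => ξ i ω) t + r • (ξ t ω).1) (ξ t ω).2 ≠ ⊤ ∧
        S.sampleCost (orbit (S.step η r) K₀ (fun i => ξ i ω) t - r • (ξ t ω).1) (ξ t ω).2 ≠ ⊤) ∧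
      S.cost ν (orbit (S.step η r) K₀ (fun i => ξ i ω) (numIter η μ d ε)) ≠ ⊤ ∧
      S.gap ν Kstar (orbit (S.step η r) K₀ (fun i => ξ i ω) (numIter η μ d ε)) ≤ ε} with hgood
  -- Failure needs a direction off the unit sphere (a null event), an early exit, or a large final
  -- gap without exit. Otherwise both query points have finite population cost, so they stabilize
  -- the system and every sample cost there is finite.
  have hcover : goodᶜ ⊆ {ω | ∀ t, ‖(ξ t ω).1‖ = 1}ᶜ ∪ (Eᶜ ∪ (E ∩ {ω | ENNReal.ofReal ε ≤
      Φ (orbit (S.step η r) K₀ (fun i => ξ i ω) (n + 1))})) := by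
    intro ω hω
    by_contra hcon
    simp only [Set.mem_union, not_or, Set.mem_compl_iff, not_not, Set.mem_inter_iff, not_and,
      Set.mem_ofPred_eq, not_le] at hcon
    obtain ⟨hu, hEω, hlt⟩ := hcon
    have h1 := (System.subopt_le_ofReal_iff hst hε.le).1 (hlt hEω).le
    rw [hn] at h1
    refine hω ⟨fun t ht => ?_, h1.1, h1.2⟩
    have h2 : Φ (orbit (S.step η r) K₀ (fun i => ξ i ω) t) ≤ ENNReal.ofReal M :=
      hEω t (by omega)
    have hru : ‖r • (ξ t ω).1‖ ≤ r := by
      rw [norm_smul, hu t, Real.norm_eq_abs, abs_of_pos hr, mul_one]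
    have h3 : ∀ v, ‖v‖ ≤ r → S.sampleCost (orbit (S.step η r) K₀ (fun i => ξ i ω) t + v)
        (ξ t ω).2 ≠ ⊤ := fun v hv => by
      rw [((System.cost_ne_top_iff hν _).1 (hball _ h2 v hv).1).sampleCost_eq]
      exact ENNReal.ofReal_ne_top
    refine ⟨h3 _ hru, ?_⟩
    rw [sub_eq_add_neg]
    exact h3 _ (by rwa [norm_neg])
  have hfail : P goodᶜ ≤ ENNReal.ofReal ((d + n * (η * ε * μ / 240)) / M + w / ε) := by
    refine (measure_mono hcover).trans ((measure_union_le _ _).trans ?_)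
    rw [hnull, zero_add, ENNReal.ofReal_add (by positivity) (by positivity)]
    exact (measure_union_le _ _).trans (add_le_add hPE hPbad)
  have hfail' : P goodᶜ < 1 / 4 := by
    refine hfail.trans_lt ?_
    rw [ENNReal.ofReal_lt_iff_lt_toReal (by positivity) (by simp)]
    simpa using hnum
  have htotal : (1 : ℝ≥0∞) ≤ P good + P goodᶜ := by
    rw [← measure_univ (μ := P), ← Set.union_compl_self good]
    exact measure_union_le _ _
  by_contra! hle
  have h34 : (3 / 4 : ℝ≥0∞) + 1 / 4 = 1 := by
    rw [← ENNReal.add_div, show (3 : ℝ≥0∞) + 1 = 4 by norm_num]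
    exact ENNReal.div_self (by norm_num) (by norm_num)
  have hlt : P good + P goodᶜ < 3 / 4 + 1 / 4 :=
    ENNReal.add_lt_add_of_le_of_lt (measure_ne_top _ _) hle hfail'
  exact absurd (htotal.trans_lt hlt) (by rw [h34]; exact lt_irrefl _)

end LQR

theorem corollary2 {m k : ℕ} (hm : 0 < m) (hk : 0 < k) (S : LQR.System m k)
    (ν : Measure (LQR.State m)) (Cm : ℝ) (hν : LQR.IsInitialLaw ν Cm)
    (K₀ : LQR.Policy m k) (hK₀ : S.cost ν K₀ ≠ ⊤) :
    -- an optimal policy exists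
    (∃ Kstar, S.IsOptimal ν Kstar) ∧
    ∀ Kstar, S.IsOptimal ν Kstar →
      -- finite and positive curvature parameters exist
      (∃ (φK βK lamK ζK : LQR.Policy m k → ℝ) (φ lam ρ μ : ℝ),
        LQR.IsCurvature S ν Kstar K₀ φK βK lamK ζK φ lam ρ μ) ∧
      -- and for any choice of them
      ∀ (φK βK lamK ζK : LQR.Policy m k → ℝ) (φ lam ρ μ : ℝ),
        LQR.IsCurvature S ν Kstar K₀ φK βK lamK ζK φ lam ρ μ →
        ∀ ε : ℝ, 0 < ε →
          ε * Real.log (120 * S.gap ν Kstar K₀ / ε) < 10 / 3 * S.gap ν Kstar K₀ →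
          -- the method succeeds with probability greater than 3/4
          (∀ η r : ℝ, 0 < η → η ≤ LQR.maxStep ((m : ℝ) * k) ε φ lam ρ μ →
            0 < r → r ≤ LQR.maxRadius ε φ lam ρ μ →
            ∀ {Ω : Type*} [MeasurableSpace Ω] (P : Measure Ω) [IsProbabilityMeasure P]
              (ξ : ℕ → Ω → LQR.Policy m k × LQR.State m),
              (∀ t, Measurable (ξ t)) →
              (∀ t, P.map (ξ t) = (LQR.uniformSphere m k).prod ν) →
              iIndepFun ξ P →
              3 / 4 < P {ω |
                -- all cost evaluations that the method makes are finite
                (∀ t < LQR.numIter η μ (S.gap ν Kstar K₀) ε,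
                  S.sampleCost (LQR.iter S η r K₀ (fun i => ξ i ω) t + r • (ξ t ω).1) (ξ t ω).2 ≠ ⊤ ∧
                  S.sampleCost (LQR.iter S η r K₀ (fun i => ξ i ω) t - r • (ξ t ω).1) (ξ t ω).2 ≠ ⊤) ∧
                -- and the last iterate is `ε`-optimal
                S.cost ν (LQR.iter S η r K₀ (fun i => ξ i ω)
                  (LQR.numIter η μ (S.gap ν Kstar K₀) ε)) ≠ ⊤ ∧
                S.gap ν Kstar (LQR.iter S η r K₀ (fun i => ξ i ω)
                  (LQR.numIter η μ (S.gap ν Kstar K₀) ε)) ≤ ε}) ∧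
          -- and with the largest step size the number of two-point queries is `Õ(D / ε)`
          (LQR.numIter (LQR.maxStep ((m : ℝ) * k) ε φ lam ρ μ) μ (S.gap ν Kstar K₀) ε : ℝ) ≤
            4 / μ * (240 * φ * lam ^ 2 / μ + 2 * φ * ε + lam * ε / ρ) * (((m : ℝ) * k) / ε) *
              max 0 (Real.log (120 * S.gap ν Kstar K₀ / ε)) + 1 := by
  refine ⟨LQR.System.exists_isOptimal hν hK₀, fun Kstar hopt =>
    ⟨hopt.exists_isCurvature hν hK₀, fun φK βK lamK ζK φ lam ρ μ h ε hε hlog => ⟨?_, ?_⟩⟩⟩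
  · intro η r hη hη' hr hr' Ω _ P _ ξ hξ hlaw hind
    exact LQR.success_probability hm hk hν hK₀ hopt h hε hlog hη hη' hr hr' P ξ hξ hlaw hind
  · have hreg := h.isRegular hopt hK₀
    refine LQR.numIter_maxStep_le hε hreg.pl.1 ?_ hreg.φ_pos hreg.lam_pos hreg.ρ_pos
    exact_mod_cast Nat.mul_pos hm hk
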